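/- Let $k$ be an algebraically closed field of characteristic $0$, let $K\supset k$ be a field, and let $C$ be a smooth projective (integral) curve over $K$. Let $\mathcal D=\sum_i m_ic_i$, $m_i\ge 1$, be an effective divisor with distinct $c_i\in C(K)$. Put $D=\sum_i c_i$, $\mathcal D'=\mathcal D-D$, and $j:U=C-D\hookrightarrow C$. Differential forms without a subscript $/K$ are relative to $k$; in particular $\Omega^i_K=\Omega^i_{K/k}$. Let $\Omega^1_C\langle D\rangle$ be the sheaf of absolute $1$-forms with logarithmic poles along $D$. Let $L$ be a line bundle on $U$ with an absolute connection $\nabla:L\to L\otimes\Omega^1_U$ with vertical curvature, i.e. $\nabla^2(L)\subset L\otimes\Omega^2_K\otimes K(C)$, and let $\nabla_{/K}$ be the relative connection that it induces. Consider extensions of $L$ to line bundles $\mathcal L$ on $C$ such that $\nabla_{/K}$ maps $\mathcal L$ to $\mathcal L\otimes\Omega^1_{C/K}(\mathcal D)$ and has a pole at every $c_i$, and such that $$\{\mathcal L\to\mathcal L\otimes\Omega^1_{C/K}(\mathcal D)\}\longrightarrow\{j_*L\to j_*(L\otimes\Omega^1_{U/K})\}$$ is a quasi-isomorphism. For such an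 extension, $\nabla_{/K}$ induces an $\mathcal O_{\mathcal D}$-linear isomorphism $\mathcal L|_{\mathcal D}\cong\mathcal L\otimes\Omega^1_{C/K}(\mathcal D)|_{\mathcal D}$. It is multiplication by a generator $\mathrm{triv}\,\nabla$ of $\Omega^1_{C/K}(\mathcal D)|_{\mathcal D}$, and hence there is a class $$(c_1(\Omega^1_{C/K}(\mathcal D)),\mathrm{triv}\,\nabla)\in\mathbb H^1(C,\mathcal O^*_C\to\mathcal O^*_{\mathcal D})=H^1(C,\mathcal O^*_{C,\mathcal D}),\qquad \mathcal O^*_{C,\mathcal D}=\ker(\mathcal O^*_C\to\mathcal O^*_{\mathcal D}).$$ The connection $\nabla$ extends to $\mathcal L\to\mathcal L\otimes\Omega^1_C\langle D\rangle(\mathcal D')$ and so defines a class $(\mathcal L,\nabla)\in\mathbb H^1(C,\mathcal O^*_C\to\Omega^1_C\langle D\rangle(\mathcal D'))$. Let $\mathcal K_2$ be the Milnor $K_2$-sheaf, mapped to $\Omega^2_C$ by $\{a,b\}\mapsto\frac{da}a\wedge\frac{db}b$. The rules $(\lambda,c)\mapsto\{\lambda,c\}$ and $(\lambda,\omega)\mapsto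 d\log\lambda\wedge\omega$, for $\lambda\in\mathcal O^*_{C,\mathcal D}$, $c\in\mathcal O^*_C$ and $\omega\in\Omega^1_C\langle D\rangle(\mathcal D')$, define a product $\cup$ of classes as above with values in $\mathbb H^2(C,\mathcal K_2\to\Omega^2_C)$; on Čech cocycles, $(\lambda_{ij})\cup(c_{ij},\omega_i)=(\{\lambda_{ij},c_{jk}\},\,d\log\lambda_{ij}\wedge\omega_j)$. Let $$\mathrm{Tr}:\mathbb H^2(C,\mathcal K_2\to\Omega^2_C)=H^1(C,\Omega^2_C)/H^1(C,\mathcal K_2)\longrightarrow\Omega^1_K/d\log K^*$$ be the trace induced by $H^1(C,\Omega^2_C)\to\Omega^1_K\otimes_K H^1(C,\Omega^1_{C/K})\to\Omega^1_K$, the last map being given by the trace (sum of residues) on $H^1(C,\Omega^1_{C/K})$. Write $A\cdot B=\mathrm{Tr}(A\cup B)$. **Theorem.** Let $(\mathcal L,\nabla)$ and $(\mathcal L',\nabla')$ be two such extensions of $(L,\nabla)$. Then the pairings below are well defined, and $$(c_1(\Omega^1_{C/K}(\mathcal D)),\mathrm{triv}\,\nabla)\cdot(\mathcal L,\nabla)=(c_1(\Omega^1_{C/K}(\mathcal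 D)),\mathrm{triv}\,\nabla')\cdot(\mathcal L',\nabla')\quad\text{in }\Omega^1_K/d\log K^*.$$ -/

import Mathlib

open AlgebraicGeometry CategoryTheory TopologicalSpace
open scoped TensorProduct

universe u v w

noncomputable section

namespace CurvePairing

/-! ## Differential forms on a field extension -/

section Forms

variable (k : Type v) {K : Type u} {F : Type w} [Field k] [Field K] [Field F] [Algebra k K]
  [Algebra k F] [Algebra K F] [IsScalarTower k K F]

theorem update_zero {M : Type*} (x y z : M) : Function.update ![x, y] 0 z = ![z, y] := by
  ext i; fin_cases i <;> rfl

theorem update_one {M : Type*} (x y z : M) : Function.update ![x, y] 1 z = ![x, z] := by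
  ext i; fin_cases i <;> rfl

/-- The wedge product of two (absolute) `1`-forms. -/
def wedge : Ω[F⁄k] →ₗ[F] Ω[F⁄k] →ₗ[F] ⋀[F]^2 Ω[F⁄k] :=
  LinearMap.mk₂ F (fun a b => exteriorPower.ιMulti F 2 ![a, b])
    (fun a a' b => by
      simpa only [update_zero, update_one] using (exteriorPower.ιMulti F 2 (M := Ω[F⁄k])).map_update_add ![0, b] 0 a a')
    (fun c a b => by
      simpa only [update_zero, update_one] using (exteriorPower.ιMulti F 2 (M := Ω[F⁄k])).map_update_smul ![0, b] 0 c a)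
    (fun a b b' => by
      simpa only [update_zero, update_one] using (exteriorPower.ιMulti F 2 (M := Ω[F⁄k])).map_update_add ![a, 0] 1 b b')
    (fun c a b => by
      simpa only [update_zero, update_one] using (exteriorPower.ιMulti F 2 (M := Ω[F⁄k])).map_update_smul ![a, 0] 1 c b)

theorem wedge_apply (a b : Ω[F⁄k]) : wedge k a b = exteriorPower.ιMulti F 2 ![a, b] := rfl

theorem wedge_self (a : Ω[F⁄k]) : wedge k a a = 0 := by
  rw [wedge_apply]
  exact (exteriorPower.ιMulti F 2).map_eq_zero_of_eq ![a, a] (i := 0) (j := 1) rfl (by decide)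

theorem wedge_swap (a b : Ω[F⁄k]) : wedge k a b = - wedge k b a := by
  have h := wedge_self k (a + b)
  simp only [map_add, LinearMap.add_apply, wedge_self, zero_add, add_zero] at h
  rw [eq_neg_iff_add_eq_zero, add_comm]
  exact h

/-- The map on `F`-linear combinations of symbols underlying the exterior derivative. -/
def extDerivAux : (F →₀ F) →+ ⋀[F]^2 Ω[F⁄k] :=
  Finsupp.liftAddHom fun b =>
    ((wedge k).flip (KaehlerDifferential.D k F b)).toAddMonoidHom.comp
      (KaehlerDifferential.D k F).toLinearMap.toAddMonoidHom

theorem extDerivAux_single (a b : F) :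
    extDerivAux k (Finsupp.single b a) =
      wedge k (KaehlerDifferential.D k F a) (KaehlerDifferential.D k F b) := by
  simp [extDerivAux]

theorem extDerivAux_eq_zero (x : F →₀ F) (hx : x ∈ KaehlerDifferential.kerTotal k F) :
    extDerivAux k x = 0 := by
  suffices h : ∀ c : F, extDerivAux k (c • x) = 0 by simpa using h 1
  unfold KaehlerDifferential.kerTotal at hx
  induction hx using Submodule.span_induction with
  | zero => intro c; simp
  | add a b _ _ ha hb => intro c; rw [smul_add, map_add, ha, hb, add_zero]
  | smul r a _ ha => intro c; rw [smul_smul]; exact ha _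
  | mem a ha =>
    intro c
    rcases ha with (⟨⟨p, q⟩, rfl⟩ | ⟨⟨p, q⟩, rfl⟩) | ⟨r, rfl⟩
    · simp only [smul_add, smul_sub, map_add, map_sub, Finsupp.smul_single, extDerivAux_single]
      abel
    · simp only [smul_add, smul_sub, map_add, map_sub, Finsupp.smul_single, extDerivAux_single,
        smul_eq_mul, Derivation.leibniz, LinearMap.add_apply, map_smul, LinearMap.smul_apply,
        mul_one]
      rw [wedge_swap k (KaehlerDifferential.D k F q) (KaehlerDifferential.D k F p)]
      module
    · simp [extDerivAux_single]

/-- The exterior derivative `d : Ω¹ → Ω²`, `a db ↦ da ∧ db`. -/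
def extDeriv : Ω[F⁄k] →+ ⋀[F]^2 Ω[F⁄k] :=
  (QuotientAddGroup.lift (KaehlerDifferential.kerTotal k F).toAddSubgroup (extDerivAux k)
    (fun x hx => extDerivAux_eq_zero k x hx)).comp
    (KaehlerDifferential.quotKerTotalEquiv k F).symm.toLinearMap.toAddMonoidHom

theorem extDeriv_smul_D (a b : F) :
    extDeriv k (a • KaehlerDifferential.D k F b) =
      wedge k (KaehlerDifferential.D k F a) (KaehlerDifferential.D k F b) := by
  have h : (KaehlerDifferential.quotKerTotalEquiv k F).symm (a • KaehlerDifferential.D k F b) =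
      (KaehlerDifferential.kerTotal k F).mkQ (Finsupp.single b a) := by
    rw [LinearEquiv.symm_apply_eq]
    exact (by simp : a • KaehlerDifferential.D k F b =
      Finsupp.linearCombination F (KaehlerDifferential.D k F) (Finsupp.single b a))
  rw [← extDerivAux_single]
  exact congrArg (QuotientAddGroup.lift (KaehlerDifferential.kerTotal k F).toAddSubgroup
    (extDerivAux k) (fun x hx => extDerivAux_eq_zero k x hx)) h

theorem extDeriv_smul (a : F) (ω : Ω[F⁄k]) :
    extDeriv k (a • ω) = wedge k (KaehlerDifferential.D k F a) ω + a • extDeriv k ω := by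
  have hω : ω ∈ Submodule.span F (Set.range (KaehlerDifferential.D k F)) := by
    rw [KaehlerDifferential.span_range_derivation]; trivial
  suffices h : ∀ c : F, extDeriv k (a • c • ω) =
      wedge k (KaehlerDifferential.D k F a) (c • ω) + a • extDeriv k (c • ω) by
    simpa using h 1
  induction hω using Submodule.span_induction with
  | zero => intro c; simp
  | add x y _ _ hx hy =>
    intro c
    simp only [smul_add, map_add] at hx hy ⊢
    rw [hx, hy]; abel
  | smul r x _ hx => intro c; rw [smul_smul c r x]; exact hx _
  | mem x hx =>
    intro c
    obtain ⟨b, rfl⟩ := hx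
    rw [smul_smul, extDeriv_smul_D, extDeriv_smul_D, Derivation.leibniz, map_add,
      LinearMap.add_apply, map_smul, map_smul, map_smul, LinearMap.smul_apply,
      LinearMap.smul_apply, add_comm]

/-- The pull-back `Ω¹_{K/k} → Ω¹_{F/k}`. -/
def pullForm : Ω[K⁄k] →ₗ[K] Ω[F⁄k] := KaehlerDifferential.map k k K F

/-- The projection `Ω¹_{F/k} → Ω¹_{F/K}` from absolute to relative forms. -/
def relForm (K : Type u) [Field K] [Algebra k K] [Algebra K F] [IsScalarTower k K F] :
    Ω[F⁄k] →ₗ[F] Ω[F⁄K] :=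
  KaehlerDifferential.map k K F F

/-- `Ω²_K ⊗ F`, as a subspace of `Ω²_F`. -/
def baseForms₂ (K : Type u) (F : Type w) [Field K] [Field F] [Algebra k K] [Algebra k F]
    [Algebra K F] [IsScalarTower k K F] : Submodule F (⋀[F]^2 Ω[F⁄k]) :=
  Submodule.span F
    (Set.image2 (fun τ τ' : Ω[K⁄k] => wedge k (pullForm (F := F) k τ) (pullForm k τ'))
      Set.univ Set.univ)

/-- The logarithmic differential `a ↦ da / a`. -/
def dlog (F : Type w) [Field F] [Algebra k F] : Additive Fˣ →+ Ω[F⁄k] :=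
  AddMonoidHom.mk' (fun a => ((a.toMul⁻¹ : Fˣ) : F) • KaehlerDifferential.D k F (a.toMul : F))
    (fun a b => by
      simp only [toMul_add, mul_inv, Units.val_mul, Derivation.leibniz, smul_add, smul_smul]
      rw [add_comm]
      congr 2
      · rw [mul_assoc, mul_comm, mul_assoc]; simp
      · rw [mul_comm (((Additive.toMul a)⁻¹ : Fˣ) : F), mul_assoc]; simp)

theorem dlog_apply (a : Additive Fˣ) : dlog k F a =
    ((a.toMul⁻¹ : Fˣ) : F) • KaehlerDifferential.D k F (a.toMul : F) := rfl

/-- Milnor's `K₂` of a field, written additively. -/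
def MilnorK₂ (F : Type w) [Field F] : Type w :=
  (Additive Fˣ ⊗[ℤ] Additive Fˣ) ⧸ AddSubgroup.closure
    {t | ∃ a b : Fˣ, (a : F) + b = 1 ∧ t = Additive.ofMul a ⊗ₜ[ℤ] Additive.ofMul b}

instance (F : Type w) [Field F] : AddCommGroup (MilnorK₂ F) :=
  inferInstanceAs (AddCommGroup ((Additive Fˣ ⊗[ℤ] Additive Fˣ) ⧸ AddSubgroup.closure
    {t | ∃ a b : Fˣ, (a : F) + b = 1 ∧ t = Additive.ofMul a ⊗ₜ[ℤ] Additive.ofMul b}))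

/-- The projection onto `K₂`. -/
def MilnorK₂.mk (F : Type w) [Field F] : (Additive Fˣ ⊗[ℤ] Additive Fˣ) →+ MilnorK₂ F :=
  QuotientAddGroup.mk' _

/-- The Steinberg symbol `{a, b}`. -/
def symb : Additive Fˣ →+ Additive Fˣ →+ MilnorK₂ F :=
  AddMonoidHom.mk' (fun a => (MilnorK₂.mk F).comp (TensorProduct.mk ℤ _ _ a).toAddMonoidHom)
    (fun a b => by ext c; simp)

/-- The map `a ⊗ b ↦ dlog a ∧ dlog b`. -/
def dlogTensor (F : Type w) [Field F] [Algebra k F] :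
    (Additive Fˣ ⊗[ℤ] Additive Fˣ) →+ ⋀[F]^2 Ω[F⁄k] :=
  TensorProduct.liftAddHom
    (AddMonoidHom.mk' (fun a => (wedge k (dlog k F a)).toAddMonoidHom.comp (dlog k F))
      (fun a b => by ext c; simp))
    (fun r m n => by simp)

theorem dlogTensor_tmul (a b : Additive Fˣ) :
    dlogTensor k F (a ⊗ₜ b) = wedge k (dlog k F a) (dlog k F b) := rfl

/-- The map `dlog : K₂ → Ω²`, `{a, b} ↦ dlog a ∧ dlog b`. -/
def dlog₂ (F : Type w) [Field F] [Algebra k F] : MilnorK₂ F →+ ⋀[F]^2 Ω[F⁄k] :=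
  QuotientAddGroup.lift _ (dlogTensor k F) (by
    rw [AddSubgroup.closure_le]
    rintro _ ⟨a, b, hab, rfl⟩
    change dlogTensor k F _ = 0
    have hb : KaehlerDifferential.D k F (b : F) = - KaehlerDifferential.D k F (a : F) := by
      rw [eq_neg_iff_add_eq_zero, ← map_add, add_comm, hab, Derivation.map_one_eq_zero]
    rw [dlogTensor_tmul, dlog_apply, dlog_apply]
    simp [hb, wedge_self])

theorem dlog₂_symb (a b : Additive Fˣ) :
    dlog₂ k F (symb a b) = wedge k (dlog k F a) (dlog k F b) := rfl

/-- `Ω¹_K / dlog K^*`, the group of isomorphism classes of rank one connections on `Spec K`. -/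
abbrev DlogQuotient (K : Type u) [Field K] [Algebra k K] : Type u :=
  Ω[K⁄k] ⧸ (dlog k K).range

end Forms

/-! ## Local conditions at a point

`O` is the local ring of a point, seen inside the function field `F`. -/

section Local

variable {k : Type v} {K : Type u} {F : Type w} [Field k] [Field K] [Field F]
  [Algebra k F] [Algebra K F] (O : Subalgebra K F)

/-- The stalk of `Ω¹` (relative to the base field `R`), inside `Ω¹_{F/R}`. -/
def regularForms (R : Type*) [Field R] [Algebra R F] : Submodule O Ω[F⁄R] :=
  Submodule.span O (KaehlerDifferential.D R F '' (O : Set F))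

/-- The stalk of `Ω²`, inside `Ω²_F`. -/
def regularForms₂ (k : Type v) [Field k] [Algebra k F] : Submodule O (⋀[F]^2 Ω[F⁄k]) :=
  Submodule.span O (Set.image2
    (fun a b => wedge k (KaehlerDifferential.D k F a) (KaehlerDifferential.D k F b))
    (O : Set F) (O : Set F))

/-- The stalk of `𝒪^*`. -/
def unitStalk : AddSubgroup (Additive Fˣ) where
  carrier := {a | (a.toMul : F) ∈ O ∧ ((a.toMul⁻¹ : Fˣ) : F) ∈ O}
  zero_mem' := by simp
  add_mem' := fun {a b} ha hb => by
    refine ⟨?_, ?_⟩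
    · simpa using mul_mem ha.1 hb.1
    · simpa [mul_comm] using mul_mem ha.2 hb.2
  neg_mem' := fun {a} ha => ⟨by simpa using ha.2, by simpa using ha.1⟩

/-- The stalk of the Milnor `K₂`-sheaf: the subgroup of `K₂(F)` generated by the symbols `{a, b}`
with `a`, `b` units of the local ring. -/
def k₂Stalk : AddSubgroup (MilnorK₂ F) :=
  AddSubgroup.closure {s | ∃ a ∈ unitStalk O, ∃ b ∈ unitStalk O, s = symb a b}

theorem wedge_D_regular {p : F} (hp : p ∈ O) {ω : Ω[F⁄k]} (hω : ω ∈ regularForms O k) :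
    wedge k (KaehlerDifferential.D k F p) ω ∈ regularForms₂ O k := by
  induction hω using Submodule.span_induction with
  | zero => simp
  | add x y _ _ hx hy => rw [map_add]; exact add_mem hx hy
  | smul r x _ hx =>
    rw [show r • x = (r : F) • x from rfl, map_smul]
    exact Submodule.smul_mem _ r hx
  | mem x hx =>
    obtain ⟨b, hb, rfl⟩ := hx
    exact Submodule.subset_span ⟨p, hp, b, hb, rfl⟩

theorem wedge_dlog_dlog {a b : Additive Fˣ} (ha : a ∈ unitStalk O) (hb : b ∈ unitStalk O) :
    dlog₂ k F (symb a b) ∈ regularForms₂ O k := by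
  rw [dlog₂_symb, dlog_apply, dlog_apply, map_smul, map_smul, LinearMap.smul_apply]
  exact Submodule.smul_mem _ (⟨_, hb.2⟩ : O) (Submodule.smul_mem _ (⟨_, ha.2⟩ : O)
    (Submodule.subset_span ⟨_, ha.1, _, hb.1, rfl⟩))

variable [IsLocalRing O]

/-- The units of the local ring that are congruent to `1` modulo the `n`-th power of the
maximal ideal. -/
def congrUnitStalk (n : ℕ) : AddSubgroup (Additive Fˣ) where
  carrier := {a | a ∈ unitStalk O ∧
    ∃ t ∈ IsLocalRing.maximalIdeal O ^ n, (t : F) = (a.toMul : F) - 1}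
  zero_mem' := ⟨zero_mem _, 0, zero_mem _, by simp⟩
  add_mem' := fun {a b} ha hb => by
    obtain ⟨ha, s, hs, hsa⟩ := ha
    obtain ⟨hb, t, ht, htb⟩ := hb
    refine ⟨add_mem ha hb, (⟨_, ha.1⟩ : O) * t + s,
      add_mem (Ideal.mul_mem_left _ _ ht) hs, ?_⟩
    simp [hsa, htb]; ring
  neg_mem' := fun {a} ha => by
    obtain ⟨ha, s, hs, hsa⟩ := ha
    refine ⟨neg_mem ha, - ((⟨_, ha.2⟩ : O) * s), neg_mem (Ideal.mul_mem_left _ _ hs), ?_⟩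
    have : (a.toMul : F) ≠ 0 := Units.ne_zero _
    simp [hsa]; field_simp; ring

/-- The stalk of `Ω¹_{C/K}(n · c)`: forms with poles of order at most `n`. -/
def polarForms (n : ℕ) : Submodule O Ω[F⁄K] where
  carrier := {ω | ∀ g ∈ IsLocalRing.maximalIdeal O ^ n, g • ω ∈ regularForms O K}
  zero_mem' := fun g _ => by simp
  add_mem' := fun ha hb g hg => by rw [smul_add]; exact add_mem (ha g hg) (hb g hg)
  smul_mem' := fun c x hx g hg => by
    rw [smul_comm]; exact Submodule.smul_mem _ _ (hx g hg)

/-- The stalk of `Ω¹_C⟨c⟩`, generated by the regular absolute forms and `dz / z`, `z` a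
uniformizer. -/
def logForms (k : Type v) [Field k] [Algebra k F] : Submodule O Ω[F⁄k] :=
  Submodule.span O (KaehlerDifferential.D k F '' (O : Set F) ∪
    {ω | ∃ z : O, IsLocalRing.maximalIdeal O = Ideal.span {z} ∧
      ω = (z : F)⁻¹ • KaehlerDifferential.D k F (z : F)})

/-- The stalk of `Ω¹_C⟨D⟩(𝒟')` at a point of multiplicity `n` in `𝒟`, where `D` is the support of
`𝒟` and `𝒟' = 𝒟 - D`: regular forms if `n = 0`, and `Ω¹_C⟨c⟩((n - 1) · c)` if `0 < n`. -/
def logPolarForms (k : Type v) [Field k] [Algebra k F] : ℕ → Submodule O Ω[F⁄k]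
  | 0 => regularForms O k
  | n + 1 =>
    { carrier := {ω | ∀ g ∈ IsLocalRing.maximalIdeal O ^ n, g • ω ∈ logForms O k}
      zero_mem' := fun g _ => by simp
      add_mem' := fun ha hb g hg => by rw [smul_add]; exact add_mem (ha g hg) (hb g hg)
      smul_mem' := fun c x hx g hg => by
        rw [smul_comm]; exact Submodule.smul_mem _ _ (hx g hg) }

theorem smul_log {q : O} (hq : q ∈ IsLocalRing.maximalIdeal O) {ω : Ω[F⁄k]}
    (hω : ω ∈ logForms O k) : q • ω ∈ regularForms O k := by
  induction hω using Submodule.span_induction with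
  | zero => simp
  | add x y _ _ hx hy => rw [smul_add]; exact add_mem hx hy
  | smul r x _ hx => rw [smul_comm]; exact Submodule.smul_mem _ r hx
  | mem x hx =>
    rcases hx with hx | ⟨z, hz, rfl⟩
    · exact Submodule.smul_mem _ q (Submodule.subset_span hx)
    · rw [hz, Ideal.mem_span_singleton] at hq
      obtain ⟨t, rfl⟩ := hq
      rcases eq_or_ne (z : F) 0 with h0 | h0
      · simp [h0]
      · rw [show (z * t) • (z : F)⁻¹ • KaehlerDifferential.D k F (z : F) =
          t • KaehlerDifferential.D k F (z : F) by
            change ((z : F) * (t : F)) • (z : F)⁻¹ • KaehlerDifferential.D k F (z : F) =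
              (t : F) • KaehlerDifferential.D k F (z : F)
            rw [smul_smul]; congr 1; field_simp]
        exact Submodule.smul_mem _ t (Submodule.subset_span ⟨_, z.2, rfl⟩)

theorem wedge_D_log {q : O} (hq : q ∈ IsLocalRing.maximalIdeal O) {ω : Ω[F⁄k]}
    (hω : ω ∈ logForms O k) :
    wedge k (KaehlerDifferential.D k F (q : F)) ω ∈ regularForms₂ O k := by
  induction hω using Submodule.span_induction with
  | zero => simp
  | add x y _ _ hx hy => rw [map_add]; exact add_mem hx hy
  | smul r x _ hx =>
    rw [show r • x = (r : F) • x from rfl, map_smul]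
    exact Submodule.smul_mem _ r hx
  | mem x hx =>
    rcases hx with ⟨b, hb, rfl⟩ | ⟨z, hz, rfl⟩
    · exact Submodule.subset_span ⟨q, q.2, b, hb, rfl⟩
    · rw [hz, Ideal.mem_span_singleton] at hq
      obtain ⟨t, rfl⟩ := hq
      rcases eq_or_ne (z : F) 0 with h0 | h0
      · simp [h0]
      · have : wedge k (KaehlerDifferential.D k F ((z * t : O) : F))
            ((z : F)⁻¹ • KaehlerDifferential.D k F (z : F)) =
            wedge k (KaehlerDifferential.D k F (t : F)) (KaehlerDifferential.D k F (z : F)) := by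
          simp [Derivation.leibniz, wedge_self, h0]
        rw [this]
        exact Submodule.subset_span ⟨t, t.2, z, z.2, rfl⟩

theorem wedge_D_logPolar (n j : ℕ) (i : ℕ) (hij : n + 1 ≤ i + j) {ω : Ω[F⁄k]}
    (hω : ω ∈ logPolarForms O k (n + 1)) (p : O) (hp : p ∈ IsLocalRing.maximalIdeal O ^ j)
    (g : O) (hg : g ∈ IsLocalRing.maximalIdeal O ^ i) :
    g • wedge k (KaehlerDifferential.D k F (p : F)) ω ∈ regularForms₂ O k := by
  have hω' : ∀ g ∈ IsLocalRing.maximalIdeal O ^ n, g • ω ∈ logForms O k := hω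
  have hsm : ∀ (g : O) (α β : Ω[F⁄k]), g • wedge k α β = wedge k α (g • β) := fun g α β => by
    rw [show g • β = (g : F) • β from rfl, map_smul]; rfl
  induction j generalizing i p g with
  | zero =>
    rw [hsm]
    refine wedge_D_regular O p.2 ?_
    have hg' : g ∈ IsLocalRing.maximalIdeal O * IsLocalRing.maximalIdeal O ^ n := by
      rw [← pow_succ']; exact Ideal.pow_le_pow_right (by omega) hg
    clear hg
    induction hg' using Submodule.mul_induction_on' with
    | mem_mul_mem a ha b hb =>
      rw [mul_smul]; exact smul_log O ha (hω' b hb)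
    | add x hx y hy h1 h2 => rw [add_smul]; exact add_mem h1 h2
  | succ j ih =>
    rw [pow_succ] at hp
    induction hp using Submodule.mul_induction_on' with
    | add x hx y hy h1 h2 =>
      rw [AddMemClass.coe_add, map_add, map_add, LinearMap.add_apply, smul_add]
      exact add_mem h1 h2
    | mem_mul_mem a ha b hb =>
      have e : g • wedge k (KaehlerDifferential.D k F ((a * b : O) : F)) ω =
          wedge k (KaehlerDifferential.D k F (b : F)) ((g * a) • ω) +
          (g * b) • wedge k (KaehlerDifferential.D k F (a : F)) ω := by
        rw [← hsm, MulMemClass.coe_mul, Derivation.leibniz, map_add, map_smul, map_smul,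
          LinearMap.add_apply, LinearMap.smul_apply, LinearMap.smul_apply, smul_add, mul_smul,
          mul_smul]
        rfl
      rw [e]
      refine add_mem ?_ (ih (i + 1) (by omega) a ha _ ?_)
      · refine wedge_D_log O hb (hω' _ ?_)
        have : g * a ∈ IsLocalRing.maximalIdeal O ^ (i + j) := by
          rw [pow_add]; exact Ideal.mul_mem_mul hg ha
        exact Ideal.pow_le_pow_right (by omega) this
      · rw [pow_succ]; exact Ideal.mul_mem_mul hg hb

/-- `dlog (𝒪^*_{C,𝒟}) ∧ Ω¹_C⟨D⟩(𝒟') ⊂ Ω²_C`. -/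
theorem wedge_dlog_logPolar (n : ℕ) {a : Additive Fˣ} (ha : a ∈ congrUnitStalk O n)
    {ω : Ω[F⁄k]} (hω : ω ∈ logPolarForms O k n) :
    wedge k (dlog k F a) ω ∈ regularForms₂ O k := by
  obtain ⟨hu, t, ht, hta⟩ := ha
  rw [dlog_apply, map_smul, LinearMap.smul_apply]
  refine Submodule.smul_mem _ (⟨_, hu.2⟩ : O) ?_
  cases n with
  | zero => exact wedge_D_regular O hu.1 hω
  | succ n =>
    have hD : KaehlerDifferential.D k F (a.toMul : F) = KaehlerDifferential.D k F (t : F) := by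
      rw [hta, map_sub, Derivation.map_one_eq_zero, sub_zero]
    rw [hD]
    simpa using wedge_D_logPolar O n (n + 1) 0 (by omega) hω t ht 1 (by simp)

end Local

/-! ## Čech cochains

For a subsheaf of a constant sheaf `A` on an irreducible space `X`, given by its stalks
`S x ⊆ A`, the sections over a nonempty open set `W` are `⋂_{z ∈ W} S z`, and restriction maps are
inclusions.  Čech cochains are taken with respect to coverings `(W x)_{x ∈ X}` indexed by the
points of `X`, with `x ∈ W x`, ordered by pointwise inclusion; every covering is refined by one of
these.  As all restriction maps are inclusions in `A`, the colimit over these coverings is a union: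
a cochain is a function with values in `A` which is a cochain for some such covering. -/

section Cech

variable {X : Type u} [TopologicalSpace X] {A : Type v} [AddCommGroup A]

/-- Čech `0`-cochains. -/
def C0 (S : X → AddSubgroup A) : AddSubgroup (X → A) where
  carrier := {a | ∃ W : X → Opens X, (∀ x, x ∈ W x) ∧ ∀ x, ∀ p ∈ W x, a x ∈ S p}
  zero_mem' := ⟨fun _ => ⊤, fun _ => trivial, fun _ _ _ => zero_mem _⟩
  add_mem' := fun {a b} ha hb => by
    obtain ⟨W, hW, ha⟩ := ha
    obtain ⟨W', hW', hb⟩ := hb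
    exact ⟨fun x => W x ⊓ W' x, fun x => ⟨hW x, hW' x⟩, fun x p hp =>
      add_mem (ha x p hp.1) (hb x p hp.2)⟩
  neg_mem' := fun {a} ha => by
    obtain ⟨W, hW, ha⟩ := ha
    exact ⟨W, hW, fun x p hp => neg_mem (ha x p hp)⟩

/-- Čech `1`-cochains. -/
def C1 (S : X → AddSubgroup A) : AddSubgroup (X → X → A) where
  carrier := {a | ∃ W : X → Opens X, (∀ x, x ∈ W x) ∧
    ∀ x y, ∀ p ∈ W x ⊓ W y, a x y ∈ S p}
  zero_mem' := ⟨fun _ => ⊤, fun _ => trivial, fun _ _ _ _ => zero_mem _⟩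
  add_mem' := fun {a b} ha hb => by
    obtain ⟨W, hW, ha⟩ := ha
    obtain ⟨W', hW', hb⟩ := hb
    exact ⟨fun x => W x ⊓ W' x, fun x => ⟨hW x, hW' x⟩, fun x y p hp =>
      add_mem (ha x y p ⟨hp.1.1, hp.2.1⟩) (hb x y p ⟨hp.1.2, hp.2.2⟩)⟩
  neg_mem' := fun {a} ha => by
    obtain ⟨W, hW, ha⟩ := ha
    exact ⟨W, hW, fun x y p hp => neg_mem (ha x y p hp)⟩

/-- Čech `2`-cochains. -/
def C2 (S : X → AddSubgroup A) : AddSubgroup (X → X → X → A) where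
  carrier := {a | ∃ W : X → Opens X, (∀ x, x ∈ W x) ∧
    ∀ x y z, ∀ p ∈ W x ⊓ W y ⊓ W z, a x y z ∈ S p}
  zero_mem' := ⟨fun _ => ⊤, fun _ => trivial, fun _ _ _ _ _ => zero_mem _⟩
  add_mem' := fun {a b} ha hb => by
    obtain ⟨W, hW, ha⟩ := ha
    obtain ⟨W', hW', hb⟩ := hb
    exact ⟨fun x => W x ⊓ W' x, fun x => ⟨hW x, hW' x⟩, fun x y z p hp =>
      add_mem (ha x y z p ⟨⟨hp.1.1.1, hp.1.2.1⟩, hp.2.1⟩)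
        (hb x y z p ⟨⟨hp.1.1.2, hp.1.2.2⟩, hp.2.2⟩)⟩
  neg_mem' := fun {a} ha => by
    obtain ⟨W, hW, ha⟩ := ha
    exact ⟨W, hW, fun x y z p hp => neg_mem (ha x y z p hp)⟩

end Cech

/-! ## The cohomology groups and the product

The curve enters through its space of points `X`, the local rings `O x` inside the function field
`F`, and the multiplicities `m x` of the points in the divisor `𝒟`. -/

section Groups

variable {k : Type v} {K : Type u} {F : Type w} [Field k] [Field K] [Field F]
  [Algebra k F] [Algebra K F] {X : Type u} [TopologicalSpace X]
  (O : X → Subalgebra K F) [∀ x, IsLocalRing (O x)] (m : X → ℕ)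

/-- Čech `1`-cocycles with values in `𝒪^*_{C,𝒟} = ker (𝒪^*_C → 𝒪^*_𝒟)`. -/
def Z1Pic : AddSubgroup (X → X → Additive Fˣ) where
  carrier := {l | l ∈ C1 (fun x => congrUnitStalk (O x) (m x)) ∧
    ∀ x y z, l x z = l x y + l y z}
  zero_mem' := ⟨zero_mem _, fun _ _ _ => by simp⟩
  add_mem' := fun {a b} ha hb => ⟨add_mem ha.1 hb.1, fun x y z => by
    simp only [Pi.add_apply]; rw [ha.2 x y z, hb.2 x y z]; abel⟩
  neg_mem' := fun {a} ha => ⟨neg_mem ha.1, fun x y z => by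
    simp only [Pi.neg_apply]; rw [ha.2 x y z]; abel⟩

/-- The coboundaries among them. -/
def B1Pic : AddSubgroup (Z1Pic O m) where
  carrier := {l | ∃ a ∈ C0 (fun x => congrUnitStalk (O x) (m x)),
    ∀ x y, (l : X → X → Additive Fˣ) x y = a x - a y}
  zero_mem' := ⟨0, zero_mem _, fun _ _ => by simp⟩
  add_mem' := fun {l l'} h h' => by
    obtain ⟨a, ha, h⟩ := h
    obtain ⟨b, hb, h'⟩ := h'
    refine ⟨a + b, add_mem ha hb, fun x y => ?_⟩
    simp only [AddSubgroup.coe_add, Pi.add_apply, h, h']; abel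
  neg_mem' := fun {l} h => by
    obtain ⟨a, ha, h⟩ := h
    refine ⟨-a, neg_mem ha, fun x y => ?_⟩
    simp only [AddSubgroup.coe_neg, Pi.neg_apply, h]; abel

/-- `ℍ¹(C, 𝒪^*_C → 𝒪^*_𝒟)`, the group of line bundles with a trivialization along `𝒟`.  As
`𝒪^*_C → 𝒪^*_𝒟` is surjective, this is `H¹(C, 𝒪^*_{C,𝒟})`. -/
def H1Pic : Type _ := Z1Pic O m ⧸ B1Pic O m

instance : AddCommGroup (H1Pic O m) := QuotientAddGroup.Quotient.addCommGroup (B1Pic O m)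

/-- The class of a cocycle. -/
def H1Pic.mk : Z1Pic O m →+ H1Pic O m := QuotientAddGroup.mk' _

/-- Čech `1`-cocycles of the complex `𝒪^*_C → Ω¹_C⟨D⟩(𝒟')`, where `D` is the support of `𝒟` and
`𝒟' = 𝒟 - D`. -/
def Z1Conn (k : Type v) [Field k] [Algebra k F] :
    AddSubgroup ((X → X → Additive Fˣ) × (X → Ω[F⁄k])) where
  carrier := {c | c.1 ∈ C1 (fun x => unitStalk (O x)) ∧
    c.2 ∈ C0 (fun x => (logPolarForms (O x) k (m x)).toAddSubgroup) ∧
    (∀ x y z, c.1 x z = c.1 x y + c.1 y z) ∧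
    ∀ x y, dlog k F (c.1 x y) = c.2 x - c.2 y}
  zero_mem' := ⟨zero_mem _, zero_mem _, fun _ _ _ => by simp, fun _ _ => by simp⟩
  add_mem' := fun {a b} ha hb => ⟨add_mem ha.1 hb.1, add_mem ha.2.1 hb.2.1,
    fun x y z => by
      simp only [Prod.fst_add, Pi.add_apply]; rw [ha.2.2.1 x y z, hb.2.2.1 x y z]; abel,
    fun x y => by
      simp only [Prod.fst_add, Prod.snd_add, Pi.add_apply, map_add]
      rw [ha.2.2.2 x y, hb.2.2.2 x y]; abel⟩
  neg_mem' := fun {a} ha => ⟨neg_mem ha.1, neg_mem ha.2.1,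
    fun x y z => by
      simp only [Prod.fst_neg, Pi.neg_apply]; rw [ha.2.2.1 x y z]; abel,
    fun x y => by
      simp only [Prod.fst_neg, Prod.snd_neg, Pi.neg_apply, map_neg]
      rw [ha.2.2.2 x y]; abel⟩

/-- The coboundaries among them. -/
def B1Conn (k : Type v) [Field k] [Algebra k F] : AddSubgroup (Z1Conn O m k) where
  carrier := {c | ∃ b ∈ C0 (fun x => unitStalk (O x)),
    (∀ x y, c.1.1 x y = b x - b y) ∧ ∀ x, c.1.2 x = dlog k F (b x)}
  zero_mem' := ⟨0, zero_mem _, fun _ _ => by simp, fun _ => by simp⟩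
  add_mem' := fun {l l'} h h' => by
    obtain ⟨a, ha, h1, h2⟩ := h
    obtain ⟨b, hb, h1', h2'⟩ := h'
    refine ⟨a + b, add_mem ha hb, fun x y => ?_, fun x => ?_⟩
    · simp only [AddSubgroup.coe_add, Prod.fst_add, Pi.add_apply, h1, h1']; abel
    · simp only [AddSubgroup.coe_add, Prod.snd_add, Pi.add_apply, h2, h2', map_add]
  neg_mem' := fun {l} h => by
    obtain ⟨a, ha, h1, h2⟩ := h
    refine ⟨-a, neg_mem ha, fun x y => ?_, fun x => ?_⟩
    · simp only [AddSubgroup.coe_neg, Prod.fst_neg, Pi.neg_apply, h1]; abel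
    · simp only [AddSubgroup.coe_neg, Prod.snd_neg, Pi.neg_apply, h2, map_neg]

/-- `ℍ¹(C, 𝒪^*_C → Ω¹_C⟨D⟩(𝒟'))`. -/
def H1Conn (k : Type v) [Field k] [Algebra k F] : Type _ := Z1Conn O m k ⧸ B1Conn O m k

instance (k : Type v) [Field k] [Algebra k F] : AddCommGroup (H1Conn O m k) :=
  QuotientAddGroup.Quotient.addCommGroup (B1Conn O m k)

/-- The class of a cocycle. -/
def H1Conn.mk (k : Type v) [Field k] [Algebra k F] : Z1Conn O m k →+ H1Conn O m k :=
  QuotientAddGroup.mk' _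

/-- Čech `2`-cocycles of the complex `𝒦₂ → Ω²_C`. -/
def Z2 (k : Type v) [Field k] [Algebra k F] :
    AddSubgroup ((X → X → X → MilnorK₂ F) × (X → X → ⋀[F]^2 Ω[F⁄k])) where
  carrier := {c | c.1 ∈ C2 (fun x => k₂Stalk (O x)) ∧
    c.2 ∈ C1 (fun x => (regularForms₂ (O x) k).toAddSubgroup) ∧
    (∀ x y z t, c.1 y z t - c.1 x z t + c.1 x y t - c.1 x y z = 0) ∧
    ∀ x y z, c.2 y z - c.2 x z + c.2 x y = dlog₂ k F (c.1 x y z)}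
  zero_mem' := ⟨zero_mem _, zero_mem _, fun _ _ _ _ => by simp, fun _ _ _ => by simp⟩
  add_mem' := fun {a b} ha hb => ⟨add_mem ha.1 hb.1, add_mem ha.2.1 hb.2.1,
    fun x y z t => by
      have h1 := ha.2.2.1 x y z t
      have h2 := hb.2.2.1 x y z t
      simp only [Prod.fst_add, Pi.add_apply]
      rw [show ∀ p q r s p' q' r' s' : MilnorK₂ F, p + p' - (q + q') + (r + r') - (s + s') =
        (p - q + r - s) + (p' - q' + r' - s') from fun _ _ _ _ _ _ _ _ => by abel, h1, h2,
        add_zero],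
    fun x y z => by
      simp only [Prod.fst_add, Prod.snd_add, Pi.add_apply, map_add]
      rw [← ha.2.2.2 x y z, ← hb.2.2.2 x y z]; abel⟩
  neg_mem' := fun {a} ha => ⟨neg_mem ha.1, neg_mem ha.2.1,
    fun x y z t => by
      have h1 := ha.2.2.1 x y z t
      simp only [Prod.fst_neg, Pi.neg_apply]
      rw [show ∀ p q r s : MilnorK₂ F, -p - -q + -r - -s = -(p - q + r - s) from
        fun p q r s => by abel, h1, neg_zero],
    fun x y z => by
      simp only [Prod.fst_neg, Prod.snd_neg, Pi.neg_apply, map_neg]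
      rw [← ha.2.2.2 x y z]; abel⟩

/-- The coboundaries among them. -/
def B2 (k : Type v) [Field k] [Algebra k F] : AddSubgroup (Z2 O k) where
  carrier := {c | ∃ β ∈ C1 (fun x => k₂Stalk (O x)),
    ∃ γ ∈ C0 (fun x => (regularForms₂ (O x) k).toAddSubgroup),
    (∀ x y z, c.1.1 x y z = β y z - β x z + β x y) ∧
    ∀ x y, c.1.2 x y = dlog₂ k F (β x y) + (γ y - γ x)}
  zero_mem' := ⟨0, zero_mem _, 0, zero_mem _, fun _ _ _ => by simp, fun _ _ => by simp⟩
  add_mem' := fun {l l'} h h' => by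
    obtain ⟨a, ha, g, hg, h1, h2⟩ := h
    obtain ⟨b, hb, g', hg', h1', h2'⟩ := h'
    refine ⟨a + b, add_mem ha hb, g + g', add_mem hg hg', fun x y z => ?_, fun x y => ?_⟩
    · simp only [AddSubgroup.coe_add, Prod.fst_add, Pi.add_apply, h1, h1']; abel
    · simp only [AddSubgroup.coe_add, Prod.snd_add, Pi.add_apply, h2, h2', map_add]; abel
  neg_mem' := fun {l} h => by
    obtain ⟨a, ha, g, hg, h1, h2⟩ := h
    refine ⟨-a, neg_mem ha, -g, neg_mem hg, fun x y z => ?_, fun x y => ?_⟩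
    · simp only [AddSubgroup.coe_neg, Prod.fst_neg, Pi.neg_apply, h1]; abel
    · simp only [AddSubgroup.coe_neg, Prod.snd_neg, Pi.neg_apply, h2, map_neg]; abel

/-- `ℍ²(C, 𝒦₂ → Ω²_C)`. -/
def H2 (k : Type v) [Field k] [Algebra k F] : Type _ := Z2 O k ⧸ B2 O k

instance (k : Type v) [Field k] [Algebra k F] : AddCommGroup (H2 O k) :=
  QuotientAddGroup.Quotient.addCommGroup (B2 O k)

/-- The class of a cocycle. -/
def H2.mk (k : Type v) [Field k] [Algebra k F] : Z2 O k →+ H2 O k :=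
  QuotientAddGroup.mk' _

/-- The product of two cocycles: `(λ) ∪ (c, ω) = ({λ_{xy}, c_{yz}}, dlog λ_{xy} ∧ ω_y)`. -/
def cupCocycle (k : Type v) [Field k] [Algebra k F] (l : Z1Pic O m) (c : Z1Conn O m k) :
    Z2 O k :=
  ⟨(fun x y z => symb (l.1 x y) (c.1.1 y z), fun x y => wedge k (dlog k F (l.1 x y)) (c.1.2 y)), by
    obtain ⟨l, hl, hl'⟩ := l
    obtain ⟨⟨c, ω⟩, hc, hω, hc', hcω⟩ := c
    replace hc' : ∀ x y z, c x z = c x y + c y z := hc'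
    replace hcω : ∀ x y, dlog k F (c x y) = ω x - ω y := hcω
    refine ⟨?_, ?_, fun x y z t => ?_, fun x y z => ?_⟩
    · obtain ⟨W, hW, hl⟩ := hl
      obtain ⟨W', hW', hc⟩ := hc
      refine ⟨fun x => W x ⊓ W' x, fun x => ⟨hW x, hW' x⟩, fun x y z p hp => ?_⟩
      exact AddSubgroup.subset_closure ⟨_, (hl x y p ⟨hp.1.1.1, hp.1.2.1⟩).1, _,
        hc y z p ⟨hp.1.2.2, hp.2.2⟩, rfl⟩
    · obtain ⟨W, hW, hl⟩ := hl
      obtain ⟨W', hW', hω⟩ := hω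
      refine ⟨fun x => W x ⊓ W' x, fun x => ⟨hW x, hW' x⟩, fun x y p hp => ?_⟩
      exact wedge_dlog_logPolar (O p) (m p) (hl x y p ⟨hp.1.1, hp.2.1⟩) (hω y p hp.2.2)
    · change symb (l y z) (c z t) - symb (l x z) (c z t) + symb (l x y) (c y t) -
        symb (l x y) (c y z) = 0
      rw [hl' x y z, hc' y z t]
      simp only [map_add, AddMonoidHom.add_apply]; abel
    · change wedge k (dlog k F (l y z)) (ω z) - wedge k (dlog k F (l x z)) (ω z) +
        wedge k (dlog k F (l x y)) (ω y) = dlog₂ k F (symb (l x y) (c y z))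
      rw [dlog₂_symb, hcω y z, hl' x y z]
      simp only [map_add, map_sub, LinearMap.add_apply]; abel⟩

theorem cup_left (k : Type v) [Field k] [Algebra k F] (l : Z1Pic O m) (c : Z1Conn O m k)
    (h : l ∈ B1Pic O m) : cupCocycle O m k l c ∈ B2 O k := by
  obtain ⟨a, ⟨W, hW, ha⟩, hla⟩ := h
  obtain ⟨⟨c, ω⟩, ⟨W', hW', hc⟩, ⟨W'', hW'', hω⟩, hc', hcω⟩ := c
  replace hc' : ∀ x y z, c x z = c x y + c y z := hc'
  replace hcω : ∀ x y, dlog k F (c x y) = ω x - ω y := hcω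
  refine ⟨fun x y => - symb (a x) (c x y), ?_, fun x => - wedge k (dlog k F (a x)) (ω x), ?_,
    fun x y z => ?_, fun x y => ?_⟩
  · refine ⟨fun x => W x ⊓ W' x, fun x => ⟨hW x, hW' x⟩, fun x y p hp => neg_mem ?_⟩
    exact AddSubgroup.subset_closure ⟨_, (ha x p hp.1.1).1, _, hc x y p ⟨hp.1.2, hp.2.2⟩, rfl⟩
  · refine ⟨fun x => W x ⊓ W'' x, fun x => ⟨hW x, hW'' x⟩, fun x p hp => neg_mem ?_⟩
    exact wedge_dlog_logPolar (O p) (m p) (ha x p hp.1) (hω x p hp.2)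
  · change symb (l.1 x y) (c y z) =
      - symb (a y) (c y z) - - symb (a x) (c x z) + - symb (a x) (c x y)
    rw [hla x y, hc' x y z]
    simp only [map_add, map_sub, AddMonoidHom.sub_apply]; abel
  · change wedge k (dlog k F (l.1 x y)) (ω y) = _
    rw [map_neg, dlog₂_symb, hla x y, hcω x y]
    simp only [map_sub, LinearMap.sub_apply]; abel

theorem cup_right (k : Type v) [Field k] [Algebra k F] (l : Z1Pic O m) (c : Z1Conn O m k)
    (h : c ∈ B1Conn O m k) : cupCocycle O m k l c ∈ B2 O k := by
  obtain ⟨b, ⟨W, hW, hb⟩, hcb, hωb⟩ := h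
  obtain ⟨l, ⟨W', hW', hl⟩, hl'⟩ := l
  refine ⟨fun x y => symb (l x y) (b y), ?_, 0, zero_mem _, fun x y z => ?_, fun x y => ?_⟩
  · refine ⟨fun x => W x ⊓ W' x, fun x => ⟨hW x, hW' x⟩, fun x y p hp => ?_⟩
    exact AddSubgroup.subset_closure ⟨_, (hl x y p ⟨hp.1.2, hp.2.2⟩).1, _, hb y p hp.2.1, rfl⟩
  · change symb (l x y) (c.1.1 y z) = symb (l y z) (b z) - symb (l x z) (b z) + symb (l x y) (b y)
    rw [hcb y z, hl' x y z]
    simp only [map_add, map_sub, AddMonoidHom.add_apply]; abel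
  · change wedge k (dlog k F (l x y)) (c.1.2 y) = _
    rw [dlog₂_symb, hωb]; simp

theorem cupCocycle_add_left (k : Type v) [Field k] [Algebra k F] (l l' : Z1Pic O m)
    (c : Z1Conn O m k) :
    cupCocycle O m k (l + l') c = cupCocycle O m k l c + cupCocycle O m k l' c := by
  apply Subtype.ext
  refine Prod.ext ?_ ?_
  · funext x y z
    change symb (l.1 x y + l'.1 x y) (c.1.1 y z) =
      symb (l.1 x y) (c.1.1 y z) + symb (l'.1 x y) (c.1.1 y z)
    rw [map_add, AddMonoidHom.add_apply]
  · funext x y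
    change wedge k (dlog k F (l.1 x y + l'.1 x y)) (c.1.2 y) =
      wedge k (dlog k F (l.1 x y)) (c.1.2 y) + wedge k (dlog k F (l'.1 x y)) (c.1.2 y)
    rw [map_add, map_add, LinearMap.add_apply]

theorem cupCocycle_add_right (k : Type v) [Field k] [Algebra k F] (l : Z1Pic O m)
    (c c' : Z1Conn O m k) :
    cupCocycle O m k l (c + c') = cupCocycle O m k l c + cupCocycle O m k l c' := by
  apply Subtype.ext
  refine Prod.ext ?_ ?_
  · funext x y z
    change symb (l.1 x y) (c.1.1 y z + c'.1.1 y z) =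
      symb (l.1 x y) (c.1.1 y z) + symb (l.1 x y) (c'.1.1 y z)
    rw [map_add]
  · funext x y
    change wedge k (dlog k F (l.1 x y)) (c.1.2 y + c'.1.2 y) =
      wedge k (dlog k F (l.1 x y)) (c.1.2 y) + wedge k (dlog k F (l.1 x y)) (c'.1.2 y)
    rw [map_add]

/-- The product
`ℍ¹(C, 𝒪^*_C → 𝒪^*_𝒟) × ℍ¹(C, 𝒪^*_C → Ω¹_C⟨D⟩(𝒟')) → ℍ²(C, 𝒦₂ → Ω²_C)`. -/
def cup (k : Type v) [Field k] [Algebra k F] : H1Pic O m →+ H1Conn O m k →+ H2 O k :=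
  QuotientAddGroup.lift (B1Pic O m)
    (AddMonoidHom.mk' (fun l =>
      QuotientAddGroup.lift (B1Conn O m k)
        ((H2.mk O k).comp (AddMonoidHom.mk' (cupCocycle O m k l) (cupCocycle_add_right O m k l)))
        (fun c hc => (QuotientAddGroup.eq_zero_iff _).2 (cup_right O m k l c hc)))
      (fun l l' => by
        apply QuotientAddGroup.addMonoidHom_ext
        ext c
        exact (congrArg (H2.mk O k) (cupCocycle_add_left O m k l l' c)).trans (map_add _ _ _)))
    (fun l hl => by
      apply QuotientAddGroup.addMonoidHom_ext
      ext c
      exact (QuotientAddGroup.eq_zero_iff _).2 (cup_left O m k l c hl))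

theorem cup_mk (k : Type v) [Field k] [Algebra k F] (l : Z1Pic O m) (c : Z1Conn O m k) :
    cup O m k (H1Pic.mk O m l) (H1Conn.mk O m k c) = H2.mk O k (cupCocycle O m k l c) := rfl

end Groups

/-! ## Residues and the trace -/

section Trace

variable {k : Type v} {K : Type u} {F : Type w} [Field k] [Field K] [Field F] [Algebra k K]
  [Algebra k F] [Algebra K F] [IsScalarTower k K F]

/-- `r` is (the trace down to `K` of) the residue of the relative `1`-form `ω` at the closed point
with local ring `O`: for a uniformizer `z`, modulo exact forms and regular forms, `ω` is equal to
`u dz / z` with `u ∈ O`, and `r` is the trace of the class of `u` in the residue field.  In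
characteristic zero this determines `r`: forms with a Laurent expansion without a `dz / z` term
are exact modulo regular forms. -/
def HasResidue (O : Subalgebra K F) [IsLocalRing O] (ω : Ω[F⁄K]) (r : K) : Prop :=
  ∃ z u : O, ∃ h : F, IsLocalRing.maximalIdeal O = Ideal.span {z} ∧
    ω - ((u : F) * (z : F)⁻¹) • KaehlerDifferential.D K F (z : F) - KaehlerDifferential.D K F h ∈
      regularForms O K ∧
    r = Algebra.trace K (IsLocalRing.ResidueField O) (IsLocalRing.residue O u)

/-- `ρ ∈ Ω¹_K` is the residue of the absolute `2`-form `η`, i.e. its image under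
`Ω²_F → Ω²_F / (Ω²_K ⊗ F) = Ω¹_K ⊗ Ω¹_{F/K} → Ω¹_K`, where `ω ∧ τ ↦ res(ω) τ` for
`τ ∈ Ω¹_K`. -/
def HasResidue₂ (O : Subalgebra K F) [IsLocalRing O] (η : ⋀[F]^2 Ω[F⁄k]) (ρ : Ω[K⁄k]) : Prop :=
  ∃ (n : ℕ) (ω : Fin n → Ω[F⁄k]) (τ : Fin n → Ω[K⁄k]) (r : Fin n → K),
    (∀ i, HasResidue O (relForm k K (ω i)) (r i)) ∧
    η - ∑ i, wedge k (ω i) (pullForm k (τ i)) ∈ baseForms₂ k K F ∧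
    ρ = ∑ i, r i • τ i

variable {X : Type u} [TopologicalSpace X] (O : X → Subalgebra K F) [∀ x, IsLocalRing (O x)]

/-- `α` is the image of the class of the `1`-cocycle `y` under
`H¹(C, Ω²_C) → Ω¹_K ⊗ H¹(C, Ω¹_{C/K}) → Ω¹_K`: writing `y` as the coboundary of a cochain `γ` of
rational forms, this is the sum of the residues of `γ_x` at the closed points `x`. -/
def HasTrace₁ (y : X → X → ⋀[F]^2 Ω[F⁄k]) (α : Ω[K⁄k]) : Prop :=
  ∃ γ : X → ⋀[F]^2 Ω[F⁄k], (∀ x x', y x x' = γ x' - γ x) ∧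
    ∃ (S : Finset X) (ρ : X → Ω[K⁄k]),
      (∀ x ∉ S, γ x ∈ regularForms₂ (O x) k) ∧
      (∀ x ∈ S, IsClosed ({x} : Set X) ∧ HasResidue₂ (O x) (γ x) (ρ x)) ∧
      α = ∑ x ∈ S, ρ x

/-- `α` is the trace of `z`, under
`ℍ²(C, 𝒦₂ → Ω²_C) = H¹(C, Ω²_C) / H¹(C, 𝒦₂) → Ω¹_K / dlog K^*`. -/
def IsTrace (z : H2 O k) (α : DlogQuotient k K) : Prop :=
  ∃ c : Z2 O k, H2.mk O k c = z ∧ c.1.1 = 0 ∧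
    ∃ a : Ω[K⁄k], HasTrace₁ O c.1.2 a ∧ QuotientAddGroup.mk a = α

end Trace

/-! ## Line bundles and connections -/

section Connections

variable {k : Type v} {K : Type u} {F : Type w} [Field k] [Field K] [Field F] [Algebra k K]
  [Algebra k F] [Algebra K F] [IsScalarTower k K F] {X : Type u} [TopologicalSpace X]
  {V : Type*} [AddCommGroup V] [Module F V]

/-- An invertible sheaf on the open subset `U` of the curve with generic stalk the one-dimensional
`F`-vector space `V`, given by its stalks as a subsheaf of the constant sheaf `V`.  (The stalks
outside `U` carry no information.) -/
structure InvertibleSheaf (O : X → Subalgebra K F) (V : Type*) [AddCommGroup V] [Module F V]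
    (U : Set X) where
  /-- the stalks -/
  stalk : ∀ x, Submodule (O x) V
  exists_generator : ∀ x ∈ U, ∃ W : Opens X, x ∈ W ∧ ∃ e : V, e ≠ 0 ∧
    ∀ y ∈ W, y ∈ U → stalk y = Submodule.span (O y) {e}

/-- The stalk of the tensor product of two sheaves with stalks `N` and `S`, inside the tensor
product of the generic stalks. -/
def tensorStalk (O : Subalgebra K F) {Ω : Type*} [AddCommGroup Ω] [Module F Ω]
    (N : Submodule O Ω) (S : Submodule O V) : Submodule O (Ω ⊗[F] V) :=
  Submodule.span O (Set.image2 (fun a s => a ⊗ₜ[F] s) (N : Set Ω) (S : Set V))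

/-- An absolute connection (with arbitrary poles) on the generic stalk `V`. -/
structure Connection (k : Type v) (F : Type w) [Field k] [Field F] [Algebra k F] (V : Type*)
    [AddCommGroup V] [Module F V] where
  /-- the underlying map -/
  toFun : V →+ Ω[F⁄k] ⊗[F] V
  leibniz : ∀ (f : F) (v : V),
    toFun (f • v) = f • toFun v + KaehlerDifferential.D k F f ⊗ₜ[F] v

namespace Connection

variable (D : Connection k F V)

/-- The extension `Ω¹ ⊗ V → Ω² ⊗ V`, `α ⊗ v ↦ dα ⊗ v - α ∧ ∇v`. -/
def next : Ω[F⁄k] ⊗[F] V →+ (⋀[F]^2 Ω[F⁄k]) ⊗[F] V :=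
  TensorProduct.liftAddHom
    (AddMonoidHom.mk' (fun α => AddMonoidHom.mk'
        (fun v => extDeriv k α ⊗ₜ[F] v - (wedge k α).rTensor V (D.toFun v))
        (fun v v' => by rw [TensorProduct.tmul_add, map_add, map_add]; abel))
      (fun α α' => by
        ext v
        simp only [AddMonoidHom.mk'_apply, AddMonoidHom.add_apply, map_add,
          TensorProduct.add_tmul, LinearMap.rTensor_add, LinearMap.add_apply]
        abel))
    (fun f α v => by
      simp only [AddMonoidHom.mk'_apply, D.leibniz, extDeriv_smul, map_smul, map_add,
        LinearMap.rTensor_smul, LinearMap.smul_apply, TensorProduct.add_tmul,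
        LinearMap.rTensor_tmul, TensorProduct.tmul_smul, TensorProduct.smul_tmul']
      rw [wedge_swap k α, TensorProduct.neg_tmul]
      abel)

/-- The curvature `∇² : V → Ω² ⊗ V`. -/
def curvature : V →+ (⋀[F]^2 Ω[F⁄k]) ⊗[F] V := D.next.comp D.toFun

/-- The curvature takes its values in `Ω²_K ⊗ V`. -/
def HasVerticalCurvature (K : Type u) [Field K] [Algebra k K] [Algebra K F]
    [IsScalarTower k K F] : Prop :=
  ∀ v, D.curvature v ∈
    Submodule.span F (Set.image2 (fun η v => η ⊗ₜ[F] v) (baseForms₂ k K F : Set _)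
      (Set.univ : Set V))

/-- The relative connection `∇_{/K}`. -/
def rel (K : Type u) [Field K] [Algebra k K] [Algebra K F] [IsScalarTower k K F] :
    V →+ Ω[F⁄K] ⊗[F] V :=
  ((relForm k K).rTensor V).toAddMonoidHom.comp D.toFun

/-- `∇` restricts to a connection `L → L ⊗ Ω¹_U` on the invertible sheaf `L` on `U`. -/
def IsRegularOn {O : X → Subalgebra K F} {U : Set X} (L : InvertibleSheaf O V U) : Prop :=
  ∀ x ∈ U, ∀ v ∈ L.stalk x, D.toFun v ∈ tensorStalk (O x) (regularForms (O x) k) (L.stalk x)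

end Connection

variable {O : X → Subalgebra K F} {U : Set X}

/-- The stalk at `x` of `j_* L`, where `j : U → C` is the inclusion. -/
def pushStalk (L : InvertibleSheaf O V U) (x : X) : Set V :=
  {v | ∃ W : Opens X, x ∈ W ∧ ∀ y ∈ W, y ∈ U → v ∈ L.stalk y}

/-- The stalk at `x` of `j_* (L ⊗ Ω¹_{U/K})`. -/
def pushFormStalk (L : InvertibleSheaf O V U) (x : X) : Set (Ω[F⁄K] ⊗[F] V) :=
  {w | ∃ W : Opens X, x ∈ W ∧
    ∀ y ∈ W, y ∈ U → w ∈ tensorStalk (O y) (regularForms (O y) K) (L.stalk y)}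

variable [∀ x, IsLocalRing (O x)]

/-- The invertible sheaf `M` on `C`, with the connection `∇`, is an extension of `(L, ∇)` on
`U = C - D` such that `∇_{/K}` takes values in `M ⊗ Ω¹_{C/K}(𝒟)`, has a pole at every point of
`D`, and such that the inclusion of complexes
`{M → M ⊗ Ω¹_{C/K}(𝒟)} → {j_* L → j_* (L ⊗ Ω¹_{U/K})}` is a quasi-isomorphism (on all stalks).
Here `D` and `𝒟` are given by the multiplicities `m`. -/
structure IsGoodExtension (m : X → ℕ) (D : Connection k F V)
    (L : InvertibleSheaf O V {x | m x = 0}) (M : InvertibleSheaf O V (Set.univ : Set X)) :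
    Prop where
  stalk_eq : ∀ x, m x = 0 → M.stalk x = L.stalk x
  rel_mem : ∀ x, ∀ v ∈ M.stalk x,
    D.rel K v ∈ tensorStalk (O x) (polarForms (O x) (m x)) (M.stalk x)
  pole : ∀ x, m x ≠ 0 → ∃ v ∈ M.stalk x,
    D.rel K v ∉ tensorStalk (O x) (regularForms (O x) K) (M.stalk x)
  /-- surjectivity on `H⁰` (injectivity being clear) -/
  quasiIso_H0 : ∀ x, ∀ v ∈ pushStalk L x, D.rel K v = 0 → v ∈ M.stalk x
  quasiIso_H1_injective : ∀ x, ∀ v ∈ pushStalk L x,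
    D.rel K v ∈ tensorStalk (O x) (polarForms (O x) (m x)) (M.stalk x) →
      ∃ v' ∈ M.stalk x, D.rel K v' = D.rel K v
  quasiIso_H1_surjective : ∀ x, ∀ w ∈ pushFormStalk L x, ∃ v ∈ pushStalk L x,
    w - D.rel K v ∈ tensorStalk (O x) (polarForms (O x) (m x)) (M.stalk x)

/-- `A` is the class `(c₁(Ω¹_{C/K}(𝒟)), triv ∇)` of the line bundle `Ω¹_{C/K}(𝒟)` with the
trivialization along `𝒟` given by the element `triv ∇ ∈ Ω¹_{C/K}(𝒟)|_𝒟` for which the map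
`M|_𝒟 → M ⊗ Ω¹_{C/K}(𝒟)|_𝒟` induced by `∇_{/K}` is `v ↦ triv ∇ ⊗ v`: there are local generators
`s_x` of `Ω¹_{C/K}(𝒟)` that restrict to `triv ∇` along `𝒟`, and `A` is the class of
`s_x / s_y`.  (At a point of `D`, the kernel of `M ⊗ Ω¹_{C/K}(𝒟) → M ⊗ Ω¹_{C/K}(𝒟)|_𝒟` is
`M ⊗ Ω¹_{C/K}`.) -/
def IsTrivClass (m : X → ℕ) (D : Connection k F V) (M : InvertibleSheaf O V (Set.univ : Set X))
    (A : H1Pic O m) : Prop :=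
  ∃ (W : X → Opens X) (s : X → Ω[F⁄K]) (l : Z1Pic O m),
    (∀ x, x ∈ W x) ∧
    (∀ x, ∀ p ∈ W x, polarForms (O p) (m p) = Submodule.span (O p) {s x}) ∧
    (∀ x, ∀ p ∈ W x, m p ≠ 0 → ∀ v ∈ M.stalk p,
      D.rel K v - s x ⊗ₜ[F] v ∈ tensorStalk (O p) (regularForms (O p) K) (M.stalk p)) ∧
    (∀ x y, s x = ((l.1 x y).toMul : F) • s y) ∧
    A = H1Pic.mk O m l

/-- `B` is the class of `(M, ∇)` in `ℍ¹(C, 𝒪^*_C → Ω¹_C⟨D⟩(𝒟'))`: there are local generators `e_x`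
of `M` with `∇ e_x = ω_x ⊗ e_x`, and `B` is the class of `(e_x / e_y, ω_x)`. -/
def IsConnClass (m : X → ℕ) (D : Connection k F V) (M : InvertibleSheaf O V (Set.univ : Set X))
    (B : H1Conn O m k) : Prop :=
  ∃ (W : X → Opens X) (e : X → V) (c : Z1Conn O m k),
    (∀ x, x ∈ W x) ∧
    (∀ x, ∀ p ∈ W x, M.stalk p = Submodule.span (O p) {e x}) ∧
    (∀ x y, e x = ((c.1.1 x y).toMul : F) • e y) ∧
    (∀ x, D.toFun (e x) = c.1.2 x ⊗ₜ[F] e x) ∧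
    B = H1Conn.mk O m k c

/-- `α` is the value of `(c₁(Ω¹_{C/K}(𝒟)), triv ∇) · (M, ∇) = Tr ((c₁(Ω¹_{C/K}(𝒟)), triv ∇) ∪ (M, ∇))`
in `Ω¹_K / dlog K^*`. -/
def IsPairing (m : X → ℕ) (D : Connection k F V) (M : InvertibleSheaf O V (Set.univ : Set X))
    (α : DlogQuotient k K) : Prop :=
  ∃ (A : H1Pic O m) (B : H1Conn O m k), IsTrivClass m D M A ∧ IsConnClass m D M B ∧
    IsTrace O (cup O m k A B) α

end Connections

/-! ## Curves -/

section Curves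

variable {K : Type u} [Field K] {C : Scheme.{u}} [IsIntegral C] (f : C ⟶ Spec (.of K))

/-- The function field of `C`, as an extension of `K`. -/
def FunctionField {C : Scheme.{u}} [IsIntegral C] (_ : C ⟶ Spec (.of K)) : Type u :=
  C.functionField

instance : Field (FunctionField f) := inferInstanceAs (Field C.functionField)

/-- The inclusion of constants. -/
def constants : K →+* FunctionField f :=
  ((Scheme.ΓSpecIso (.of K)).inv ≫ f.appTop ≫ C.presheaf.germ ⊤ (genericPoint C) trivial).hom

instance {R : Type*} [Field R] [Algebra R K] : Algebra R (FunctionField f) :=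
  ((constants f).comp (algebraMap R K)).toAlgebra

instance {R : Type*} [Field R] [Algebra R K] : IsScalarTower R K (FunctionField f) :=
  IsScalarTower.of_algebraMap_eq' rfl

/-- The local ring of `C` at `x`, inside the function field. -/
def localRing (x : C) : Subalgebra K (FunctionField f) where
  toSubsemiring := (algebraMap (C.presheaf.stalk x) C.functionField).rangeS
  algebraMap_mem' a := by
    refine ⟨((Scheme.ΓSpecIso (.of K)).inv ≫ f.appTop ≫ C.presheaf.germ ⊤ x trivial).hom a, ?_⟩
    change (C.presheaf.stalkSpecializes ((genericPoint_spec C).specializes trivial)).hom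
      (((Scheme.ΓSpecIso (.of K)).inv ≫ f.appTop ≫ C.presheaf.germ ⊤ x trivial).hom a) =
      ((Scheme.ΓSpecIso (.of K)).inv ≫ f.appTop ≫
        C.presheaf.germ ⊤ (genericPoint C) trivial).hom a
    rw [← C.presheaf.germ_stalkSpecializes (U := ⊤) (y := x) trivial
      ((genericPoint_spec C).specializes trivial)]
    rfl

instance (x : C) : IsLocalRing (localRing f x) :=
  IsLocalRing.of_surjective' (algebraMap (C.presheaf.stalk x) C.functionField).rangeSRestrict
    (RingHom.rangeSRestrict_surjective _)

/-- `x` is (the image of) a `K`-rational point of `C`. -/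
def IsRationalPoint (x : C) : Prop :=
  ∃ p : Spec (.of K) ⟶ C, p ≫ f = 𝟙 _ ∧ x ∈ Set.range p

end Curves

end CurvePairing

end

/-!
The value of the pairing is a sum of local residues, and two good extensions can be compared one
point at a time.

**Residues.**  The scheme enters only through `IsSmoothCurve`: its local rings at closed points are
discrete valuation rings essentially of finite type over `K`, and by the valuative criterion these
are all the valuation rings of the function field `F` over `K` (`isSmoothCurve`).  A relative form
has a residue at each point, and the sum of the residues vanishes
(`IsSmoothCurve.sum_residue_eq_zero`).  The trace of the form to `K(s)`, for a function `s`
vanishing at its poles, is regular outside `s = 0` and therefore exact, and the sum of the residues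
is the residue of the trace at `s = 0`.  The residue in `Ω¹_K` of an absolute `2`-form is reduced to
this by contraction with derivations of `F` extending those of `K`: a derivation can be chosen to
preserve a given local ring and to kill a given uniformizer (`IsSmoothPoint.exists_isAdapted`), and
contraction turns the residue in `Ω¹_K` into residues in `K`
(`IsSmoothPoint.hasResidue₂_of_contraction`).

**The trace.**  The residue of `dlog u ∧ dlog z`, for a unit `u` and a uniformizer `z`, is minus
`dlog` of the norm of the value of `u` at the point, so that the forms coming from `K₂` have
residues in `dlog K^*` (`IsSmoothPoint.hasResidue₂_dlog₂`).  With the residue theorem this makes the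
trace well defined (`IsSmoothCurve.isTrace_unique`).  Since every class can be trivialized at the
generic point `η`, the trace of `(λ_{xy}) ∪ (c_{xy}, ω_x)` is minus the sum over the closed points
`x` of the residues of `dlog λ_{xη} ∧ ω_x` (`IsSmoothCurve.exists_isTrace_cup`).

**Comparison of extensions.**  Let `e` generate a good extension at a point of `𝒟` of multiplicity
`m`, and let `ω` be its connection form.  The quasi-isomorphism forces the relative form of `ω` to
have a pole of order exactly `m` (`IsGoodExtension.exists_unit`), so that this relative form
generates `Ω¹_{C/K}(𝒟)` and represents `triv ∇`.  As the curvature is vertical, `dω` vanishes up to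
`2`-forms from the base, and therefore the components of `ω` along the base have poles of order at
most `m - 1` (`IsSmoothPoint.pow_mul_lift_mem`, `IsSmoothPoint.mem_logPolarForms`).

A second extension is generated at the point by `z ^ N • e`, with connection form `ω' = ω + N dz /
z`.  Let `g` be the quotient of the relative forms of `ω'` and `ω`, and let `a` be the quotient of
the relative form of `ω` and a fixed rational form.  The contributions of the point to the two
pairings differ by the residue of `dlog (a g) ∧ ω' - dlog a ∧ ω = dlog g ∧ ω' + dlog a ∧ N dz / z`.
The second summand comes from `K₂`.  The first has residue zero
(`IsSmoothPoint.hasResidue₂_dlog_quotient`): for a derivation `E` killing `z`, with `y = (z f)⁻¹` if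
`f dz` is the relative form of `ω`, one has `g = 1 + N y`, and the contraction of `dlog g ∧ ω'` with
`E` is the exact form `-N d(y E(ω))` plus the regular form `N² y E(ω) g⁻¹ dy`.
-/

noncomputable section

namespace CurvePairing

open IsLocalRing

/-! ### Local rings of a smooth curve -/

/-- The local ring `O` is the localization, at some multiplicative set, of the `K`-algebra
generated by the finite set `b`. -/
def GeneratedBy {K F : Type*} [Field K] [Field F] [Algebra K F] (b : Finset F)
    (O : Subalgebra K F) : Prop :=
  (b : Set F) ⊆ O ∧ ∀ a ∈ O, ∃ p ∈ Algebra.adjoin K (b : Set F),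
    ∃ q ∈ Algebra.adjoin K (b : Set F), q⁻¹ ∈ O ∧ a = p * q⁻¹

/-- `O` is the local ring of a closed point of a smooth curve over `K` with function field `F`: a
discrete valuation ring with quotient field `F` and residue field finite over `K`, essentially of
finite type over `K`.  Smoothness at the generic point is expressed by the rank of `Ω¹_{F/K}`. -/
structure IsSmoothPoint {K F : Type*} [Field K] [Field F] [Algebra K F] (O : Subalgebra K F)
    [IsLocalRing O] : Prop where
  dvr : IsDiscreteValuationRing O
  frac : ∀ f : F, ∃ a ∈ O, ∃ b ∈ O, b ≠ 0 ∧ f = a / b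
  finite : Module.Finite K (ResidueField O)
  generated : ∃ b : Finset F, GeneratedBy b O
  finrank_eq_one : Module.finrank F Ω[F⁄K] = 1

/-- The properties of a smooth complete curve, given by its points `x` and local rings `O x`, with
generic point `η`, that the theory of residues needs.  Completeness enters through the last field:
every valuation ring of the function field containing `K` is the local ring of a point. -/
structure IsSmoothCurve {K F X : Type*} [Field K] [Field F] [Algebra K F] [TopologicalSpace X]
    (O : X → Subalgebra K F) [∀ x, IsLocalRing (O x)] (η : X) : Prop where
  generic : O η = ⊤
  generic_mem : ∀ U : Opens X, (U : Set X).Nonempty → η ∈ U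
  finrank_eq_one : Module.finrank F Ω[F⁄K] = 1
  point : ∀ x, x ≠ η → IsSmoothPoint (O x)
  isClosed : ∀ x, x ≠ η → IsClosed ({x} : Set X)
  finite_compl : ∀ U : Opens X, (U : Set X).Nonempty → (U : Set X)ᶜ.Finite
  spread : ∀ x, ∀ f ∈ O x, ∃ U : Opens X, x ∈ U ∧ ∀ y ∈ U, f ∈ O y
  injective : Function.Injective O
  chart : ∃ (b : Finset F) (U : Opens X), (U : Set X).Nonempty ∧ ∀ y ∈ U, GeneratedBy b (O y)
  exists_eq_valuationSubring : ∀ R : ValuationSubring F, (∀ a : K, algebraMap K F a ∈ R) →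
    R ≠ ⊤ → ∃ x, x ≠ η ∧ (O x : Set F) = R

/-! ### Regular forms and residues at a point -/

section LocalRing

variable {K F : Type*} [Field K] [Field F] [Algebra K F] {O : Subalgebra K F} [IsLocalRing O]

theorem IsSmoothPoint.ne_zero (hO : IsSmoothPoint O) {z : O}
    (hz : maximalIdeal O = Ideal.span {z}) : (z : F) ≠ 0 := by
  have := hO.dvr
  intro h
  have h0 : z = 0 := Subtype.ext h
  apply IsDiscreteValuationRing.not_a_field O
  rw [hz, h0]; simp

theorem IsSmoothPoint.exists_uniformizer (hO : IsSmoothPoint O) :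
    ∃ z : O, maximalIdeal O = Ideal.span {z} := by
  have := hO.dvr
  obtain ⟨z, hz⟩ := IsDiscreteValuationRing.exists_irreducible O
  exact ⟨z, hz.maximalIdeal_eq⟩

theorem IsSmoothPoint.irreducible (hO : IsSmoothPoint O) {z : O}
    (hz : maximalIdeal O = Ideal.span {z}) : Irreducible z := by
  have := hO.dvr
  exact (IsDiscreteValuationRing.irreducible_iff_uniformizer z).2 hz

theorem coe_inv_unit (u : Oˣ) : (((u⁻¹ : Oˣ) : O) : F) = ((u : O) : F)⁻¹ := by
  refine eq_inv_of_mul_eq_one_left ?_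
  rw [← MulMemClass.coe_mul, Units.inv_mul]; rfl

theorem unit_ne_zero (u : Oˣ) : ((u : O) : F) ≠ 0 := fun h => by
  have := u.ne_zero
  exact this (Subtype.ext h)

theorem IsSmoothPoint.exists_eq_mul_zpow (hO : IsSmoothPoint O) {z : O}
    (hz : maximalIdeal O = Ideal.span {z}) {f : F} (hf : f ≠ 0) :
    ∃ (n : ℤ) (u : Oˣ), f = (u : O) * (z : F) ^ n := by
  have := hO.dvr
  have hz0 := hO.ne_zero hz
  obtain ⟨a, ha, b, hb, hb0, rfl⟩ := hO.frac f
  have ha0 : a ≠ 0 := by rintro rfl; simp at hf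
  obtain ⟨i, u, hu⟩ := IsDiscreteValuationRing.eq_unit_mul_pow_irreducible
    (x := (⟨a, ha⟩ : O)) (fun h => ha0 (congrArg Subtype.val h)) (hO.irreducible hz)
  obtain ⟨j, v, hv⟩ := IsDiscreteValuationRing.eq_unit_mul_pow_irreducible
    (x := (⟨b, hb⟩ : O)) (fun h => hb0 (congrArg Subtype.val h)) (hO.irreducible hz)
  replace hu : a = ((u : O) : F) * (z : F) ^ i := by simpa using congrArg Subtype.val hu
  replace hv : b = ((v : O) : F) * (z : F) ^ j := by simpa using congrArg Subtype.val hv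
  refine ⟨i - j, u * v⁻¹, ?_⟩
  rw [Units.val_mul, MulMemClass.coe_mul, coe_inv_unit, zpow_sub₀ hz0, hu, hv]
  simp only [zpow_natCast]
  have := unit_ne_zero v
  field_simp

/-- An element of `F` is regular or has a pole of some order `j + 1`. -/
theorem IsSmoothPoint.mem_or_pole (hO : IsSmoothPoint O) {z : O}
    (hz : maximalIdeal O = Ideal.span {z}) (f : F) :
    f ∈ O ∨ ∃ (j : ℕ) (u : Oˣ), (z : F) ^ (j + 1) * f = (u : O) := by
  rcases eq_or_ne f 0 with rfl | hf
  · exact .inl (zero_mem _)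
  have hz0 := hO.ne_zero hz
  obtain ⟨n, u, rfl⟩ := hO.exists_eq_mul_zpow hz hf
  rcases le_or_gt 0 n with hn | hn
  · lift n to ℕ using hn
    left; rw [zpow_natCast]; exact mul_mem u.1.2 (pow_mem z.2 _)
  · right
    obtain ⟨j, hj⟩ : ∃ j : ℕ, n = - ((j + 1 : ℕ) : ℤ) := ⟨(-n - 1).toNat, by omega⟩
    refine ⟨j, u, ?_⟩
    rw [hj, zpow_neg, zpow_natCast]; field_simp

theorem IsSmoothPoint.exists_pow_mul_mem (hO : IsSmoothPoint O) {z : O}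
    (hz : maximalIdeal O = Ideal.span {z}) (f : F) : ∃ n : ℕ, (z : F) ^ n * f ∈ O := by
  rcases hO.mem_or_pole hz f with h | ⟨j, u, h⟩
  · exact ⟨0, by simpa⟩
  · exact ⟨j + 1, h ▸ u.1.2⟩

/-- A unit divided by a uniformizer is not regular. -/
theorem IsSmoothPoint.not_mem_of_mul_eq_unit (hO : IsSmoothPoint O) {z : O}
    (hz : maximalIdeal O = Ideal.span {z}) {f : F} {u : Oˣ} (h : (z : F) * f = (u : O)) :
    f ∉ O := fun hf => by
  have : z * ⟨f, hf⟩ = (u : O) := Subtype.ext h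
  exact (hO.irreducible hz).not_isUnit (isUnit_of_mul_isUnit_left (this ▸ u.isUnit))

theorem mem_of_pow_mul_mem {z : F} (hz : z ∈ O) {i j : ℕ} (hij : i ≤ j) {f : F}
    (h : z ^ i * f ∈ O) : z ^ j * f ∈ O := by
  obtain ⟨d, rfl⟩ := Nat.exists_eq_add_of_le hij
  rw [pow_add, mul_assoc, mul_left_comm]
  exact mul_mem (pow_mem hz _) h

/-- A discrete valuation ring is a maximal proper subring of its fraction field. -/
theorem IsSmoothPoint.eq_of_le (hO : IsSmoothPoint O) {R : Subring F} (h : ∀ a ∈ O, a ∈ R)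
    (hR : R ≠ ⊤) : ∀ a ∈ R, a ∈ O := by
  obtain ⟨z, hz⟩ := hO.exists_uniformizer
  have hz0 := hO.ne_zero hz
  by_contra! hcon
  obtain ⟨a, haR, haO⟩ := hcon
  apply hR
  obtain ⟨j, u, hu⟩ := (hO.mem_or_pole hz a).resolve_left haO
  have hzi : (z : F)⁻¹ ∈ R := by
    have : (z : F)⁻¹ = ((u⁻¹ : Oˣ) : O) * ((z : F) ^ j * a) := by
      have hu0 := unit_ne_zero u
      rw [coe_inv_unit]; field_simp; rw [← hu]; ring
    rw [this]
    exact mul_mem (h _ (u⁻¹ : Oˣ).1.2) (mul_mem (h _ (pow_mem z.2 _)) haR)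
  rw [eq_top_iff]
  intro f _
  obtain ⟨n, hn⟩ := hO.exists_pow_mul_mem hz f
  have : f = (z : F)⁻¹ ^ n * ((z : F) ^ n * f) := by
    rw [inv_pow, inv_mul_cancel_left₀ (pow_ne_zero _ hz0)]
  rw [this]
  exact mul_mem (pow_mem hzi _) (h _ hn)

theorem IsSmoothPoint.ne_top (hO : IsSmoothPoint O) : O ≠ ⊤ := by
  obtain ⟨z, hz⟩ := hO.exists_uniformizer
  intro h
  have : (z : F)⁻¹ ∈ O := (SetLike.ext_iff.1 h _).2 Algebra.mem_top
  refine hO.not_mem_of_mul_eq_unit hz (u := 1) ?_ this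
  simp [hO.ne_zero hz]

variable [CharZero K]

theorem natCast_inv_mem (n : ℕ) : (n : F)⁻¹ ∈ O := by
  have : (n : F)⁻¹ = algebraMap K F (n : K)⁻¹ := by simp
  rw [this]; exact O.algebraMap_mem _

/-- In characteristic zero, an element of the local ring is a simple root, modulo the maximal ideal,
of a polynomial over `K`: the minimal polynomial of its class in the residue field. -/
theorem IsSmoothPoint.exists_separable (hO : IsSmoothPoint O) (a : O) :
    ∃ p : Polynomial K, Polynomial.aeval a p ∈ maximalIdeal O ∧
      IsUnit (Polynomial.aeval a (Polynomial.derivative p)) := by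
  have := hO.finite
  have hres : ∀ q : Polynomial K, residue O (Polynomial.aeval a q) =
      Polynomial.aeval (residue O a) q := fun q => by
    have := Polynomial.aeval_algebraMap_apply (ResidueField O) a q
    simpa [ResidueField.algebraMap_eq] using this.symm
  refine ⟨minpoly K (residue O a), ?_, ?_⟩
  · rw [← residue_eq_zero_iff, hres, minpoly.aeval]
  · rw [← residue_ne_zero_iff_isUnit, hres]
    have hint : IsIntegral K (residue O a) := Algebra.IsIntegral.isIntegral _
    exact (minpoly.irreducible hint).separable.aeval_derivative_ne_zero (minpoly.aeval _ _)

theorem GeneratedBy.D_mem {b : Finset F} (h : GeneratedBy b O) {R : Type*} [Field R] [Algebra R F]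
    {S : Submodule O Ω[F⁄R]} (hK : ∀ c : K, KaehlerDifferential.D R F (algebraMap K F c) ∈ S)
    (hb : ∀ y ∈ b, KaehlerDifferential.D R F y ∈ S) {a : F} (ha : a ∈ O) :
    KaehlerDifferential.D R F a ∈ S := by
  have hle : Algebra.adjoin K (b : Set F) ≤ O := Algebra.adjoin_le h.1
  have had : ∀ p ∈ Algebra.adjoin K (b : Set F), KaehlerDifferential.D R F p ∈ S := by
    intro p hp
    induction hp using Algebra.adjoin_induction with
    | mem x hx => exact hb x hx
    | algebraMap c => exact hK c
    | add x y _ _ hx hy => rw [map_add]; exact add_mem hx hy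
    | mul x y hx' hy' hx hy =>
      rw [Derivation.leibniz]
      exact add_mem (S.smul_mem ⟨x, hle hx'⟩ hy) (S.smul_mem ⟨y, hle hy'⟩ hx)
  obtain ⟨p, hp, q, hq, hqi, rfl⟩ := h.2 a ha
  rw [Derivation.leibniz, Derivation.leibniz_inv]
  have h2 : -q⁻¹ ^ 2 ∈ O := neg_mem (pow_mem hqi 2)
  exact add_mem (S.smul_mem (⟨p, hle hp⟩ : O) (S.smul_mem (⟨_, h2⟩ : O) (had q hq)))
    (S.smul_mem (⟨_, hqi⟩ : O) (had p hp))

theorem GeneratedBy.regularForms_eq {b : Finset F} (h : GeneratedBy b O) :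
    regularForms O K = Submodule.span O (KaehlerDifferential.D K F '' (b : Set F)) := by
  refine le_antisymm (Submodule.span_le.2 ?_) (Submodule.span_mono (Set.image_mono h.1))
  rintro _ ⟨a, ha, rfl⟩
  exact h.D_mem (S := Submodule.span O _) (fun c => by rw [Derivation.map_algebraMap]; exact zero_mem _)
    (fun y hy => Submodule.subset_span (Set.mem_image_of_mem _ hy)) ha

theorem D_mem_regularForms {R : Type*} [Field R] [Algebra R F] {a : F} (ha : a ∈ O) :
    KaehlerDifferential.D R F a ∈ regularForms O R := Submodule.subset_span ⟨a, ha, rfl⟩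

/-- The regular forms are generated by the differential of a uniformizer. -/
theorem IsSmoothPoint.regularForms_eq (hO : IsSmoothPoint O) {z : O}
    (hz : maximalIdeal O = Ideal.span {z}) :
    regularForms O K = Submodule.span O {KaehlerDifferential.D K F (z : F)} := by
  obtain ⟨b, hb⟩ := hO.generated
  refine le_antisymm ?_ (Submodule.span_le.2 (by simpa using D_mem_regularForms z.2))
  -- by Nakayama's lemma it suffices to generate modulo the maximal ideal
  refine Submodule.le_of_le_smul_of_le_jacobson_bot (I := maximalIdeal O) ?_
    (IsLocalRing.maximalIdeal_le_jacobson _) ?_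
  · rw [hb.regularForms_eq]
    exact Submodule.fg_span (b.finite_toSet.image _)
  · refine Submodule.span_le.2 ?_
    rintro _ ⟨a, ha, rfl⟩
    obtain ⟨p, hp, hp'⟩ := hO.exists_separable ⟨a, ha⟩
    rw [hz, Ideal.mem_span_singleton] at hp
    obtain ⟨q, hq⟩ := hp
    obtain ⟨c, hc⟩ := hp'.exists_left_inv
    -- `p(a) = z q` with `p'(a)` a unit, so that `p'(a) da = z dq + q dz`
    have e1 : KaehlerDifferential.D K F (Polynomial.aeval a p) =
        Polynomial.aeval a (Polynomial.derivative p) • KaehlerDifferential.D K F a :=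
      Derivation.map_aeval _ _ _
    have hcoe : ∀ r : Polynomial K, ((Polynomial.aeval (⟨a, ha⟩ : O) r : O) : F) =
        Polynomial.aeval a r := fun r => by
      simpa using (Polynomial.aeval_algebraMap_apply F (⟨a, ha⟩ : O) r).symm
    have e2 : Polynomial.aeval a p = (z : F) * q := by rw [← hcoe, hq]; rfl
    have e3 : (c : F) * Polynomial.aeval a (Polynomial.derivative p) = 1 := by
      rw [← hcoe]; exact congrArg Subtype.val hc
    have e4 : KaehlerDifferential.D K F a = c • (z • KaehlerDifferential.D K F (q : F) +
        q • KaehlerDifferential.D K F (z : F)) := by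
      change _ = (c : F) • ((z : F) • KaehlerDifferential.D K F (q : F) +
        (q : F) • KaehlerDifferential.D K F (z : F))
      rw [← Derivation.leibniz, ← e2, e1, smul_smul, e3, one_smul]
    change KaehlerDifferential.D K F a ∈ _
    rw [e4]
    refine Submodule.smul_mem _ _ (add_mem ?_ ?_)
    · refine Submodule.mem_sup_right (Submodule.smul_mem_smul ?_ (D_mem_regularForms q.2))
      rw [hz]; exact Ideal.mem_span_singleton_self z
    · exact Submodule.mem_sup_left (Submodule.smul_mem _ _ (Submodule.mem_span_singleton_self _))

theorem span_regularForms [CharZero F] (hfrac : ∀ f : F, ∃ a ∈ O, ∃ b ∈ O, b ≠ 0 ∧ f = a / b) :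
    Submodule.span F (regularForms O K : Set Ω[F⁄K]) = ⊤ := by
  rw [eq_top_iff, ← KaehlerDifferential.span_range_derivation, Submodule.span_le]
  rintro _ ⟨f, rfl⟩
  obtain ⟨a, ha, b, hb, hb0, rfl⟩ := hfrac f
  rw [div_eq_mul_inv, Derivation.leibniz, Derivation.leibniz_inv]
  have h : ∀ a ∈ O, KaehlerDifferential.D K F a ∈
      Submodule.span F (regularForms O K : Set Ω[F⁄K]) := fun a ha =>
    Submodule.subset_span (D_mem_regularForms ha)
  exact add_mem (Submodule.smul_mem _ _ (Submodule.smul_mem _ _ (h b hb)))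
    (Submodule.smul_mem _ _ (h a ha))

theorem IsSmoothPoint.span_D (hO : IsSmoothPoint O) {z : O}
    (hz : maximalIdeal O = Ideal.span {z}) :
    Submodule.span F {KaehlerDifferential.D K F (z : F)} = ⊤ := by
  have : CharZero F := charZero_of_injective_algebraMap (algebraMap K F).injective
  rw [eq_top_iff, ← span_regularForms (K := K) hO.frac, Submodule.span_le, hO.regularForms_eq hz]
  intro ω hω
  obtain ⟨c, rfl⟩ := Submodule.mem_span_singleton.1 hω
  exact Submodule.smul_mem _ (c : F) (Submodule.mem_span_singleton_self _)

theorem IsSmoothPoint.D_ne_zero (hO : IsSmoothPoint O) {z : O}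
    (hz : maximalIdeal O = Ideal.span {z}) : KaehlerDifferential.D K F (z : F) ≠ 0 := by
  intro h
  have h1 := hO.span_D hz
  rw [h, Submodule.span_zero_singleton] at h1
  have h2 := hO.finrank_eq_one
  have : Subsingleton Ω[F⁄K] := (Submodule.subsingleton_iff F).1 (subsingleton_of_bot_eq_top h1)
  rw [Module.finrank_zero_of_subsingleton] at h2
  exact zero_ne_one h2

/-- The derivation `d / dz`. -/
theorem IsSmoothPoint.exists_derivation (hO : IsSmoothPoint O) {z : O}
    (hz : maximalIdeal O = Ideal.span {z}) :
    ∃ d : Derivation K F F, d (z : F) = 1 ∧ (∀ a ∈ O, d a ∈ O) ∧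
      (∀ f, KaehlerDifferential.D K F f = d f • KaehlerDifferential.D K F (z : F)) := by
  have hb : ∀ ω : Ω[F⁄K], ∃ c : F, c • KaehlerDifferential.D K F (z : F) = ω := fun ω =>
    Submodule.mem_span_singleton.1 (hO.span_D hz ▸ Submodule.mem_top (x := ω))
  choose c hc using hb
  have hinj : ∀ {a b : F}, a • KaehlerDifferential.D K F (z : F) =
      b • KaehlerDifferential.D K F (z : F) → a = b := fun h =>
    smul_left_injective F (hO.D_ne_zero hz) h
  let φ : Ω[F⁄K] →ₗ[F] F :=
    { toFun := c
      map_add' := fun x y => hinj (by rw [add_smul, hc, hc, hc])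
      map_smul' := fun r x => hinj (by simp [mul_smul, hc]) }
  refine ⟨φ.compDer (KaehlerDifferential.D K F), hinj ?_, fun a ha => ?_, fun f => ?_⟩
  · exact (hc _).trans (one_smul _ _).symm
  · have := D_mem_regularForms (R := K) ha
    rw [hO.regularForms_eq hz] at this
    obtain ⟨r, hr⟩ := Submodule.mem_span_singleton.1 this
    have : c (KaehlerDifferential.D K F a) = r := hinj ((hc _).trans hr.symm)
    change c (KaehlerDifferential.D K F a) ∈ O
    rw [this]; exact r.2
  · exact (hc _).symm

end LocalRing

section Residue

variable {K F : Type*} [Field K] [Field F] [Algebra K F] {O : Subalgebra K F} [IsLocalRing O]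
  [CharZero K]

/-- If `f` has a pole of order `j > 0` at the point with uniformizer `z`, then so does
`z df / dz`: this needs characteristic zero. -/
theorem IsSmoothPoint.pow_mul_mem_of_deriv (hO : IsSmoothPoint O) {z : O}
    (hz : maximalIdeal O = Ideal.span {z}) {d : Derivation K F F} (hd : d (z : F) = 1)
    (hdO : ∀ a ∈ O, d a ∈ O) {i : ℕ} {f : F} (h : (z : F) ^ (i + 1) * d f ∈ O) :
    (z : F) ^ i * f ∈ O := by
  have : CharZero F := charZero_of_injective_algebraMap (algebraMap K F).injective
  rcases hO.mem_or_pole hz f with hf | ⟨j, u, hu⟩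
  · exact mul_mem (pow_mem z.2 _) hf
  rcases lt_or_ge j i with hij | hij
  · exact mem_of_pow_mul_mem z.2 (show j + 1 ≤ i from hij) (hu ▸ u.1.2)
  exfalso
  have h1 : (z : F) ^ (j + 1) * d f ∈ O := mem_of_pow_mul_mem z.2 (by omega) h
  have h2 : d ((u : O) : F) ∈ O := hdO _ u.1.2
  have h3 : ((j + 1 : ℕ) : F) * ((z : F) ^ j * f) ∈ O := by
    have : ((j + 1 : ℕ) : F) * ((z : F) ^ j * f) = d ((u : O) : F) - (z : F) ^ (j + 1) * d f := by
      rw [← hu, Derivation.leibniz, Derivation.leibniz_pow, hd]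
      simp only [smul_eq_mul, nsmul_eq_mul, Nat.add_sub_cancel]
      ring
    rw [this]; exact sub_mem h2 h1
  have h4 : (z : F) ^ j * f ∈ O := by
    have := mul_mem (natCast_inv_mem (O := O) (j + 1)) h3
    rwa [inv_mul_cancel_left₀ (Nat.cast_ne_zero.2 (Nat.succ_ne_zero j))] at this
  refine hO.not_mem_of_mul_eq_unit hz (u := u) ?_ h4
  rw [← hu]; ring

theorem IsSmoothPoint.smul_D_mem_iff (hO : IsSmoothPoint O) {z : O}
    (hz : maximalIdeal O = Ideal.span {z}) {f : F} :
    f • KaehlerDifferential.D K F (z : F) ∈ regularForms O K ↔ f ∈ O := by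
  rw [hO.regularForms_eq hz, Submodule.mem_span_singleton]
  constructor
  · rintro ⟨a, ha⟩
    have : (a : F) = f := smul_left_injective F (hO.D_ne_zero hz) ha
    exact this ▸ a.2
  · intro h; exact ⟨⟨f, h⟩, rfl⟩

theorem IsSmoothPoint.exists_smul_D (hO : IsSmoothPoint O) {z : O}
    (hz : maximalIdeal O = Ideal.span {z}) (ω : Ω[F⁄K]) :
    ∃ f : F, ω = f • KaehlerDifferential.D K F (z : F) := by
  obtain ⟨f, hf⟩ := Submodule.mem_span_singleton.1 (hO.span_D hz ▸ Submodule.mem_top (x := ω))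
  exact ⟨f, hf.symm⟩

/-- The definition of the residue does not depend on the choice of the uniformizer. -/
theorem IsSmoothPoint.hasResidue_iff (hO : IsSmoothPoint O) {z : O}
    (hz : maximalIdeal O = Ideal.span {z}) {ω : Ω[F⁄K]} {r : K} :
    HasResidue O ω r ↔ ∃ (u : O) (h : F), ω - ((u : F) * (z : F)⁻¹) •
      KaehlerDifferential.D K F (z : F) - KaehlerDifferential.D K F h ∈ regularForms O K ∧
      r = Algebra.trace K (ResidueField O) (residue O u) := by
  constructor
  · rintro ⟨z', u, h, hz', hω, hr⟩
    refine ⟨u, h, ?_, hr⟩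
    have hz0 := hO.ne_zero hz
    have hzz : Associated z z' := by
      rw [← Ideal.span_singleton_eq_span_singleton, ← hz, hz']
    obtain ⟨v, hv⟩ := hzz
    have hv0 := unit_ne_zero v
    -- `dz' / z'` and `dz / z` differ by `dv / v`, which is regular
    have e : ((u : F) * (z' : F)⁻¹) • KaehlerDifferential.D K F (z' : F) =
        ((u : F) * (z : F)⁻¹) • KaehlerDifferential.D K F (z : F) +
        (u * ((v⁻¹ : Oˣ) : O)) • KaehlerDifferential.D K F ((v : O) : F) := by
      rw [← hv, MulMemClass.coe_mul, Derivation.leibniz, smul_add, smul_smul, smul_smul, add_comm]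
      congr 2
      · field_simp
      · rw [MulMemClass.coe_mul, coe_inv_unit]; field_simp
    have hreg : (u * ((v⁻¹ : Oˣ) : O)) • KaehlerDifferential.D K F ((v : O) : F) ∈
        regularForms O K := Submodule.smul_mem _ _ (D_mem_regularForms v.1.2)
    rw [e] at hω
    have := add_mem hω hreg
    convert this using 1; abel
  · rintro ⟨u, h, hω, hr⟩
    exact ⟨z, u, h, hz, hω, hr⟩

/-- The residue is well defined: `u dz / z + dh` is regular only if `h` and `u / z` are regular,
since an exact form has no simple pole. -/
theorem IsSmoothPoint.hasResidue_unique (hO : IsSmoothPoint O) {ω : Ω[F⁄K]} {r r' : K}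
    (h : HasResidue O ω r) (h' : HasResidue O ω r') : r = r' := by
  obtain ⟨z, hz⟩ := hO.exists_uniformizer
  obtain ⟨d, hd, hdO, hdf⟩ := hO.exists_derivation hz
  have hz0 := hO.ne_zero hz
  rw [hO.hasResidue_iff hz] at h h'
  obtain ⟨u, g, hu, rfl⟩ := h
  obtain ⟨u', g', hu', rfl⟩ := h'
  have h1 := sub_mem hu' hu
  have e : (ω - ((u' : F) * (z : F)⁻¹) • KaehlerDifferential.D K F (z : F) -
      KaehlerDifferential.D K F g') - (ω - ((u : F) * (z : F)⁻¹) •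
      KaehlerDifferential.D K F (z : F) - KaehlerDifferential.D K F g) =
      (((u : F) - u') * (z : F)⁻¹ + d (g - g')) • KaehlerDifferential.D K F (z : F) := by
    rw [hdf g, hdf g', map_sub]; module
  rw [e, hO.smul_D_mem_iff hz] at h1
  have h2 : (z : F) ^ (0 + 1) * d (g - g') ∈ O := by
    have : (z : F) ^ (0 + 1) * d (g - g') =
        z * (((u : F) - u') * (z : F)⁻¹ + d (g - g')) - (u - u') := by field_simp; ring
    rw [this]
    exact sub_mem (mul_mem z.2 h1) (sub_mem u.2 u'.2)
  have h3 := hO.pow_mul_mem_of_deriv hz hd hdO h2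
  rw [pow_zero, one_mul] at h3
  have h4 : ((u : F) - u') * (z : F)⁻¹ ∈ O := by
    simpa using sub_mem h1 (hdO _ h3)
  have h5 : u - u' ∈ maximalIdeal O := by
    rw [hz, Ideal.mem_span_singleton]
    refine ⟨⟨_, h4⟩, Subtype.ext ?_⟩
    rw [MulMemClass.coe_mul]
    simp only [AddSubgroupClass.coe_sub]
    field_simp
  rw [← residue_eq_zero_iff, map_sub, sub_eq_zero] at h5
  rw [h5]

theorem IsSmoothPoint.exists_hasResidue (hO : IsSmoothPoint O) (ω : Ω[F⁄K]) :
    ∃ r, HasResidue O ω r := by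
  have : CharZero F := charZero_of_injective_algebraMap (algebraMap K F).injective
  obtain ⟨z, hz⟩ := hO.exists_uniformizer
  obtain ⟨d, hd, hdO, hdf⟩ := hO.exists_derivation hz
  have hz0 := hO.ne_zero hz
  obtain ⟨g, rfl⟩ := hO.exists_smul_D hz ω
  suffices H : ∀ (n : ℕ) (g : F), (z : F) ^ n * g ∈ O → ∃ (u : O) (h : F),
      g - u * (z : F)⁻¹ - d h ∈ O by
    obtain ⟨n, hn⟩ := hO.exists_pow_mul_mem hz g
    obtain ⟨u, h, hu⟩ := H n g hn
    refine ⟨_, (hO.hasResidue_iff hz).2 ⟨u, h, ?_, rfl⟩⟩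
    rw [hdf h, ← sub_smul, ← sub_smul, hO.smul_D_mem_iff hz]
    exact hu
  intro n
  induction n with
  | zero => intro g hg; exact ⟨0, 0, by simpa using hg⟩
  | succ n ih =>
    intro g hg
    rcases Nat.eq_zero_or_pos n with rfl | hn
    · refine ⟨⟨_, hg⟩, 0, ?_⟩
      have : g - ((z : F) ^ (0 + 1) * g) * (z : F)⁻¹ - d 0 = 0 := by
        rw [map_zero]; field_simp; ring
      rw [this]; exact zero_mem _
    · have hn0 : (n : F) ≠ 0 := by exact_mod_cast hn.ne'
      -- subtract the exact form with the same polar part of order `n + 1`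
      set h0 : F := -((n : F)⁻¹ * ((z : F) * g)) with hh0
      have e : (z : F) ^ n * (g - d h0) = (n : F)⁻¹ * d ((z : F) ^ (n + 1) * g) := by
        rw [hh0, map_neg, Derivation.leibniz, Derivation.leibniz _ (z : F) g,
          Derivation.leibniz _ _ g, Derivation.leibniz_pow, Derivation.leibniz_inv,
          Derivation.map_natCast, hd]
        simp only [smul_eq_mul, nsmul_eq_mul, Nat.add_sub_cancel]
        push_cast
        field_simp
        ring
      obtain ⟨u, h, hu⟩ := ih (g - d h0) (by
        rw [e]; exact mul_mem (natCast_inv_mem _) (hdO _ hg))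
      refine ⟨u, h0 + h, ?_⟩
      convert hu using 1
      rw [map_add]; ring

theorem hasResidue_of_mem (hO : IsSmoothPoint O) {ω : Ω[F⁄K]} (h : ω ∈ regularForms O K) :
    HasResidue O ω 0 := by
  obtain ⟨z, hz⟩ := hO.exists_uniformizer
  exact ⟨z, 0, 0, hz, by simpa using h, by simp⟩

theorem hasResidue_D (hO : IsSmoothPoint O) (h : F) :
    HasResidue O (KaehlerDifferential.D K F h) 0 := by
  obtain ⟨z, hz⟩ := hO.exists_uniformizer
  exact ⟨z, 0, h, hz, by simp, by simp⟩

theorem HasResidue.add (hO : IsSmoothPoint O) {ω ω' : Ω[F⁄K]} {r r' : K} (h : HasResidue O ω r)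
    (h' : HasResidue O ω' r') : HasResidue O (ω + ω') (r + r') := by
  obtain ⟨z, hz⟩ := hO.exists_uniformizer
  rw [hO.hasResidue_iff hz] at h h' ⊢
  obtain ⟨u, g, hu, rfl⟩ := h
  obtain ⟨u', g', hu', rfl⟩ := h'
  refine ⟨u + u', g + g', ?_, by simp⟩
  convert add_mem hu hu' using 1
  rw [map_add, AddMemClass.coe_add]
  module

theorem HasResidue.smul {ω : Ω[F⁄K]} {r : K} (h : HasResidue O ω r) (c : K) :
    HasResidue O (c • ω) (c * r) := by
  obtain ⟨z, u, g, hz, hu, rfl⟩ := h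
  refine ⟨z, c • u, c • g, hz, ?_, ?_⟩
  · convert (regularForms O K).smul_mem (algebraMap K O c) hu using 1
    rw [algebraMap_smul, Derivation.map_smul, smul_sub, smul_sub]
    congr 2
    rw [show ((c • u : O) : F) = c • (u : F) from rfl, smul_mul_assoc, smul_assoc]
  · have : residue O (c • u) = c • residue O u := by
      rw [Algebra.smul_def, Algebra.smul_def, map_mul]; rfl
    rw [this, map_smul, smul_eq_mul]

theorem HasResidue.sum (hO : IsSmoothPoint O) {ι : Type*} (s : Finset ι) {ω : ι → Ω[F⁄K]}
    {r : ι → K} (h : ∀ i, HasResidue O (ω i) (r i)) :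
    HasResidue O (∑ i ∈ s, ω i) (∑ i ∈ s, r i) := by
  classical
  induction s using Finset.induction_on with
  | empty => simpa using hasResidue_of_mem hO (zero_mem _)
  | insert a s ha ih => rw [Finset.sum_insert ha, Finset.sum_insert ha]; exact (h a).add hO ih

end Residue

/-! ### The local rings of a smooth curve over a field -/

section Unramified
open Polynomial

/-- If `dt` generates the differentials of a local ring `O` that is essentially of finite type, then
`O` is unramified over `K[t]`, so that its maximal ideal is generated by an element of `K[t]`. -/
theorem maximalIdeal_principal_of_span_D {K O : Type*} [Field K] [CommRing O] [IsLocalRing O]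
    [Algebra K O] [Algebra.EssFiniteType K O] (t : O)
    (ht : Submodule.span O {KaehlerDifferential.D K O t} = ⊤) :
    (∃ z : O, maximalIdeal O = Ideal.span {z}) ∧
      (maximalIdeal O ≠ ⊥ → Module.Finite K (ResidueField O)) := by
  let : Algebra K[X] O := (aeval t).toAlgebra
  have hmap : algebraMap K[X] O = (aeval t : K[X] →ₐ[K] O).toRingHom := rfl
  have : IsScalarTower K K[X] O := .of_algebraMap_eq fun a => by
    rw [hmap]; simp
  have : Algebra.FormallyUnramified K[X] O := by
    have hs := KaehlerDifferential.map_surjective K K[X] O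
    have h0 : ∀ ω, KaehlerDifferential.map K K[X] O O ω = 0 := fun ω => by
      have hω : ω ∈ Submodule.span O {KaehlerDifferential.D K O t} := ht ▸ trivial
      obtain ⟨c, rfl⟩ := Submodule.mem_span_singleton.1 hω
      have : t = algebraMap K[X] O X := by rw [hmap]; simp
      rw [map_smul, KaehlerDifferential.map_D]
      simp only [Algebra.algebraMap_self, RingHom.id_apply]
      rw [this, Derivation.map_algebraMap, smul_zero]
    exact ⟨⟨fun a b => by
      obtain ⟨a, rfl⟩ := hs a; obtain ⟨b, rfl⟩ := hs b; rw [h0, h0]⟩⟩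
  let p : Ideal K[X] := (maximalIdeal O).comap (algebraMap K[X] O)
  have : p.IsPrime := Ideal.IsPrime.comap _
  let R := Localization.AtPrime p
  have hu : ∀ y : p.primeCompl, IsUnit (algebraMap K[X] O y) := fun y => by
    by_contra h
    exact y.2 ((mem_maximalIdeal _).2 h)
  let : Algebra R O := (IsLocalization.lift hu).toAlgebra
  have : IsScalarTower K[X] R O := .of_algebraMap_eq fun a => (IsLocalization.lift_eq hu a).symm
  have : IsScalarTower K R O := .of_algebraMap_eq fun a => by
    rw [IsScalarTower.algebraMap_apply K K[X] O, IsScalarTower.algebraMap_apply K[X] R O,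
      ← IsScalarTower.algebraMap_apply K K[X] R]
  have : Algebra.FormallyUnramified R O := .of_restrictScalars K[X] R O
  have : Algebra.EssFiniteType R O := .of_comp K R O
  have : IsLocalHom (algebraMap R O) := ⟨fun a ha => by
    obtain ⟨a, s, rfl⟩ := IsLocalization.exists_mk'_eq p.primeCompl a
    rw [IsLocalization.mk'_eq_mul_mk'_one, map_mul, ← IsScalarTower.algebraMap_apply] at ha
    have h1 : IsUnit (algebraMap K[X] O a) := isUnit_of_mul_isUnit_left ha
    have : a ∈ p.primeCompl := fun h => (mem_maximalIdeal _).1 h h1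
    exact (IsLocalization.AtPrime.isUnit_mk'_iff R p a s).2 this⟩
  have hm := Algebra.FormallyUnramified.map_maximalIdeal (R := R) (S := O)
  have hp : Ideal.map (algebraMap K[X] R) p = maximalIdeal R :=
    Localization.AtPrime.map_eq_maximalIdeal
  obtain ⟨g, hg⟩ := (IsPrincipalIdealRing.principal p).principal
  have hg : p = Ideal.span {g} := hg
  have hz : maximalIdeal O = Ideal.span {algebraMap K[X] O g} := by
    rw [← hm, ← hp, Ideal.map_map, ← IsScalarTower.algebraMap_eq,
      congrArg (Ideal.map (algebraMap K[X] O)) hg, Ideal.map_span, Set.image_singleton]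
  refine ⟨⟨_, hz⟩, fun hne => ?_⟩
  have hg0 : g ≠ 0 := by
    rintro rfl
    apply hne; rw [hz, map_zero]; simp
  have : Module.Finite K (K[X] ⧸ p) := by
    rw [hg]
    exact (AdjoinRoot.powerBasis hg0).finite
  have hpm : p.IsMaximal := by
    have hp0 : p ≠ ⊥ := by rw [hg]; simpa using hg0
    exact IsPrime.to_maximal_ideal hp0
  have : Module.Finite K p.ResidueField :=
    Module.Finite.of_surjective (IsScalarTower.toAlgHom K (K[X] ⧸ p) p.ResidueField).toLinearMap
      (p.bijective_algebraMap_quotient_residueField).surjective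
  have : Module.Finite (ResidueField R) (ResidueField O) := inferInstance
  have : IsScalarTower K (ResidueField R) (ResidueField O) := by
    refine .of_algebraMap_eq fun a => ?_
    rw [IsScalarTower.algebraMap_apply K R (ResidueField R), IsScalarTower.algebraMap_apply K O (ResidueField O),
      IsScalarTower.algebraMap_apply K R O]
    rfl
  have : Module.Finite K (ResidueField R) := ‹Module.Finite K p.ResidueField›
  exact Module.Finite.trans (ResidueField R) _

end Unramified

section Scheme

variable {K : Type u} [Field K] {C : Scheme.{u}} [IsIntegral C] (f : C ⟶ Spec (.of K))

theorem localRing_generic : localRing f (genericPoint C) = ⊤ := by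
  refine eq_top_iff.2 fun g _ => ⟨g, ?_⟩
  change (C.presheaf.stalkSpecializes _).hom g = g
  rw [TopCat.Presheaf.stalkSpecializes_refl]; rfl

/-- The inclusion of the sections of the structure sheaf over `U` into the function field, by way
of the stalk at a point `x` of `U`. -/
def sectionMap {U : C.Opens} (x : C) (hx : x ∈ U) : Γ(C, U) →+* FunctionField f :=
  (algebraMap (C.presheaf.stalk x) C.functionField).comp (C.presheaf.germ U x hx).hom

theorem sectionMap_eq {U : C.Opens} (x y : C) (hx : x ∈ U) (hy : y ∈ U) :
    sectionMap f x hx = sectionMap f y hy := by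
  have : Nonempty U := ⟨⟨x, hx⟩⟩
  ext a
  exact (Scheme.algebraMap_germ_eq_germToFunctionField C hx a).trans
    (Scheme.algebraMap_germ_eq_germToFunctionField C hy a).symm

theorem sectionMap_mem {U : C.Opens} (x y : C) (hx : x ∈ U) (hy : y ∈ U) (a : Γ(C, U)) :
    sectionMap f x hx a ∈ localRing f y := by
  rw [sectionMap_eq f x y hx hy]; exact ⟨_, rfl⟩

theorem localRing_spread (x : C) (g : FunctionField f) (hg : g ∈ localRing f x) :
    ∃ U : Opens C, x ∈ U ∧ ∀ y ∈ U, g ∈ localRing f y := by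
  obtain ⟨s, rfl⟩ := hg
  obtain ⟨U, hU, a, rfl⟩ := C.presheaf.exists_germ_eq s
  exact ⟨U, hU, fun y hy => sectionMap_mem f x y hU hy a⟩

theorem localRing_frac (x : C) (g : FunctionField f) :
    ∃ a ∈ localRing f x, ∃ b ∈ localRing f x, b ≠ 0 ∧ g = a / b := by
  obtain ⟨a, b, hb, h⟩ := IsFractionRing.div_surjective (A := C.presheaf.stalk x) (K := C.functionField) g
  refine ⟨_, ⟨a, rfl⟩, _, ⟨b, rfl⟩, ?_, h.symm⟩
  exact (map_ne_zero_iff _ (IsFractionRing.injective (C.presheaf.stalk x) C.functionField)).2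
    (nonZeroDivisors.ne_zero hb)

/-- The local ring, as a subalgebra of the function field, is the stalk. -/
def stalkEquiv (x : C) : C.presheaf.stalk x ≃+* localRing f x :=
  RingEquiv.ofBijective (algebraMap (C.presheaf.stalk x) C.functionField).rangeSRestrict
    ⟨fun a b h => IsFractionRing.injective (C.presheaf.stalk x) C.functionField
      (congrArg Subtype.val h), RingHom.rangeSRestrict_surjective _⟩

theorem isNoetherianRing_localRing [LocallyOfFiniteType f] (x : C) :
    IsNoetherianRing (localRing f x) := by
  have : IsLocallyNoetherian C := LocallyOfFiniteType.isLocallyNoetherian f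
  have : IsNoetherianRing (C.presheaf.stalk x) := inferInstance
  exact isNoetherianRing_of_ringEquiv _ (stalkEquiv f x)

/-- The structure map from `K` to the sections over `V`. -/
def structMap (V : C.Opens) : K →+* Γ(C, V) :=
  ((Scheme.ΓSpecIso (.of K)).inv ≫ f.appLE ⊤ V le_top).hom

theorem sectionMap_structMap {V : C.Opens} (x : C) (hx : x ∈ V) (a : K) :
    sectionMap f x hx (structMap f V a) = algebraMap K (FunctionField f) a := by
  have : Nonempty V := ⟨⟨x, hx⟩⟩
  refine (Scheme.algebraMap_germ_eq_germToFunctionField C hx _).trans ?_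
  change (f.appLE ⊤ V le_top ≫ C.presheaf.germ V _ _).hom ((Scheme.ΓSpecIso (.of K)).inv.hom a) =
    (f.appTop ≫ C.presheaf.germ ⊤ (genericPoint C) trivial).hom
      ((Scheme.ΓSpecIso (.of K)).inv.hom a)
  have hη : genericPoint C ∈ V :=
    ((genericPoint_spec C).mem_open_set_iff V.isOpen).2 ⟨x, trivial, hx⟩
  have h : f.appLE ⊤ V le_top ≫ C.presheaf.germ V _ hη =
      f.appTop ≫ C.presheaf.germ ⊤ (genericPoint C) trivial := by
    rw [← C.presheaf.germ_res (homOfLE (le_top : V ≤ ⊤)) _ hη, ← Category.assoc]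
    rfl
  rw [← h]

theorem exists_chart [SmoothOfRelativeDimension 1 f] (x : C) : ∃ V : C.Opens, x ∈ V ∧ IsAffineOpen V ∧
    (structMap f V).IsStandardSmoothOfRelativeDimension 1 := by
  obtain ⟨U, hU, V, hV, hx, e, h⟩ :=
    SmoothOfRelativeDimension.exists_isStandardSmoothOfRelativeDimension (n := 1) (f := f) x
  have hUtop : U = ⊤ := by
    refine Opens.ext (Set.eq_univ_of_forall fun y => ?_)
    have hy : f x ∈ U := e hx
    have : Subsingleton (Spec (.of K)) := inferInstanceAs (Subsingleton (PrimeSpectrum K))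
    exact Subsingleton.elim (f x) y ▸ hy
  subst hUtop
  refine ⟨V, hx, hV, ?_⟩
  exact RingHom.isStandardSmoothOfRelativeDimension_respectsIso.2 (f.appLE ⊤ V e).hom
    ((Scheme.ΓSpecIso (.of K)).symm.commRingCatIsoToRingEquiv) h

end Scheme

section Chart

variable {K A F : Type*} [Field K] [CommRing A] [Algebra K A] [Field F] [Algebra K F] [Algebra A F]
  [IsScalarTower K A F]

/-- Every element of `O` is a quotient of elements of `A`, with denominators invertible in `O`. -/
def IsLocalizedFrom (A : Type*) [CommRing A] [Algebra A F] (O : Subalgebra K F) : Prop :=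
  (∀ a : A, algebraMap A F a ∈ O) ∧ ∀ g ∈ O, ∃ p q : A, (algebraMap A F q)⁻¹ ∈ O ∧
    algebraMap A F q ≠ 0 ∧ g = algebraMap A F p * (algebraMap A F q)⁻¹

theorem exists_generatedBy [Algebra.FiniteType K A] :
    ∃ b : Finset F, ∀ O : Subalgebra K F, IsLocalizedFrom A O → GeneratedBy b O := by
  classical
  obtain ⟨s, hs⟩ := Algebra.FiniteType.out (R := K) (A := A)
  have him : ∀ a : A, algebraMap A F a ∈ Algebra.adjoin K ((s.image (algebraMap A F) : Finset F) : Set F) := by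
    intro a
    have : a ∈ Algebra.adjoin K (s : Set A) := hs ▸ Algebra.mem_top
    have h2 : IsScalarTower.toAlgHom K A F a ∈
      (Algebra.adjoin K (s : Set A)).map (IsScalarTower.toAlgHom K A F) := ⟨a, this, rfl⟩
    rw [AlgHom.map_adjoin] at h2
    simpa using h2
  refine ⟨s.image (algebraMap A F), fun O hO => ⟨?_, fun a ha => ?_⟩⟩
  · intro y hy
    simp only [Finset.coe_image, Set.mem_image] at hy
    obtain ⟨a, -, rfl⟩ := hy
    exact hO.1 a
  · obtain ⟨p, q, hq, -, rfl⟩ := hO.2 a ha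
    exact ⟨_, him p, _, him q, hq, rfl⟩

theorem GeneratedBy.essFiniteType {b : Finset F} {O : Subalgebra K F} (h : GeneratedBy b O) :
    Algebra.EssFiniteType K O := by
  classical
  rw [Algebra.essFiniteType_iff]
  refine ⟨b.attach.image (fun y => ⟨y.1, h.1 y.2⟩), ?_⟩
  set S := Algebra.adjoin K ((b.attach.image (fun y => ⟨y.1, h.1 y.2⟩) : Finset O) : Set O) with hS
  have hmap : S.map O.val = Algebra.adjoin K (b : Set F) := by
    rw [hS, AlgHom.map_adjoin]
    congr 1
    ext y
    constructor
    · rintro ⟨_, hz, rfl⟩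
      obtain ⟨y, -, rfl⟩ := Finset.mem_image.1 hz
      exact y.2
    · intro hy
      exact ⟨_, Finset.mem_image.2 ⟨⟨y, hy⟩, Finset.mem_attach _ _, rfl⟩, rfl⟩
  intro a
  obtain ⟨p, hp, q, hq, hq', ha⟩ := h.2 a a.2
  rw [← hmap] at hp hq
  obtain ⟨p, hp, hp'⟩ := hp
  obtain ⟨q, hq, hq''⟩ := hq
  change (p : F) = _ at hp'
  change (q : F) = _ at hq''
  subst hp' hq''
  rcases eq_or_ne (q : F) 0 with h0 | h0
  · refine ⟨1, one_mem _, isUnit_one, ?_⟩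
    have : a = 0 := Subtype.ext (by rw [ha, h0]; simp)
    rw [this]; simp
  · refine ⟨q, hq, .of_mul_eq_one ⟨_, hq'⟩ (Subtype.ext (mul_inv_cancel₀ h0)), ?_⟩
    have : a * q = p := Subtype.ext (by
      rw [MulMemClass.coe_mul, ha]; exact inv_mul_cancel_right₀ h0 _)
    rw [this]; exact hp

/-- The differentials of the local ring of a smooth curve are generated by one differential. -/
theorem exists_span_D_eq_top [Algebra.IsStandardSmoothOfRelativeDimension 1 K A]
    {O : Subalgebra K F} [IsLocalRing O] (hO : IsLocalizedFrom A O) :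
    ∃ t : O, Submodule.span O {KaehlerDifferential.D K O t} = ⊤ := by
  let _ : Algebra A O := ((algebraMap A F).codRestrict O.toSubring hO.1).toAlgebra
  have hmap : ∀ a, ((algebraMap A O a : O) : F) = algebraMap A F a := fun a => rfl
  have : IsScalarTower K A O := .of_algebraMap_eq fun a => Subtype.ext <| by
    rw [hmap, ← IsScalarTower.algebraMap_apply]; rfl
  have : Nontrivial A := (algebraMap A F).domain_nontrivial
  have : Algebra.IsStandardSmooth K A := Algebra.IsStandardSmoothOfRelativeDimension.isStandardSmooth 1
  have hr := Algebra.IsStandardSmoothOfRelativeDimension.rank_kaehlerDifferential (R := K) (S := A) 1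
  have hr' : Module.finrank A Ω[A⁄K] = 1 := by simp [Module.finrank, hr]
  let B := Module.basisUnique Unit hr'
  let g : Ω[A⁄K] →ₗ[A] A := B.coord ()
  have hg : ∀ ω, g ω • B () = ω := fun ω => by
    conv_rhs => rw [← B.sum_repr ω]
    simp [g]
  -- the differentials `da` generate `Ω¹`, so that one of them is a unit multiple of the basis
  have hunit : ∃ a : A, IsUnit (algebraMap A O (g (KaehlerDifferential.D K A a))) := by
    by_contra! hcon
    have : ∀ ω ∈ Submodule.span A (Set.range (KaehlerDifferential.D K A)),
        algebraMap A O (g ω) ∈ maximalIdeal O := by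
      intro ω hω
      induction hω using Submodule.span_induction with
      | zero => simp
      | add x y _ _ hx hy => rw [map_add, map_add]; exact add_mem hx hy
      | smul r x _ hx => rw [map_smul, smul_eq_mul, map_mul]; exact Ideal.mul_mem_left _ _ hx
      | mem x hx => obtain ⟨a, rfl⟩ := hx; exact hcon a
    have h1 := this (B ()) (by rw [KaehlerDifferential.span_range_derivation]; trivial)
    have : g (B ()) = 1 := by simp [g]
    rw [this, map_one] at h1
    exact (maximalIdeal.isMaximal O).ne_top ((Ideal.eq_top_iff_one _).2 h1)
  obtain ⟨a, ha⟩ := hunit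
  refine ⟨algebraMap A O a, ?_⟩
  set N := Submodule.span O {KaehlerDifferential.D K O (algebraMap A O a)} with hN
  have haN : KaehlerDifferential.D K O (algebraMap A O a) ∈ N := Submodule.mem_span_singleton_self _
  have key : ∀ a', KaehlerDifferential.D K O (algebraMap A O a') ∈ N := by
    intro a'
    have h1 : g (KaehlerDifferential.D K A a) • KaehlerDifferential.D K A a' =
        g (KaehlerDifferential.D K A a') • KaehlerDifferential.D K A a := by
      rw [← hg (KaehlerDifferential.D K A a'), ← hg (KaehlerDifferential.D K A a)]
      simp [g, smul_smul, mul_comm]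
    have h2 := congrArg (KaehlerDifferential.map K K A O) h1
    simp only [map_smul, KaehlerDifferential.map_D] at h2
    have h3 : algebraMap A O (g (KaehlerDifferential.D K A a)) •
        KaehlerDifferential.D K O (algebraMap A O a') ∈ N := by
      rw [algebraMap_smul, h2, ← algebraMap_smul O]
      exact N.smul_mem _ haN
    obtain ⟨c, hc⟩ := ha.exists_left_inv
    have h4 : KaehlerDifferential.D K O (algebraMap A O a') =
        c • algebraMap A O (g (KaehlerDifferential.D K A a)) •
          KaehlerDifferential.D K O (algebraMap A O a') := by
      refine Eq.trans ?_ (mul_smul _ _ _)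
      rw [hc, one_smul]
    rw [h4]
    exact N.smul_mem _ h3
  rw [eq_top_iff, ← KaehlerDifferential.span_range_derivation, Submodule.span_le]
  rintro _ ⟨o, rfl⟩
  obtain ⟨p, q, hq, hq0, ho⟩ := hO.2 o o.2
  set r : O := ⟨_, hq⟩
  have hqu : r * algebraMap A O q = 1 := Subtype.ext (inv_mul_cancel₀ hq0)
  have h1 : o = algebraMap A O p * r := Subtype.ext ho
  have h2 : o * algebraMap A O q = algebraMap A O p := by
    rw [h1, mul_assoc, hqu, mul_one]
  have h3 := key p
  rw [← h2, Derivation.leibniz] at h3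
  have h5 : KaehlerDifferential.D K O o =
      r • algebraMap A O q • KaehlerDifferential.D K O o := by
    refine Eq.trans ?_ (mul_smul _ _ _)
    rw [hqu, one_smul]
  change _ ∈ N
  rw [h5]
  exact N.smul_mem r ((N.add_mem_iff_right (N.smul_mem o (key q))).1 h3)

theorem finrank_kaehlerDifferential_eq_one [Algebra.IsStandardSmoothOfRelativeDimension 1 K A]
    [IsDomain A] [IsFractionRing A F] : Module.finrank F Ω[F⁄K] = 1 := by
  have : Algebra.IsStandardSmooth K A := Algebra.IsStandardSmoothOfRelativeDimension.isStandardSmooth 1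
  have hr := Algebra.IsStandardSmoothOfRelativeDimension.rank_kaehlerDifferential (R := K) (S := A) 1
  have : IsLocalizedModule (nonZeroDivisors A) (KaehlerDifferential.map K K A F) := inferInstance
  have h1 := IsLocalizedModule.finrank_eq (R := A) (nonZeroDivisors A)
    (KaehlerDifferential.map K K A F) le_rfl
  have h2 := IsLocalization.finrank_eq F (nonZeroDivisors A) le_rfl (N := Ω[F⁄K])
  rw [h2, h1]
  simp [Module.finrank, hr]

end Chart

section Scheme

variable {K : Type u} [Field K] {C : Scheme.{u}} [IsIntegral C] (f : C ⟶ Spec (.of K))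

theorem fromSpecStalk_comp (x : C) : C.fromSpecStalk x ≫ f =
    Spec.map ((Scheme.ΓSpecIso (.of K)).inv ≫ f.appTop ≫ C.presheaf.germ ⊤ x trivial) := by
  rw [← cancel_mono (Spec (.of K)).toSpecΓ, Category.assoc, Scheme.toSpecΓ_naturality,
    Scheme.fromSpecStalk_toSpecΓ_assoc, Spec.map_comp, Spec.map_comp, Category.assoc, Category.assoc]
  simp

/-- The data of the valuative criterion, at the generic point of the curve. -/
def valuativeSquare (R : Type u) [CommRing R] [IsDomain R] [ValuationRing R] [Algebra K R]
    [Algebra R (FunctionField f)] [IsFractionRing R (FunctionField f)]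
    [IsScalarTower K R (FunctionField f)] : ValuativeCommSq f where
  R := R
  K := FunctionField f
  i₁ := C.fromSpecStalk (genericPoint C)
  i₂ := Spec.map (CommRingCat.ofHom (algebraMap K R))
  commSq := ⟨by
    refine (fromSpecStalk_comp f _).trans ?_
    rw [← Spec.map_comp]
    congr 1
    ext a
    exact IsScalarTower.algebraMap_apply K R (FunctionField f) a⟩

/-- Properness, in the form of the valuative criterion: a valuation ring of the function field
dominates the local ring of a point, its center. -/
theorem exists_center [IsProper f] (R : ValuationSubring (FunctionField f))
    (hR : ∀ a : K, algebraMap K (FunctionField f) a ∈ R) :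
    ∃ x, ∀ g ∈ localRing f x, g ∈ R := by
  let _ : Algebra K R := ((algebraMap K (FunctionField f)).codRestrict R.toSubring hR).toAlgebra
  have : IsScalarTower K R (FunctionField f) := .of_algebraMap_eq fun a => rfl
  have hval : ValuativeCriterion f := by
    have h := IsProper.eq_valuativeCriterion
    have h2 : @IsProper _ _ f := inferInstance
    rw [h] at h2
    exact h2.1.1.1
  obtain ⟨⟨l, hl, -⟩⟩ := (hval.existence (valuativeSquare f R)).exists_lift
  change Spec.map (CommRingCat.ofHom (algebraMap R (FunctionField f))) ≫ l =
    C.fromSpecStalk (genericPoint C) at hl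
  change Spec (.of R) ⟶ C at l
  let x := l (closedPoint R)
  let φ : C.presheaf.stalk x ⟶ .of R := Scheme.stalkClosedPointTo (R := .of R) l
  have h1 : Spec.map φ ≫ C.fromSpecStalk x = l :=
    Scheme.Spec_stalkClosedPointTo_fromSpecStalk (R := .of R) l
  have h2 : C.presheaf.stalkSpecializes ((genericPoint_spec C).specializes trivial) =
      φ ≫ CommRingCat.ofHom (algebraMap R (FunctionField f)) := by
    apply Spec.map_injective
    rw [← cancel_mono (C.fromSpecStalk x), Scheme.SpecMap_stalkSpecializes_fromSpecStalk]
    have h3 : Spec.map (φ ≫ CommRingCat.ofHom (algebraMap R (FunctionField f))) ≫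
        C.fromSpecStalk x = C.fromSpecStalk (genericPoint C) := by
      refine (congrArg (· ≫ C.fromSpecStalk x) (Spec.map_comp φ
        (CommRingCat.ofHom (algebraMap R (FunctionField f))))).trans ?_
      exact (Category.assoc _ _ _).trans ((congrArg _ h1).trans hl)
    exact h3.symm
  refine ⟨x, ?_⟩
  rintro _ ⟨a, rfl⟩
  have : algebraMap (C.presheaf.stalk x) C.functionField a = ((φ.hom a : R) : FunctionField f) :=
    congrArg (fun m => m.hom a) h2
  rw [this]
  exact (φ.hom a).2

/-- Separatedness, in the form of the valuative criterion: a point is determined by its local ring,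
if that is a valuation ring. -/
theorem localRing_injective_of_valuationRing [IsProper f] {x y : C} (hx : ValuationRing (localRing f x))
   [IsFractionRing (localRing f x) (FunctionField f)]
   (hxy : localRing f x = localRing f y) : x = y := by
  have hsep := IsSeparated.valuativeCriterion f (valuativeSquare f (localRing f x))
  -- the morphism from the spectrum of the common local ring that is given by a point
  have key : ∀ y (h : localRing f x = localRing f y), ∃ l : Spec (.of (localRing f x)) ⟶ C,
      l (closedPoint (localRing f x)) = y ∧
      Spec.map (CommRingCat.ofHom (algebraMap (localRing f x) (FunctionField f))) ≫ l =
        C.fromSpecStalk (genericPoint C) ∧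
      l ≫ f = Spec.map (CommRingCat.ofHom (algebraMap K (localRing f x))) := by
    intro y h
    let e : C.presheaf.stalk y ≃+* localRing f x :=
      (stalkEquiv f y).trans (Subalgebra.equivOfEq _ _ h.symm).toRingEquiv
    let φ : C.presheaf.stalk y ⟶ .of (localRing f x) := CommRingCat.ofHom e.toRingHom
    have : IsLocalHom φ.hom := ⟨fun a ha => by
      have := ha.map e.symm.toRingHom
      have h2 : e.symm.toRingHom (φ.hom a) = a := e.symm_apply_apply a
      rwa [h2] at this⟩
    refine ⟨Spec.map φ ≫ C.fromSpecStalk y, ?_, ?_, ?_⟩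
    · refine (Scheme.Hom.comp_apply _ _ _).trans ?_
      refine (congrArg _ ?_).trans (Scheme.fromSpecStalk_closedPoint (x := y))
      exact Spec_closedPoint (f := φ)
    · rw [← Spec.map_comp_assoc, ← Scheme.SpecMap_stalkSpecializes_fromSpecStalk
        ((genericPoint_spec C).specializes (y := y) trivial)]
      rfl
    · rw [Category.assoc, fromSpecStalk_comp, ← Spec.map_comp]
      congr 1
      refine CommRingCat.hom_ext (RingHom.ext fun a => Subtype.ext ?_)
      refine (?_ : _ = algebraMap K (FunctionField f) a).trans rfl
      have := C.presheaf.germ_stalkSpecializes (U := ⊤) (y := y) trivial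
        ((genericPoint_spec C).specializes trivial)
      change (C.presheaf.stalkSpecializes _).hom (((Scheme.ΓSpecIso (.of K)).inv ≫ f.appTop ≫ C.presheaf.germ ⊤ y trivial).hom a) =
        ((Scheme.ΓSpecIso (.of K)).inv ≫ f.appTop ≫ C.presheaf.germ ⊤ (genericPoint C) trivial).hom a
      rw [← this]; rfl
  obtain ⟨l, h1, h2, h3⟩ := key x rfl
  obtain ⟨l', h1', h2', h3'⟩ := key y hxy
  have := congrArg CommSq.LiftStruct.l (hsep.elim ⟨l, h2, h3⟩ ⟨l', h2', h3'⟩)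
  change l = l' at this
  rw [← h1, ← h1', this]

/-- Around each point, the local rings are localizations of one smooth `K`-algebra. -/
theorem exists_chart_algebra [SmoothOfRelativeDimension 1 f] (x : C) :
    ∃ V : Opens C, x ∈ V ∧ ∃ (A : Type u) (_ : CommRing A) (_ : Algebra K A)
      (_ : Algebra A (FunctionField f)), IsScalarTower K A (FunctionField f) ∧ IsDomain A ∧
      Algebra.IsStandardSmoothOfRelativeDimension 1 K A ∧ IsFractionRing A (FunctionField f) ∧
      ∀ y ∈ V, IsLocalizedFrom A (localRing f y) := by
  obtain ⟨V, hx, hV, hs⟩ := exists_chart f x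
  have : Nonempty V := ⟨⟨x, hx⟩⟩
  refine ⟨V, hx, Γ(C, V), inferInstance, (structMap f V).toAlgebra,
    (C.germToFunctionField V).hom.toAlgebra, ?_, inferInstance, hs,
    functionField_isFractionRing_of_isAffineOpen C V hV, fun y hy => ⟨fun a => ?_, fun g hg => ?_⟩⟩
  · refine @IsScalarTower.of_algebraMap_eq _ _ _ _ _ _ (_) (_) (_) fun a => ?_
    exact (sectionMap_structMap f x hx a).symm.trans
      (Scheme.algebraMap_germ_eq_germToFunctionField C hx _)
  · have := sectionMap_mem f y y hy hy a
    rwa [show sectionMap f y hy a = (C.germToFunctionField V).hom a from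
      Scheme.algebraMap_germ_eq_germToFunctionField C hy _] at this
  · obtain ⟨s, rfl⟩ := hg
    let _ : Algebra Γ(C, V) (C.presheaf.stalk y) := (C.presheaf.germ V y hy).hom.toAlgebra
    have hloc : IsLocalization.AtPrime (C.presheaf.stalk y) (hV.primeIdealOf ⟨y, hy⟩).asIdeal :=
      hV.isLocalization_stalk ⟨y, hy⟩
    obtain ⟨p, q, rfl⟩ := IsLocalization.exists_mk'_eq
      (hV.primeIdealOf ⟨y, hy⟩).asIdeal.primeCompl s
    have hq := IsLocalization.map_units (C.presheaf.stalk y) q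
    have hmap : ∀ a : Γ(C, V), (C.germToFunctionField V).hom a =
        algebraMap (C.presheaf.stalk y) C.functionField (algebraMap _ _ a) := fun a =>
      (Scheme.algebraMap_germ_eq_germToFunctionField C hy a).symm
    have hne : algebraMap (C.presheaf.stalk y) C.functionField
        (algebraMap Γ(C, V) (C.presheaf.stalk y) q) ≠ 0 := (hq.map _).ne_zero
    refine ⟨p, q, ?_, ?_, ?_⟩
    · change ((C.germToFunctionField V).hom (q : Γ(C, V)) : FunctionField f)⁻¹ ∈ localRing f y
      rw [hmap]
      obtain ⟨r, hr⟩ := hq.exists_right_inv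
      refine ⟨r, ?_⟩
      refine eq_inv_of_mul_eq_one_right ?_
      exact (map_mul _ _ _).symm.trans ((congrArg _ hr).trans (map_one _))
    · change ((C.germToFunctionField V).hom (q : Γ(C, V)) : FunctionField f) ≠ 0
      rw [hmap]; exact hne
    · change _ = ((C.germToFunctionField V).hom p : FunctionField f) *
        ((C.germToFunctionField V).hom (q : Γ(C, V)) : FunctionField f)⁻¹
      rw [hmap, hmap]
      refine (eq_mul_inv_iff_mul_eq₀ hne).2 ?_
      exact (map_mul _ _ _).symm.trans (congrArg _ (IsLocalization.mk'_spec _ p q))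

instance isFractionRing_localRing (x : C) : IsFractionRing (localRing f x) (FunctionField f) := by
  refine .of_field _ _ fun g => ?_
  obtain ⟨a, ha, b, hb, -, h⟩ := localRing_frac f x g
  exact ⟨⟨a, ha⟩, ⟨b, hb⟩, h⟩

theorem finrank_functionField [SmoothOfRelativeDimension 1 f] :
    Module.finrank (FunctionField f) Ω[FunctionField f⁄K] = 1 := by
  obtain ⟨V, -, A, _, _, _, _, _, _, _, -⟩ := exists_chart_algebra f (genericPoint C)
  exact finrank_kaehlerDifferential_eq_one (A := A)

theorem isSmoothPoint_localRing [IsProper f] [SmoothOfRelativeDimension 1 f] (x : C)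
    (hx : x ≠ genericPoint C) : IsSmoothPoint (localRing f x) := by
  obtain ⟨V, hxV, A, _, _, _, _, _, _, _, hA⟩ := exists_chart_algebra f x
  have : Algebra.IsStandardSmooth K A :=
    Algebra.IsStandardSmoothOfRelativeDimension.isStandardSmooth 1
  obtain ⟨b, hb⟩ := exists_generatedBy (K := K) (A := A) (F := FunctionField f)
  have := (hb _ (hA x hxV)).essFiniteType
  have := isNoetherianRing_localRing f x
  obtain ⟨t, ht⟩ := exists_span_D_eq_top (hA x hxV)
  obtain ⟨⟨z, hz⟩, hfin⟩ := maximalIdeal_principal_of_span_D t ht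
  -- a local ring that is a field is the function field, the local ring of the generic point
  have hnf : ¬ IsField (localRing f x) := fun hfield => by
    apply hx
    have hval : ValuationRing (localRing f x) := by
      let _ := hfield.toField
      infer_instance
    refine localRing_injective_of_valuationRing f hval ?_
    rw [localRing_generic, eq_top_iff]
    intro g _
    obtain ⟨a, ha, b, hb, hb0, rfl⟩ := localRing_frac f x g
    obtain ⟨c, hc⟩ := hfield.mul_inv_cancel (a := ⟨b, hb⟩) (fun h => hb0 (congrArg Subtype.val h))
    rw [div_eq_mul_inv]
    refine mul_mem ha ?_
    rw [← eq_inv_of_mul_eq_one_right (congrArg Subtype.val hc)]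
    exact c.2
  have hdvr : IsDiscreteValuationRing (localRing f x) :=
    ((IsDiscreteValuationRing.TFAE (localRing f x) hnf).out 0 4 rfl rfl).2 ⟨⟨z, hz⟩⟩
  exact ⟨hdvr, localRing_frac f x, hfin (IsDiscreteValuationRing.not_a_field _), ⟨b, hb _ (hA x hxV)⟩,
    finrank_functionField f⟩

theorem localRing_injective [IsProper f] [SmoothOfRelativeDimension 1 f] :
    Function.Injective (localRing f) := by
  intro x y hxy
  rcases eq_or_ne x (genericPoint C) with rfl | hx
  · rcases eq_or_ne y (genericPoint C) with rfl | hy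
    · rfl
    · exact ((isSmoothPoint_localRing f y hy).ne_top (hxy.symm.trans (localRing_generic f))).elim
  · have := (isSmoothPoint_localRing f x hx).dvr
    exact localRing_injective_of_valuationRing f inferInstance hxy

/-- A specialization of `x` has a smaller local ring; as local rings are maximal proper subrings of
the function field, it is `x`. -/
theorem isClosed_singleton [IsProper f] [SmoothOfRelativeDimension 1 f] (x : C)
    (hx : x ≠ genericPoint C) : IsClosed ({x} : Set C) := by
  rw [← closure_subset_iff_isClosed]
  intro y hy
  have hxy : x ⤳ y := specializes_iff_mem_closure.2 hy
  have hle : ∀ g ∈ localRing f y, g ∈ (localRing f x).toSubring := fun g hg => by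
    obtain ⟨U, hyU, hU⟩ := localRing_spread f y g hg
    exact hU x (hxy.mem_open U.isOpen hyU)
  have hO := isSmoothPoint_localRing f x hx
  have hyη : y ≠ genericPoint C := by
    rintro rfl
    apply hO.ne_top
    rw [eq_top_iff, ← localRing_generic]; exact hle
  have hge := (isSmoothPoint_localRing f y hyη).eq_of_le hle (fun h => hO.ne_top
    (eq_top_iff.2 fun g _ => (h ▸ Subring.mem_top g : g ∈ (localRing f x).toSubring)))
  exact localRing_injective f (le_antisymm hle hge)

theorem finite_compl [IsProper f] [SmoothOfRelativeDimension 1 f] (U : Opens C)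
    (hU : (U : Set C).Nonempty) : (U : Set C)ᶜ.Finite := by
  have : IsLocallyNoetherian C := LocallyOfFiniteType.isLocallyNoetherian f
  have : CompactSpace C := ⟨by simpa using f.isCompact_preimage (U := ⊤) isCompact_univ⟩
  have : IsNoetherian C := {}
  obtain ⟨S, hS, hSc, hSi, hSu⟩ := NoetherianSpace.exists_finite_set_isClosed_irreducible
    (U.isOpen.isClosed_compl)
  rw [hSu]
  refine hS.sUnion fun Z hZ => ?_
  obtain ⟨y, hy⟩ := QuasiSober.sober (hSi Z hZ) (hSc Z hZ)
  have hyη : y ≠ genericPoint C := by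
    rintro rfl
    obtain ⟨u, hu⟩ := hU
    have h1 : genericPoint C ∈ U :=
      ((genericPoint_spec C).mem_open_set_iff U.isOpen).2 ⟨u, trivial, hu⟩
    have h2 : genericPoint C ∈ (U : Set C)ᶜ := hSu ▸ ⟨Z, hZ, hy.mem⟩
    exact h2 h1
  have h3 : closure {y} = Z := hy
  rw [← h3, (isClosed_singleton f y hyη).closure_eq]
  exact Set.finite_singleton y

theorem isSmoothCurve [IsProper f] [SmoothOfRelativeDimension 1 f] :
    IsSmoothCurve (localRing f) (genericPoint C) where
  generic := localRing_generic f
  generic_mem U hU := ((genericPoint_spec C).mem_open_set_iff U.2).2 (by simpa using hU)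
  finrank_eq_one := finrank_functionField f
  point := isSmoothPoint_localRing f
  isClosed := isClosed_singleton f
  finite_compl := finite_compl f
  spread := localRing_spread f
  injective := localRing_injective f
  chart := by
    obtain ⟨V, hxV, A, _, _, _, _, _, _, _, hA⟩ := exists_chart_algebra f (genericPoint C)
    have : Algebra.IsStandardSmooth K A :=
      Algebra.IsStandardSmoothOfRelativeDimension.isStandardSmooth 1
    obtain ⟨b, hb⟩ := exists_generatedBy (K := K) (A := A) (F := FunctionField f)
    exact ⟨b, V, ⟨_, hxV⟩, fun y hy => hb _ (hA y hy)⟩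
  exists_eq_valuationSubring R hR hR' := by
    obtain ⟨x, hx⟩ := exists_center f R hR
    have hxη : x ≠ genericPoint C := by
      rintro rfl
      apply hR'
      rw [localRing_generic] at hx
      exact eq_top_iff.2 fun g _ => hx g Algebra.mem_top
    have hge := (isSmoothPoint_localRing f x hxη).eq_of_le (R := R.toSubring) hx (fun h => hR'
      (eq_top_iff.2 fun g _ => (h ▸ Subring.mem_top g : g ∈ R.toSubring)))
    exact ⟨x, hxη, Set.Subset.antisymm hx hge⟩

theorem IsRationalPoint.exists_sub_mem {c : C} (hc : IsRationalPoint f c) :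
    ∀ a : localRing f c, ∃ r : K, a - algebraMap K _ r ∈ maximalIdeal (localRing f c) := by
  obtain ⟨p, hp, y, hy⟩ := hc
  have : Subsingleton (Spec (.of K)) := inferInstanceAs (Subsingleton (PrimeSpectrum K))
  obtain rfl : y = closedPoint K := Subsingleton.elim _ _
  subst hy
  let φ : C.presheaf.stalk (p (closedPoint K)) ⟶ .of K := Scheme.stalkClosedPointTo (R := .of K) p
  have h1 : Spec.map φ ≫ C.fromSpecStalk _ = p :=
    Scheme.Spec_stalkClosedPointTo_fromSpecStalk (R := .of K) p
  have h2 : ((Scheme.ΓSpecIso (.of K)).inv ≫ f.appTop ≫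
      C.presheaf.germ ⊤ (p (closedPoint K)) trivial) ≫ φ = 𝟙 _ := by
    apply Spec.map_injective
    rw [Spec.map_comp, Spec.map_id, ← hp, ← fromSpecStalk_comp, ← Category.assoc, h1]
  intro a
  let s := (stalkEquiv f _).symm a
  refine ⟨φ.hom s, fun hu => ?_⟩
  have h3 := (hu.map (stalkEquiv f _).symm).map φ.hom
  have h4 : (stalkEquiv f (p (closedPoint K))).symm (algebraMap K _ (φ.hom s)) =
      ((Scheme.ΓSpecIso (.of K)).inv ≫ f.appTop ≫
      C.presheaf.germ ⊤ (p (closedPoint K)) trivial).hom (φ.hom s) := by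
    rw [RingEquiv.symm_apply_eq]
    refine Subtype.ext ?_
    have := C.presheaf.germ_stalkSpecializes (U := ⊤) (y := p (closedPoint K)) trivial
        ((genericPoint_spec C).specializes trivial)
    change ((Scheme.ΓSpecIso (.of K)).inv ≫ f.appTop ≫
        C.presheaf.germ ⊤ (genericPoint C) trivial).hom (φ.hom s) =
      (C.presheaf.stalkSpecializes _).hom (((Scheme.ΓSpecIso (.of K)).inv ≫ f.appTop ≫
        C.presheaf.germ ⊤ (p (closedPoint K)) trivial).hom (φ.hom s))
    rw [← this]; rfl
  have h5 := congrArg (fun m => m.hom (φ.hom s)) h2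
  have h6 : φ.hom ((stalkEquiv f _).symm (a - algebraMap K _ (φ.hom s))) = 0 := by
    rw [map_sub, map_sub, h4, sub_eq_zero]
    exact h5.symm
  exact h3.ne_zero h6

end Scheme

/-! ### Approximation -/

section Approximation

variable {K F : Type*} [Field K] [Field F] [Algebra K F]

theorem IsSmoothPoint.isFractionRing {O : Subalgebra K F} [IsLocalRing O] (hO : IsSmoothPoint O) :
    IsFractionRing O F := by
  refine .of_field _ _ fun g => ?_
  obtain ⟨a, ha, b, hb, -, h⟩ := hO.frac g
  exact ⟨⟨a, ha⟩, ⟨b, hb⟩, h⟩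

/-- The local ring of a smooth point is the unit ball of an absolute value. -/
theorem IsSmoothPoint.exists_absoluteValue {O : Subalgebra K F} [IsLocalRing O]
    (hO : IsSmoothPoint O) : ∃ v : AbsoluteValue F ℝ, v.IsNontrivial ∧ ∀ f, v f ≤ 1 ↔ f ∈ O := by
  have := hO.dvr
  have := hO.isFractionRing
  obtain ⟨z, hz⟩ := hO.exists_uniformizer
  have hb : (1 : NNReal) < 2 := by norm_num
  let v : AbsoluteValue F ℝ := (IsDiscreteValuationRing.maximalIdeal O).adicAbv hb
  have h1 : ∀ a : O, v a ≤ 1 := fun a =>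
    (IsDiscreteValuationRing.maximalIdeal O).adicAbv_coe_le_one hb a
  have h2 : v z < 1 :=
    ((IsDiscreteValuationRing.maximalIdeal O).adicAbv_coe_lt_one_iff hb z).2
      (show z ∈ maximalIdeal O from hz ▸ Ideal.mem_span_singleton_self z)
  have hz0 := hO.ne_zero hz
  refine ⟨v, ⟨z, hz0, h2.ne⟩, fun f => ⟨fun hf => ?_, fun hf => h1 ⟨f, hf⟩⟩⟩
  rcases hO.mem_or_pole hz f with h | ⟨j, u, h⟩
  · exact h
  exfalso
  have h3 : v (z : F) ^ (j + 1) * v f = v (u : O) := by rw [← h, map_mul, map_pow]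
  have h4 : v ((u : O) : F) * v (((u⁻¹ : Oˣ) : O) : F) = 1 := by
    rw [← map_mul, coe_inv_unit, mul_inv_cancel₀ (unit_ne_zero u), map_one]
  have h5 := h1 (u⁻¹ : Oˣ)
  have h6 := h1 u
  have h7 : 0 < v (z : F) ^ (j + 1) := pow_pos (v.pos hz0) _
  have h8 : v (z : F) ^ (j + 1) < 1 := pow_lt_one₀ (v.nonneg _) h2 (by omega)
  have h9 : 0 ≤ v ((u : O) : F) := v.nonneg _
  have h10 := v.nonneg f
  nlinarith

variable {X : Type*} [TopologicalSpace X] {O : X → Subalgebra K F} [∀ x, IsLocalRing (O x)] {η : X}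

/-- Weak approximation for finitely many points of a curve. -/
theorem IsSmoothCurve.exists_approx (hC : IsSmoothCurve O η) (T : Finset X) (hT : η ∉ T)
    (g c : X → F) (hc : ∀ x ∈ T, c x ≠ 0) : ∃ f : F, ∀ x ∈ T, (f - g x) / c x ∈ O x := by
  classical
  have hne : ∀ x : T, (x : X) ≠ η := fun x h => hT (h ▸ x.2)
  choose v hv hvO using fun x : T => (hC.point x (hne x)).exists_absoluteValue
  have hpair : Pairwise fun x y : T => ¬ (v x).IsEquiv (v y) := fun x y hxy h => by
    apply hxy
    refine Subtype.ext (hC.injective ?_)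
    ext f
    rw [← hvO, ← hvO]
    exact h.le_one_iff
  -- approximation in the product of the completions, for pairwise inequivalent absolute values
  have hd := AbsoluteValue.denseRange_algebraMap_pi hv hpair
  have hopen : IsOpen {p : (x : T) → WithAbs (v x) |
      ∀ x, dist (p x) (WithAbs.toAbs (v x) (g x)) < v x (c x)} := by
    simp only [Set.setOf_forall]
    exact isOpen_iInter_of_finite fun x => isOpen_lt (by fun_prop) continuous_const
  obtain ⟨f, hf⟩ := hd.exists_mem_open hopen ⟨fun x => WithAbs.toAbs (v x) (g x), fun x => by
    simpa using hc x x.2⟩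
  refine ⟨f, fun x hx => ?_⟩
  have h1 : v ⟨x, hx⟩ (f - g x) < v ⟨x, hx⟩ (c x) := by
    have := hf ⟨x, hx⟩
    rwa [dist_eq_norm] at this
  rw [← hvO ⟨x, hx⟩, map_div₀]
  exact div_le_one_of_le₀ h1.le (AbsoluteValue.nonneg _ _)

/-- A rational function has finitely many poles. -/
theorem IsSmoothCurve.finite_poles (hC : IsSmoothCurve O η) (f : F) : {x | f ∉ O x}.Finite := by
  obtain ⟨U, hU, h⟩ := hC.spread η f (hC.generic ▸ Algebra.mem_top)
  exact (hC.finite_compl U ⟨η, hU⟩).subset fun x hx hxU => hx (h x hxU)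

/-- The condition `a⁻¹ ∉ O` makes sense for all rational functions; it is used to express that a
function vanishes at a point. -/
theorem mem_maximalIdeal_iff {O : Subalgebra K F} [IsLocalRing O] (a : O) (ha : a ≠ 0) :
    a ∈ maximalIdeal O ↔ (a : F)⁻¹ ∉ O := by
  rw [mem_maximalIdeal, mem_nonunits_iff, not_iff_not]
  have ha' : (a : F) ≠ 0 := fun h => ha (Subtype.ext h)
  constructor
  · rintro ⟨u, rfl⟩
    rw [← coe_inv_unit]; exact (u⁻¹ : Oˣ).1.2
  · intro h
    exact .of_mul_eq_one ⟨_, h⟩ (Subtype.ext (mul_inv_cancel₀ ha'))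

theorem IsSmoothPoint.inv_mem {O : Subalgebra K F} [IsLocalRing O] (hO : IsSmoothPoint O) {f : F}
    (hf : f ∉ O) : f⁻¹ ∈ O := by
  obtain ⟨z, hz⟩ := hO.exists_uniformizer
  obtain ⟨j, u, h⟩ := (hO.mem_or_pole hz f).resolve_left hf
  have : f⁻¹ = (((u⁻¹ : Oˣ) : O) : F) * (z : F) ^ (j + 1) := by
    have hu := unit_ne_zero u
    rw [coe_inv_unit, ← h, mul_inv_rev, mul_assoc, inv_mul_cancel₀ (pow_ne_zero _ (hO.ne_zero hz)),
      mul_one]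
  rw [this]
  exact mul_mem (u⁻¹ : Oˣ).1.2 (pow_mem z.2 _)

/-- The local ring of a smooth point as a valuation ring. -/
def IsSmoothPoint.valuationSubring {O : Subalgebra K F} [IsLocalRing O] (hO : IsSmoothPoint O) :
    ValuationSubring F where
  __ := O.toSubring
  mem_or_inv_mem' f := (em (f ∈ O)).imp_right hO.inv_mem

/-- A rational function that is integral over a ring of functions regular at `x` is regular at
`x`. -/
theorem IsSmoothPoint.mem_of_isIntegral {O : Subalgebra K F} [IsLocalRing O] (hO : IsSmoothPoint O)
    {A : Type*} [CommRing A] [Algebra A F] (hA : ∀ a : A, algebraMap A F a ∈ O) {f : F}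
    (hf : IsIntegral A f) : f ∈ O := by
  have : IsIntegrallyClosedIn O.toSubring F :=
    inferInstanceAs (IsIntegrallyClosedIn hO.valuationSubring F)
  let φ : A →+* O.toSubring := (algebraMap A F).codRestrict O.toSubring hA
  have h : IsIntegral O.toSubring f := by
    obtain ⟨p, hp, hpf⟩ := hf
    exact ⟨p.map φ, hp.map φ, by rw [Polynomial.eval₂_map]; exact hpf⟩
  obtain ⟨y, rfl⟩ := IsIntegrallyClosedIn.algebraMap_eq_of_integral h
  exact y.2

/-- The functions regular at all points where a given ring `A` of functions is regular are those
integral over `A`. -/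
theorem IsSmoothCurve.isIntegral_iff (hC : IsSmoothCurve O η) {A : Type*} [CommRing A]
    [Algebra K A] [Algebra A F] [IsScalarTower K A F] (f : F) :
    IsIntegral A f ↔ ∀ x, x ≠ η → (∀ a : A, algebraMap A F a ∈ O x) → f ∈ O x := by
  refine ⟨fun h x hx hA => (hC.point x hx).mem_of_isIntegral hA h, fun h => ?_⟩
  -- the integral closure is the intersection of the valuation rings, which are local rings
  have key := iInf_valuationSubring_superset (s := ((algebraMap A F).range : Set F))
  have hf : f ∈ (⨅ V : {V : ValuationSubring F // ((algebraMap A F).range : Set F) ⊆ V.toSubring},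
      V.1.toSubring) := by
    rw [Subring.mem_iInf]
    rintro ⟨V, hV⟩
    by_cases hVt : V = ⊤
    · subst hVt; trivial
    obtain ⟨x, hx, hOx⟩ := hC.exists_eq_valuationSubring V (fun a => hV (by
      rw [IsScalarTower.algebraMap_apply K A F]; exact ⟨_, rfl⟩)) hVt
    have := h x hx (fun a => by
      have h1 : algebraMap A F a ∈ (V : Set F) := hV ⟨_, rfl⟩
      rw [← hOx] at h1; exact h1)
    have h2 : f ∈ (O x : Set F) := this
    rw [hOx] at h2; exact h2
  rw [key] at hf
  have hf : IsIntegral (Subring.closure ((algebraMap A F).range : Set F)) f := hf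
  obtain ⟨p, hp, hpf⟩ := hf
  let φ : A →+* Subring.closure ((algebraMap A F).range : Set F) :=
    (algebraMap A F).codRestrict _ fun a => Subring.subset_closure ⟨a, rfl⟩
  have hφ : Function.Surjective φ := by
    rintro ⟨y, hy⟩
    rw [Subring.closure_eq] at hy
    obtain ⟨a, rfl⟩ := hy
    exact ⟨a, rfl⟩
  obtain ⟨q, hq, -, hqm⟩ := Polynomial.lifts_and_degree_eq_and_monic (f := φ)
    (Polynomial.mem_lifts_of_surjective hφ p) hp
  refine ⟨q, hqm, ?_⟩
  rw [← hq, Polynomial.eval₂_map] at hpf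
  exact hpf

end Approximation

/-! ### Traces of multiplication maps and of derivations -/

section TraceAdditive
open Module

theorem trace_eq_trace_restrict_add_trace_mapQ {K V : Type*} [Field K] [AddCommGroup V] [Module K V]
    [Module.Finite K V] (W : Submodule K V) (e : V →ₗ[K] V) (he : W ≤ W.comap e) :
    LinearMap.trace K V e = LinearMap.trace K W (e.restrict he) +
      LinearMap.trace K (V ⧸ W) (W.mapQ W e he) := by
  let m := Module.Free.ChooseBasisIndex K W
  let bW : Basis m K W := Module.Free.chooseBasis K W
  let n := Module.Free.ChooseBasisIndex K (V ⧸ W)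
  let bQ : Basis n K (V ⧸ W) := Module.Free.chooseBasis K (V ⧸ W)
  let b := Basis.sumQuot bW bQ
  rw [LinearMap.trace_eq_matrix_trace K b, LinearMap.trace_eq_matrix_trace K bW,
    LinearMap.trace_eq_matrix_trace K bQ, Matrix.trace, Fintype.sum_sum_type]
  congr 1
  · refine Finset.sum_congr rfl fun i _ => ?_
    simp only [Matrix.diag_apply, LinearMap.toMatrix_apply, b, Basis.sumQuot_inl]
    exact Basis.sumQuot_repr_inl_of_mem bW bQ _ (he (bW i).2) i
  · refine Finset.sum_congr rfl fun i _ => ?_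
    simp only [Matrix.diag_apply, LinearMap.toMatrix_apply, b]
    rw [Basis.sumQuot_repr_inr, ← Basis.sumQuot_inr bW bQ i]
    rfl

theorem trace_eq_add_of_exact {K M₁ M₂ M₃ : Type*} [Field K] [AddCommGroup M₁] [Module K M₁]
    [AddCommGroup M₂] [Module K M₂] [AddCommGroup M₃] [Module K M₃] [Module.Finite K M₂]
    (i : M₁ →ₗ[K] M₂) (p : M₂ →ₗ[K] M₃) (hi : Function.Injective i) (hp : Function.Surjective p)
    (hip : Function.Exact i p) (e₁ : M₁ →ₗ[K] M₁) (e₂ : M₂ →ₗ[K] M₂) (e₃ : M₃ →ₗ[K] M₃)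
    (h₁ : ∀ a, e₂ (i a) = i (e₁ a)) (h₂ : ∀ a, e₃ (p a) = p (e₂ a)) :
    LinearMap.trace K M₂ e₂ = LinearMap.trace K M₁ e₁ + LinearMap.trace K M₃ e₃ := by
  have hk : LinearMap.ker p = LinearMap.range i := LinearMap.exact_iff.1 hip
  have he : LinearMap.range i ≤ (LinearMap.range i).comap e₂ := by
    rintro _ ⟨a, rfl⟩; exact ⟨e₁ a, (h₁ a).symm⟩
  rw [trace_eq_trace_restrict_add_trace_mapQ (LinearMap.range i) e₂ he]
  let f₁ : M₁ ≃ₗ[K] LinearMap.range i := LinearEquiv.ofInjective i hi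
  let f₃ : (M₂ ⧸ LinearMap.range i) ≃ₗ[K] M₃ :=
    (Submodule.quotEquivOfEq _ _ hk.symm).trans (p.quotKerEquivOfSurjective hp)
  congr 1
  · rw [← LinearMap.trace_conj' e₁ f₁]
    congr 1
    ext ⟨_, a, rfl⟩
    rw [LinearEquiv.conj_apply_apply]
    have : f₁.symm ⟨i a, a, rfl⟩ = a := f₁.symm_apply_eq.2 rfl
    rw [this]
    exact h₁ a
  · rw [← LinearMap.trace_conj' _ f₃]
    congr 1
    ext b
    obtain ⟨a, rfl⟩ := hp b
    rw [LinearEquiv.conj_apply_apply]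
    have : f₃.symm (p a) = Submodule.Quotient.mk a := f₃.symm_apply_eq.2 rfl
    rw [this, h₂]
    rfl

variable {K B : Type*} [Field K] [CommRing B] [IsDomain B] [Algebra K B]

theorem trace_quotient_mul (g h u : B) (hh : h ≠ 0)
    [Module.Finite K (B ⧸ Ideal.span {g})] [Module.Finite K (B ⧸ Ideal.span {h})] :
    Module.Finite K (B ⧸ Ideal.span {h * g}) ∧
    Algebra.trace K (B ⧸ Ideal.span {h * g}) (Ideal.Quotient.mk _ u) =
      Algebra.trace K (B ⧸ Ideal.span {g}) (Ideal.Quotient.mk _ u) +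
      Algebra.trace K (B ⧸ Ideal.span {h}) (Ideal.Quotient.mk _ u) := by
  let i : (B ⧸ Ideal.span {g}) →ₗ[K] (B ⧸ Ideal.span {h * g}) :=
    (Submodule.liftQ (Ideal.span {g}) ((Submodule.mkQ (Ideal.span {h * g})).comp
      (LinearMap.mulLeft B h)) (by
        rw [Ideal.span, Submodule.span_le, Set.singleton_subset_iff]
        exact (Submodule.Quotient.mk_eq_zero _).2 (Ideal.mem_span_singleton_self _))).restrictScalars K
  let p : (B ⧸ Ideal.span {h * g}) →ₗ[K] (B ⧸ Ideal.span {h}) :=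
    (Ideal.Quotient.factorₐ K (Ideal.span_singleton_le_span_singleton.2 ⟨g, rfl⟩)).toLinearMap
  have hi' : ∀ a : B, i (Ideal.Quotient.mk _ a) = Ideal.Quotient.mk _ (h * a) := fun a => rfl
  have hp' : ∀ a : B, p (Ideal.Quotient.mk _ a) = Ideal.Quotient.mk _ a := fun a => rfl
  have hi : Function.Injective i := by
    rw [injective_iff_map_eq_zero]
    intro a ha
    obtain ⟨a, rfl⟩ := Ideal.Quotient.mk_surjective a
    rw [hi', Ideal.Quotient.eq_zero_iff_mem, Ideal.mem_span_singleton] at ha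
    rw [Ideal.Quotient.eq_zero_iff_mem, Ideal.mem_span_singleton]
    exact (mul_dvd_mul_iff_left hh).1 ha
  have hp : Function.Surjective p := by
    intro b
    obtain ⟨b, rfl⟩ := Ideal.Quotient.mk_surjective b
    exact ⟨Ideal.Quotient.mk _ b, rfl⟩
  have hip : Function.Exact i p := by
    intro b
    obtain ⟨b, rfl⟩ := Ideal.Quotient.mk_surjective b
    rw [hp', Ideal.Quotient.eq_zero_iff_mem, Ideal.mem_span_singleton]
    constructor
    · rintro ⟨a, rfl⟩; exact ⟨Ideal.Quotient.mk _ a, rfl⟩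
    · rintro ⟨a, ha⟩
      obtain ⟨a, rfl⟩ := Ideal.Quotient.mk_surjective a
      rw [hi', Ideal.Quotient.mk_eq_mk_iff_sub_mem, Ideal.mem_span_singleton] at ha
      have := (dvd_mul_right h g).trans ha
      exact (dvd_sub_right (dvd_mul_right h a)).1 this
  have hfin : Module.Finite K (B ⧸ Ideal.span {h * g}) := by
    have h1 : Module.Finite K (LinearMap.range i) := inferInstance
    have h2 : LinearMap.ker p = LinearMap.range i := LinearMap.exact_iff.1 hip
    have h3 : Module.Finite K ((B ⧸ Ideal.span {h * g}) ⧸ LinearMap.range i) :=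
      Module.Finite.equiv (((Submodule.quotEquivOfEq _ _ h2.symm).trans
        (p.quotKerEquivOfSurjective hp)).symm)
    exact Module.Finite.of_submodule_quotient (LinearMap.range i)
  refine ⟨hfin, ?_⟩
  refine trace_eq_add_of_exact i p hi hp hip _ _ _ (fun a => ?_) (fun a => ?_)
  · obtain ⟨a, rfl⟩ := Ideal.Quotient.mk_surjective a
    change Ideal.Quotient.mk _ (u * (h * a)) = Ideal.Quotient.mk _ (h * (u * a))
    rw [mul_left_comm]
  · obtain ⟨a, rfl⟩ := Ideal.Quotient.mk_surjective a
    rfl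

theorem trace_quotient_unit_mul (w : Bˣ) (g u : B) :
    Algebra.trace K (B ⧸ Ideal.span {(w : B) * g}) (Ideal.Quotient.mk _ u) =
      Algebra.trace K (B ⧸ Ideal.span {g}) (Ideal.Quotient.mk _ u) := by
  rw [Ideal.span_singleton_mul_left_unit w.isUnit]

/-- The trace on `B / (∏ gᵢ^eᵢ)` is the sum of the traces on the `B / (gᵢ)`, counted `eᵢ` times. -/
theorem trace_quotient_prod {ι : Type*} (T : Finset ι) (g : ι → B) (e : ι → ℕ) (u : B)
    (hg : ∀ i ∈ T, g i ≠ 0) (hfin : ∀ i ∈ T, Module.Finite K (B ⧸ Ideal.span {g i})) :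
    Module.Finite K (B ⧸ Ideal.span {∏ i ∈ T, g i ^ e i}) ∧
    Algebra.trace K (B ⧸ Ideal.span {∏ i ∈ T, g i ^ e i}) (Ideal.Quotient.mk _ u) =
      ∑ i ∈ T, e i * Algebra.trace K (B ⧸ Ideal.span {g i}) (Ideal.Quotient.mk _ u) := by
  classical
  have h1 : Module.Finite K (B ⧸ Ideal.span {(1 : B)}) ∧
      Algebra.trace K (B ⧸ Ideal.span {(1 : B)}) (Ideal.Quotient.mk _ u) = 0 := by
    have : Subsingleton (B ⧸ Ideal.span {(1 : B)}) :=
      Ideal.Quotient.subsingleton_iff.2 Ideal.span_singleton_one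
    refine ⟨inferInstance, ?_⟩
    rw [Subsingleton.elim (Ideal.Quotient.mk (Ideal.span {(1 : B)}) u) 0, map_zero]
  have hpow : ∀ (a : B) (_ : a ≠ 0) (_ : Module.Finite K (B ⧸ Ideal.span {a})) (n : ℕ),
      Module.Finite K (B ⧸ Ideal.span {a ^ n}) ∧
      Algebra.trace K (B ⧸ Ideal.span {a ^ n}) (Ideal.Quotient.mk _ u) =
        n * Algebra.trace K (B ⧸ Ideal.span {a}) (Ideal.Quotient.mk _ u) := by
    intro a ha hf n
    induction n with
    | zero => rw [pow_zero]; exact ⟨h1.1, by rw [h1.2]; simp⟩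
    | succ n ih =>
      have := ih.1
      have h := trace_quotient_mul (K := K) (a ^ n) a u ha
      rw [pow_succ']
      refine ⟨h.1, ?_⟩
      rw [h.2, ih.2]; push_cast; ring
  induction T using Finset.induction_on with
  | empty => rw [Finset.prod_empty, Finset.sum_empty]; exact h1
  | insert i T hi ih =>
    have hT := ih (fun j hj => hg j (Finset.mem_insert_of_mem hj))
      (fun j hj => hfin j (Finset.mem_insert_of_mem hj))
    have := hT.1
    have hi1 := hpow (g i) (hg i (Finset.mem_insert_self _ _)) (hfin i (Finset.mem_insert_self _ _)) (e i)
    have := hi1.1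
    rw [Finset.prod_insert hi, Finset.sum_insert hi]
    have h := trace_quotient_mul (K := K) (∏ i ∈ T, g i ^ e i) (g i ^ e i) u
      (pow_ne_zero _ (hg i (Finset.mem_insert_self _ _)))
    refine ⟨h.1, ?_⟩
    rw [h.2, hT.2, hi1.2, add_comm]

end TraceAdditive

section TraceDerivation

/-- The matrix form of the Leibniz rule for a derivation of a finite extension: `N` is the matrix of
the derivation on a basis. -/
theorem leftMulMatrix_derivation {R E F ι : Type*} [CommRing R] [Field E] [Field F] [Algebra R E]
    [Algebra R F] [Algebra E F] [IsScalarTower R E F] [Fintype ι] [DecidableEq ι]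
    (b : Module.Basis ι E F) (d : Derivation R F F) (δ : Derivation R E E)
    (h : ∀ a : E, d (algebraMap E F a) = algebraMap E F (δ a)) (f : F) :
    Algebra.leftMulMatrix b (d f) + Algebra.leftMulMatrix b f *
        (Matrix.of fun j i => b.repr (d (b i)) j) =
      (Matrix.of fun j i => b.repr (d (b i)) j) * Algebra.leftMulMatrix b f +
        (Algebra.leftMulMatrix b f).map δ := by
  have hM : ∀ (x : F) (i), x * b i = ∑ j, Algebra.leftMulMatrix b x j i • b j := fun x i => by
    rw [← b.sum_repr (x * b i)]
    simp only [Algebra.leftMulMatrix_eq_repr_mul, b.repr_sum_self]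
  set N : Matrix _ _ E := Matrix.of fun j i => b.repr (d (b i)) j with hNdef
  have hN : ∀ i, d (b i) = ∑ j, N j i • b j := fun i => (b.sum_repr _).symm
  have hsmul : ∀ (a : E) (x : F), d (a • x) = a • d x + δ a • x := fun a x => by
    rw [Algebra.smul_def, d.leibniz, h, Algebra.smul_def a (d x), Algebra.smul_def (δ a) x, smul_eq_mul, smul_eq_mul]
    ring
  set M := Algebra.leftMulMatrix b f with hMdef
  ext l i
  have h1 : d (f * b i) = d (∑ j, M j i • b j) := congrArg d (hM f i)
  rw [d.leibniz, map_sum, hN] at h1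
  simp only [smul_eq_mul, hsmul, hN] at h1
  rw [mul_comm (b i), hM (d f) i, Finset.mul_sum] at h1
  have h2 := congrArg (fun y => b.repr y l) h1
  simp only [mul_smul_comm, hM f, map_add, map_sum, map_smul, Finsupp.add_apply,
    Finsupp.finset_sum_apply, Finsupp.smul_apply, Module.Basis.repr_self, Finsupp.single_apply,
    smul_eq_mul, mul_ite, mul_one, mul_zero, Finset.sum_ite_eq', Finset.mem_univ, if_true,
    Finset.sum_add_distrib] at h2
  simp only [Matrix.add_apply, Matrix.mul_apply, Matrix.map_apply]
  have h3 : ∑ j, N j i * M l j + Algebra.leftMulMatrix b (d f) l i =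
      ∑ j, M j i * N l j + δ (M l i) := h2
  simp only [mul_comm (N _ i), mul_comm (M _ i)] at h3
  linear_combination h3

/-- The trace of a finite extension commutes with derivations preserving the base field. -/
theorem derivation_trace {R E F : Type*} [CommRing R] [Field E] [Field F] [Algebra R E] [Algebra R F]
    [Algebra E F] [IsScalarTower R E F]
    [Module.Finite E F] (d : Derivation R F F) (δ : Derivation R E E)
    (h : ∀ a : E, d (algebraMap E F a) = algebraMap E F (δ a)) (f : F) :
    Algebra.trace E F (d f) = δ (Algebra.trace E F f) := by
  classical
  let b := Module.finBasis E F
  have h3 := congrArg Matrix.trace (leftMulMatrix_derivation b d δ h f)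
  rw [Matrix.trace_add, Matrix.trace_add, Matrix.trace_mul_comm (Matrix.of _)] at h3
  have h4 : ((Algebra.leftMulMatrix b f).map δ).trace = δ (Algebra.leftMulMatrix b f).trace := by
    simp [Matrix.trace]
  rw [Algebra.trace_eq_matrix_trace b, Algebra.trace_eq_matrix_trace b, ← h4]
  linear_combination h3

/-- Jacobi's formula for the derivative of a determinant. -/
theorem derivation_det {R E ι : Type*} [CommRing R] [CommRing E] [Algebra R E] [Fintype ι]
    [DecidableEq ι] (δ : Derivation R E E) (A : Matrix ι ι E) :
    δ A.det = (A.adjugate * A.map δ).trace := by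
  have hprod : ∀ (s : Finset ι) (f : ι → E),
      δ (∏ i ∈ s, f i) = ∑ i ∈ s, (∏ j ∈ s.erase i, f j) * δ (f i) := by
    intro s f
    induction s using Finset.induction_on with
    | empty => simp
    | insert a s ha ih =>
      rw [Finset.prod_insert ha, δ.leibniz, ih, Finset.sum_insert ha, Finset.erase_insert ha,
        add_comm, smul_eq_mul, smul_eq_mul, Finset.mul_sum]
      congr 1
      refine Finset.sum_congr rfl fun i hi => ?_
      have hai : a ≠ i := fun h => ha (h ▸ hi)
      rw [Finset.erase_insert_of_ne hai, Finset.prod_insert (fun h => ha (Finset.mem_of_mem_erase h))]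
      ring
  have hcol : ∀ i, (A.adjugate * A.map δ) i i = (A.updateCol i fun j => δ (A j i)).det := fun i => by
    rw [← Matrix.cramer_apply, Matrix.cramer_eq_adjugate_mulVec]
    rfl
  rw [Matrix.trace]
  simp only [Matrix.diag_apply, hcol, Matrix.det_apply, map_sum, hprod]
  rw [Finset.sum_comm]
  refine Finset.sum_congr rfl fun σ _ => ?_
  have : ∀ (u : ℤˣ) (x : E), δ (u • x) = u • δ x := fun u x => by
    rw [Units.smul_def, Units.smul_def, map_zsmul]
  rw [this, hprod, Finset.smul_sum]
  refine Finset.sum_congr rfl fun i _ => ?_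
  congr 1
  rw [← Finset.mul_prod_erase _ _ (Finset.mem_univ i), Matrix.updateCol_self, mul_comm]
  congr 1
  refine Finset.prod_congr rfl fun j hj => ?_
  rw [Matrix.updateCol_ne (Finset.ne_of_mem_erase hj)]

/-- The logarithmic derivative of a norm is the trace of the logarithmic derivative. -/
theorem derivation_norm {R E F : Type*} [CommRing R] [Field E] [Field F] [Algebra R E] [Algebra R F]
    [Algebra E F] [IsScalarTower R E F]
    [Module.Finite E F] (d : Derivation R F F) (δ : Derivation R E E)
    (h : ∀ a : E, d (algebraMap E F a) = algebraMap E F (δ a)) {f : F} (hf : f ≠ 0) :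
    δ (Algebra.norm E f) = Algebra.norm E f * Algebra.trace E F (f⁻¹ * d f) := by
  classical
  let b := Module.finBasis E F
  have key := leftMulMatrix_derivation b d δ h f
  set M := Algebra.leftMulMatrix b f with hM
  set N : Matrix _ _ E := Matrix.of fun j i => b.repr (d (b i)) j
  set M' := Algebra.leftMulMatrix b f⁻¹ with hM'
  have h1 : M * M' = 1 := by rw [hM, hM', ← map_mul, mul_inv_cancel₀ hf, map_one]
  have h1' : M' * M = 1 := by rw [hM, hM', ← map_mul, inv_mul_cancel₀ hf, map_one]
  have h2 : M.adjugate = M.det • M' := by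
    rw [← mul_one M.adjugate, ← h1, ← mul_assoc, Matrix.adjugate_mul, smul_mul_assoc, one_mul]
  have h3 := congrArg (fun A => (M' * A).trace) key
  simp only [mul_add, Matrix.trace_add] at h3
  rw [← mul_assoc M' M, h1', one_mul, ← mul_assoc M' N M, Matrix.trace_mul_comm (M' * N) M,
    ← mul_assoc M M', h1, one_mul, hM', ← map_mul] at h3
  rw [Algebra.norm_eq_matrix_det b, derivation_det, ← hM, h2, smul_mul_assoc, Matrix.trace_smul,
    Algebra.trace_eq_matrix_trace b, smul_eq_mul]
  congr 1
  linear_combination -h3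

end TraceDerivation

/-! ### The semilocal ring of finitely many points -/

section Semilocal

variable {K F : Type*} [Field K] [Field F] [Algebra K F]

theorem IsSmoothPoint.exists_pow_mul_mem_of_mem_maximalIdeal {O : Subalgebra K F} [IsLocalRing O]
    (hO : IsSmoothPoint O) {c : O} (hc : c ∈ maximalIdeal O) (g : F) :
    ∃ N : ℕ, ∀ n ≥ N, (c : F) ^ n * g ∈ O := by
  obtain ⟨z, hz⟩ := hO.exists_uniformizer
  obtain ⟨N, hN⟩ := hO.exists_pow_mul_mem hz g
  rw [hz, Ideal.mem_span_singleton] at hc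
  obtain ⟨a, rfl⟩ := hc
  refine ⟨N, fun n hn => ?_⟩
  have := mem_of_pow_mul_mem z.2 hn hN
  rw [MulMemClass.coe_mul, mul_pow, mul_right_comm, mul_comm]
  exact mul_mem (pow_mem a.2 _) this

variable {X : Type*} [TopologicalSpace X] {O : X → Subalgebra K F} [∀ x, IsLocalRing (O x)] {η : X}

/-- There is a function with a simple zero at a given point and without zeros and poles at finitely
many other points. -/
theorem IsSmoothCurve.exists_uniformizer (hC : IsSmoothCurve O η) (T : Finset X) (hT : η ∉ T)
    (x : X) (hx : x ∈ T) : ∃ g : F, (∃ z : O x, maximalIdeal (O x) = Ideal.span {z} ∧ (z : F) = g) ∧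
      ∀ y ∈ T, y ≠ x → g ∈ O y ∧ g⁻¹ ∈ O y := by
  classical
  have hne : ∀ y ∈ T, y ≠ η := fun y hy h => hT (h ▸ hy)
  have hu : ∀ y, ∃ z : F, y ∈ T → ∃ z' : O y, maximalIdeal (O y) = Ideal.span {z'} ∧ (z' : F) = z := by
    intro y
    by_cases hy : y ∈ T
    · obtain ⟨z, hz⟩ := (hC.point y (hne y hy)).exists_uniformizer
      exact ⟨z, fun _ => ⟨z, hz, rfl⟩⟩
    · exact ⟨0, fun h => (hy h).elim⟩
  choose z hz using hu
  have hz0 : ∀ y ∈ T, z y ≠ 0 := fun y hy => by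
    obtain ⟨z', h, h'⟩ := hz y hy
    rw [← h']; exact (hC.point y (hne y hy)).ne_zero h
  -- `f` is congruent to a uniformizer modulo its square at `x`, and to `1` modulo a uniformizer
  -- at the other points
  obtain ⟨f, hf⟩ := hC.exists_approx T hT (fun y => if y = x then z x else 1)
    (fun y => if y = x then z x ^ 2 else z y) (fun y hy => by
      split_ifs with h
      · exact pow_ne_zero _ (hz0 x hx)
      · exact hz0 y hy)
  refine ⟨f, ?_, fun y hy hyx => ?_⟩
  · have h := hf x hx
    simp only [if_true] at h
    obtain ⟨z', h1, h2⟩ := hz x hx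
    have hx0 := hz0 x hx
    have hmem : z' ∈ maximalIdeal (O x) := h1 ▸ Ideal.mem_span_singleton_self z'
    let a : O x := ⟨_, h⟩
    have hunit : IsUnit (1 + z' * a) := by
      by_contra hcon
      have h3 : (1 + z' * a) - z' * a ∈ maximalIdeal (O x) :=
        sub_mem hcon (Ideal.mul_mem_right _ _ hmem)
      rw [add_sub_cancel_right] at h3
      exact (Ideal.ne_top_iff_one _).1 (maximalIdeal.isMaximal (O x)).ne_top h3
    refine ⟨z' * (1 + z' * a), ?_, ?_⟩
    · rw [h1, Ideal.span_singleton_mul_right_unit hunit]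
    · change (z' : F) * (1 + z' * ((f - z x) / z x ^ 2)) = f
      rw [h2]; field_simp; ring
  · have h := hf y hy
    simp only [if_neg hyx] at h
    obtain ⟨z', h1, h2⟩ := hz y hy
    have hy0 := hz0 y hy
    have hmem : z' ∈ maximalIdeal (O y) := h1 ▸ Ideal.mem_span_singleton_self z'
    let a : O y := ⟨_, h⟩
    have hunit : IsUnit (1 + z' * a) := by
      by_contra hcon
      have h3 : (1 + z' * a) - z' * a ∈ maximalIdeal (O y) :=
        sub_mem hcon (Ideal.mul_mem_right _ _ hmem)
      rw [add_sub_cancel_right] at h3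
      exact (Ideal.ne_top_iff_one _).1 (maximalIdeal.isMaximal (O y)).ne_top h3
    have hfe : f = ((1 + z' * a : O y) : F) := by
      change f = 1 + z' * ((f - 1) / z y)
      rw [h2]; field_simp; ring
    obtain ⟨w, hw⟩ := hunit
    rw [hfe, ← hw, ← coe_inv_unit]
    exact ⟨w.1.2, (w⁻¹ : (O y)ˣ).1.2⟩

/-- A system of simultaneous uniformizers at finitely many points. -/
def IsUniformizers (O : X → Subalgebra K F) [∀ x, IsLocalRing (O x)] (T : Finset X) (g : X → F) :
    Prop :=
  ∀ x ∈ T, (∃ z : O x, maximalIdeal (O x) = Ideal.span {z} ∧ (z : F) = g x) ∧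
      ∀ y ∈ T, y ≠ x → g x ∈ O y ∧ (g x)⁻¹ ∈ O y

theorem IsSmoothCurve.exists_isUniformizers (hC : IsSmoothCurve O η) (T : Finset X) (hT : η ∉ T) :
    ∃ g, IsUniformizers O T g := by
  classical
  have : ∀ x, ∃ g : F, x ∈ T → (∃ z : O x, maximalIdeal (O x) = Ideal.span {z} ∧ (z : F) = g) ∧
      ∀ y ∈ T, y ≠ x → g ∈ O y ∧ g⁻¹ ∈ O y := fun x => by
    by_cases hx : x ∈ T
    · obtain ⟨g, hg⟩ := hC.exists_uniformizer T hT x hx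
      exact ⟨g, fun _ => hg⟩
    · exact ⟨0, fun h => (hx h).elim⟩
  choose g hg using this
  exact ⟨g, hg⟩

section

variable {T : Finset X} {g : X → F}

theorem IsUniformizers.mem (hg : IsUniformizers O T g) {x y : X} (hx : x ∈ T) (hy : y ∈ T) :
    g x ∈ O y := by
  rcases eq_or_ne y x with rfl | h
  · obtain ⟨⟨z, -, hz⟩, -⟩ := hg y hx
    rw [← hz]; exact z.2
  · exact ((hg x hx).2 y hy h).1

theorem IsUniformizers.ne_zero (hg : IsUniformizers O T g) (hC : IsSmoothCurve O η) (hT : η ∉ T)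
    {x : X} (hx : x ∈ T) : g x ≠ 0 := by
  obtain ⟨⟨z, hz, hz'⟩, -⟩ := hg x hx
  rw [← hz']
  exact (hC.point x (fun h => hT (h ▸ hx))).ne_zero hz

/-- A function is a unit at the points of `T` up to powers of the uniformizers. -/
theorem IsUniformizers.exists_eq_mul_prod (hg : IsUniformizers O T g) (hC : IsSmoothCurve O η)
    (hT : η ∉ T) {τ : F} (hτ : τ ≠ 0) (hτO : ∀ x ∈ T, τ ∈ O x) :
    ∃ (e : X → ℕ) (w : F), τ = w * ∏ x ∈ T, g x ^ e x ∧ ∀ x ∈ T, w ∈ O x ∧ w⁻¹ ∈ O x := by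
  classical
  have hne : ∀ y ∈ T, y ≠ η := fun y hy h => hT (h ▸ hy)
  have : ∀ x, ∃ n : ℕ, x ∈ T → ∃ u : (O x)ˣ, τ = (u : O x) * g x ^ n := fun x => by
    by_cases hx : x ∈ T
    · obtain ⟨⟨z, hz, hz'⟩, -⟩ := hg x hx
      have hO := hC.point x (hne x hx)
      obtain ⟨n, u, h⟩ := hO.exists_eq_mul_zpow hz hτ
      rcases le_or_gt 0 n with hn | hn
      · obtain ⟨m, rfl⟩ := Int.eq_ofNat_of_zero_le hn
        exact ⟨m, fun _ => ⟨u, by rw [h, hz']; simp⟩⟩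
      · exfalso
        obtain ⟨m, rfl⟩ : ∃ m : ℕ, n = -(m + 1 : ℤ) := ⟨(-n - 1).toNat, by omega⟩
        have hz0 := hO.ne_zero hz
        refine hO.not_mem_of_mul_eq_unit hz (f := (z : F) ^ m * τ) (u := u) ?_
          (mul_mem (pow_mem z.2 _) (hτO x hx))
        rw [h, zpow_neg, ← mul_assoc, ← pow_succ', mul_left_comm]
        rw [show ((m : ℤ) + 1) = ((m + 1 : ℕ) : ℤ) by push_cast; rfl, zpow_natCast,
          mul_inv_cancel₀ (pow_ne_zero _ hz0), mul_one]
    · exact ⟨0, fun h => (hx h).elim⟩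
  choose e he using this
  have hP0 : ∏ x ∈ T, g x ^ e x ≠ 0 :=
    Finset.prod_ne_zero_iff.2 fun x hx => pow_ne_zero _ (hg.ne_zero hC hT hx)
  refine ⟨e, τ / ∏ x ∈ T, g x ^ e x, by field_simp, fun x hx => ?_⟩
  obtain ⟨u, hu⟩ := he x hx
  have h1 : ∏ x ∈ T, g x ^ e x = g x ^ e x * ∏ y ∈ T.erase x, g y ^ e y :=
    (Finset.mul_prod_erase T (fun y => g y ^ e y) hx).symm
  have hx0 := pow_ne_zero (e x) (hg.ne_zero hC hT hx)
  have h2 : τ / ∏ x ∈ T, g x ^ e x = (u : O x) * ∏ y ∈ T.erase x, ((g y)⁻¹) ^ e y := by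
    rw [h1, hu, Finset.prod_congr rfl fun y _ => inv_pow (g y) (e y), Finset.prod_inv_distrib]
    field_simp
  have h3 : (τ / ∏ x ∈ T, g x ^ e x)⁻¹ = ((u⁻¹ : (O x)ˣ) : O x) * ∏ y ∈ T.erase x, (g y) ^ e y := by
    rw [h2, mul_inv, coe_inv_unit, ← Finset.prod_inv_distrib]
    congr 1
    exact Finset.prod_congr rfl fun y _ => by rw [inv_pow, inv_inv]
  refine ⟨h2 ▸ mul_mem u.1.2 (prod_mem fun y hy => pow_mem ?_ _),
    h3 ▸ mul_mem (u⁻¹ : (O x)ˣ).1.2 (prod_mem fun y hy => pow_mem ?_ _)⟩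
  · obtain ⟨hyx, hy⟩ := Finset.mem_erase.1 hy
    exact ((hg y hy).2 x hx hyx.symm).2
  · exact hg.mem (Finset.mem_of_mem_erase hy) hx

/-- The ring of functions that are regular at the points of `T`. -/
def semilocalRing (O : X → Subalgebra K F) (T : Finset X) : Subalgebra K F := ⨅ x : T, O x

theorem mem_semilocalRing {f : F} : f ∈ semilocalRing O T ↔ ∀ x ∈ T, f ∈ O x := by
  simp [semilocalRing, Algebra.mem_iInf]

/-- The residue field of a point is a quotient of the semilocal ring. -/
theorem IsUniformizers.trace_quotient (hg : IsUniformizers O T g) (hC : IsSmoothCurve O η)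
    (hT : η ∉ T) {x : X} (hx : x ∈ T) (γ u : semilocalRing O T) (hγ : (γ : F) = g x) :
    Module.Finite K (semilocalRing O T ⧸ Ideal.span {γ}) ∧
    Algebra.trace K (semilocalRing O T ⧸ Ideal.span {γ}) (Ideal.Quotient.mk _ u) =
      Algebra.trace K (ResidueField (O x)) (residue (O x) ⟨u, mem_semilocalRing.1 u.2 x hx⟩) := by
  classical
  have hO := hC.point x (fun h => hT (h ▸ hx))
  let i : semilocalRing O T →ₐ[K] O x := Subalgebra.inclusion fun a ha => mem_semilocalRing.1 ha x hx
  let φ : semilocalRing O T →ₐ[K] ResidueField (O x) := (IsScalarTower.toAlgHom K (O x) _).comp i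
  obtain ⟨⟨z, hz, hzg⟩, hgy⟩ := hg x hx
  have hx0 := hg.ne_zero hC hT hx
  have hker : RingHom.ker φ = Ideal.span {γ} := by
    ext b
    have h1 : b ∈ RingHom.ker φ ↔ i b ∈ maximalIdeal (O x) := residue_eq_zero_iff _
    rw [h1, hz, Ideal.mem_span_singleton, Ideal.mem_span_singleton]
    constructor
    · rintro ⟨c, hc⟩
      have hc' : (b : F) = g x * c := by rw [← hzg]; exact congrArg Subtype.val hc
      have : (c : F) ∈ semilocalRing O T := mem_semilocalRing.2 fun y hy => by
        rcases eq_or_ne y x with rfl | h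
        · exact c.2
        · have : (c : F) = (g x)⁻¹ * b := by rw [hc', inv_mul_cancel_left₀ hx0]
          rw [this]
          exact mul_mem (hgy y hy h).2 (mem_semilocalRing.1 b.2 y hy)
      exact ⟨⟨c, this⟩, Subtype.ext (by rw [hc', MulMemClass.coe_mul, hγ])⟩
    · rintro ⟨c, rfl⟩
      refine ⟨i c, Subtype.ext ?_⟩
      change (γ : F) * c = z * c
      rw [hγ, hzg]
  have hsurj : Function.Surjective φ := by
    intro r
    obtain ⟨a, rfl⟩ := residue_surjective r
    -- a function with the given residue class at `x` that is regular at the other points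
    obtain ⟨f, hf⟩ := hC.exists_approx T hT (fun y => if y = x then (a : F) else 0)
      (fun y => if y = x then g x else 1) (fun y hy => by
        split_ifs
        · exact hx0
        · exact one_ne_zero)
    have h1 := hf x hx
    simp only [if_true] at h1
    have hfx : f = a + z * (⟨_, h1⟩ : O x) := by
      change f = a + z * ((f - a) / g x)
      rw [hzg]; field_simp; ring
    have hfS : f ∈ semilocalRing O T := mem_semilocalRing.2 fun y hy => by
      rcases eq_or_ne y x with rfl | h
      · rw [hfx]; exact add_mem a.2 (mul_mem z.2 (⟨_, h1⟩ : O y).2)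
      · have := hf y hy
        simpa [h] using this
    refine ⟨⟨f, hfS⟩, ?_⟩
    have h2 : i ⟨f, hfS⟩ = a + z * (⟨_, h1⟩ : O x) := Subtype.ext hfx
    change residue (O x) (i ⟨f, hfS⟩) = _
    rw [h2, map_add, map_mul, (residue_eq_zero_iff z).2 (hz ▸ Ideal.mem_span_singleton_self z),
      zero_mul, add_zero]
  let e : (semilocalRing O T ⧸ Ideal.span {γ}) ≃ₐ[K] ResidueField (O x) :=
    (Ideal.quotientEquivAlgOfEq K hker.symm).trans (Ideal.quotientKerAlgEquivOfSurjective hsurj)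
  have := hO.finite
  refine ⟨Module.Finite.equiv e.symm.toLinearEquiv, ?_⟩
  rw [← Algebra.trace_eq_of_algEquiv e]
  rfl

/-- The trace on the quotient of the semilocal ring by a function `τ` is a sum over the zeros
of `τ`, with multiplicities. -/
theorem IsUniformizers.trace_quotient_eq_sum (hg : IsUniformizers O T g) (hC : IsSmoothCurve O η)
    (hT : η ∉ T) {e : X → ℕ} {w : F} (hw : ∀ x ∈ T, w ∈ O x ∧ w⁻¹ ∈ O x) (hw0 : w ≠ 0)
    (τ u : semilocalRing O T) (hτ : (τ : F) = w * ∏ x ∈ T, g x ^ e x) :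
    Algebra.trace K (semilocalRing O T ⧸ Ideal.span {τ}) (Ideal.Quotient.mk _ u) =
      ∑ x : T, e x * Algebra.trace K (ResidueField (O x))
        (residue (O x) ⟨u, mem_semilocalRing.1 u.2 x x.2⟩) := by
  classical
  let γ : T → semilocalRing O T := fun x =>
    ⟨g x, mem_semilocalRing.2 fun y hy => hg.mem x.2 hy⟩
  let W : (semilocalRing O T)ˣ := ⟨⟨w, mem_semilocalRing.2 fun y hy => (hw y hy).1⟩,
    ⟨w⁻¹, mem_semilocalRing.2 fun y hy => (hw y hy).2⟩, Subtype.ext (mul_inv_cancel₀ hw0),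
    Subtype.ext (inv_mul_cancel₀ hw0)⟩
  have h1 : τ = W * ∏ x : T, γ x ^ e x := Subtype.ext (by
    rw [hτ, ← Finset.prod_coe_sort]
    simp [W, γ])
  rw [h1, trace_quotient_unit_mul]
  have h2 := fun x : T => hg.trace_quotient hC hT x.2 (γ x) u rfl
  rw [(trace_quotient_prod (K := K) Finset.univ γ (fun x => e x) u
    (fun x _ h => hg.ne_zero hC hT x.2 (congrArg Subtype.val h)) (fun x _ => (h2 x).1)).2]
  exact Finset.sum_congr rfl fun x _ => by rw [(h2 x).2]
end

end Semilocal

/-! ### Traces to the field of rational functions -/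

section Integral
open Polynomial

variable {K F : Type*} [Field K] [Field F] [Algebra K F]
  {Y : Type*} [TopologicalSpace Y] {O : Y → Subalgebra K F} [∀ x, IsLocalRing (O x)] {η : Y}
  [Algebra K[X] F] [IsScalarTower K K[X] F]

theorem aeval_eq_algebraMap (p : K[X]) : algebraMap K[X] F p = aeval (algebraMap K[X] F X) p := by
  have : IsScalarTower.toAlgHom K K[X] F = aeval (algebraMap K[X] F X) := by
    ext; simp
  exact DFunLike.congr_fun this p

theorem algebraMap_mem_of_X {O : Subalgebra K F} (h : algebraMap K[X] F X ∈ O) (p : K[X]) :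
    algebraMap K[X] F p ∈ O := by
  rw [aeval_eq_algebraMap]
  exact (Subalgebra.aeval_coe O ⟨_, h⟩ p) ▸ (aeval (⟨_, h⟩ : O) p).2

variable {E : Type*} [Field E] [Algebra K[X] E] [IsFractionRing K[X] E] [Algebra E F]
  [IsScalarTower K[X] E F] [FiniteDimensional E F] [Algebra.IsSeparable E F]

theorem trace_polynomial_smul (E : Type*) [Field E] [Algebra K[X] E] [Algebra E F]
    [IsScalarTower K[X] E F] (q : K[X]) (f : F) :
    Algebra.trace E F (q • f) = algebraMap K[X] E q * Algebra.trace E F f := by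
  rw [← algebraMap_smul E q f, map_smul, smul_eq_mul]

theorem algebraMap_polynomial_injective (E : Type*) [Field E] [Algebra K[X] E]
    [IsFractionRing K[X] E] [Algebra E F] [IsScalarTower K[X] E F] :
    Function.Injective (algebraMap K[X] F) := by
  rw [IsScalarTower.algebraMap_eq K[X] E F]
  exact (algebraMap E F).injective.comp (IsFractionRing.injective K[X] E)

/-- A function that is regular at the zeros of an irreducible polynomial `π` has a denominator
that is prime to `π`. -/
theorem IsSmoothCurve.exists_isIntegral_smul (hC : IsSmoothCurve O η) (E : Type*) [Field E]
    [Algebra K[X] E] [IsFractionRing K[X] E] [Algebra E F] [IsScalarTower K[X] E F]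
    [FiniteDimensional E F] {π : K[X]} (hπ : Prime π) {u : F}
    (hu : ∀ x, (algebraMap K[X] F π)⁻¹ ∉ O x → algebraMap K[X] F X ∈ O x → u ∈ O x) :
    ∃ q : K[X], ¬ π ∣ q ∧ IsIntegral K[X] (q • u) := by
  have hinj := algebraMap_polynomial_injective (K := K) (F := F) E
  have halg : Algebra.IsAlgebraic K[X] F :=
    (IsFractionRing.comap_isAlgebraic_iff (A := K[X]) (K := E) (C := F)).2 inferInstance
  obtain ⟨l, hl0, hl⟩ := (halg.isAlgebraic u).exists_integral_multiple
  have hfin : FiniteMultiplicity π l := FiniteMultiplicity.of_prime_left hπ hl0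
  obtain ⟨m, q, rfl, hπq⟩ : ∃ m q, l = π ^ m * q ∧ ¬ π ∣ q :=
    ⟨_, hfin.exists_eq_pow_mul_and_not_dvd⟩
  refine ⟨q, hπq, (hC.isIntegral_iff (A := K[X]) _).2 fun x hx hA => ?_⟩
  by_cases hx' : (algebraMap K[X] F π)⁻¹ ∈ O x
  · have h1 := (hC.isIntegral_iff (A := K[X]) _).1 hl x hx hA
    have h2 : q • u = (algebraMap K[X] F π)⁻¹ ^ m * ((π ^ m * q) • u) := by
      rw [Algebra.smul_def, Algebra.smul_def, map_mul, map_pow]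
      have : algebraMap K[X] F π ≠ 0 := (map_ne_zero_iff _ hinj).2 hπ.ne_zero
      rw [inv_pow, mul_assoc, inv_mul_cancel_left₀ (pow_ne_zero _ this)]
    rw [h2]
    exact mul_mem (pow_mem hx' _) h1
  · rw [Algebra.smul_def]
    exact mul_mem (hA q) (hu x hx' (hA X))

attribute [local instance] Ideal.Quotient.field

/-- The trace of a function that vanishes at all zeros of `π` is divisible by `π`: modulo `π`, the
function is nilpotent in the integral closure of `K[X]`. -/
theorem IsSmoothCurve.dvd_intTrace (hC : IsSmoothCurve O η) (E : Type*) [Field E]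
    [Algebra K[X] E] [IsFractionRing K[X] E] [Algebra E F] [IsScalarTower K[X] E F]
    [FiniteDimensional E F] [Algebra.IsSeparable E F] {π : K[X]} (hπ : Prime π) {c : F}
    (hc : IsIntegral K[X] c)
    (hcπ : ∀ x, x ≠ η → (algebraMap K[X] F π)⁻¹ ∉ O x → algebraMap K[X] F X ∈ O x →
      ∃ t ∈ maximalIdeal (O x), (t : F) = c) :
    ∃ a : K[X], π ∣ a ∧ Algebra.trace E F c = algebraMap K[X] E a := by
  have hinj := algebraMap_polynomial_injective (K := K) (F := F) E
  have hπ0 : algebraMap K[X] F π ≠ 0 := (map_ne_zero_iff _ hinj).2 hπ.ne_zero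
  let C := integralClosure K[X] F
  have : IsIntegralClosure C K[X] F := integralClosure.isIntegralClosure _ _
  have : IsDedekindDomain C := IsIntegralClosure.isDedekindDomain K[X] E F C
  have : Module.Finite K[X] C := IsIntegralClosure.finite K[X] E F C
  have : IsFractionRing C F := IsIntegralClosure.isFractionRing_of_finite_extension K[X] E F C
  have : FaithfulSMul K[X] C := (faithfulSMul_iff_algebraMap_injective _ _).2 fun a b h =>
    hinj (congrArg (algebraMap C F) h)
  have : Module.IsTorsionFree K[X] C := inferInstance
  let γ : C := ⟨c, hc⟩
  let p : Ideal K[X] := Ideal.span {π}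
  have hpm : p.IsMaximal := PrincipalIdealRing.isMaximal_of_irreducible hπ.irreducible
  refine ⟨Algebra.intTrace K[X] C γ, ?_, (Algebra.algebraMap_intTrace (A := K[X]) (K := E) (L := F) γ).symm⟩
  rw [← Ideal.mem_span_singleton, ← Ideal.Quotient.eq_zero_iff_mem]
  have h1 := Algebra.trace_quotient_eq_of_isDedekindDomain (R := K[X]) (S := C) p γ
  change Ideal.Quotient.mk p _ = 0
  rw [← h1]
  refine (LinearMap.isNilpotent_trace_of_isNilpotent ?_).eq_zero
  -- it remains to see that a power of the function is divisible by `π`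
  have hfin := hC.finite_poles (algebraMap K[X] F π)⁻¹
  have hN : ∀ x : Y, ∃ N : ℕ, x ≠ η → (algebraMap K[X] F π)⁻¹ ∉ O x → algebraMap K[X] F X ∈ O x →
      ∀ n ≥ N, c ^ n * (algebraMap K[X] F π)⁻¹ ∈ O x := fun x => by
    by_cases h : x ≠ η ∧ (algebraMap K[X] F π)⁻¹ ∉ O x ∧ algebraMap K[X] F X ∈ O x
    · obtain ⟨t, ht, htc⟩ := hcπ x h.1 h.2.1 h.2.2
      obtain ⟨N, hN⟩ := (hC.point x h.1).exists_pow_mul_mem_of_mem_maximalIdeal ht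
        (algebraMap K[X] F π)⁻¹
      exact ⟨N, fun _ _ _ n hn => htc ▸ hN n hn⟩
    · exact ⟨0, fun h1 h2 h3 => (h ⟨h1, h2, h3⟩).elim⟩
  choose N hN using hN
  let M := hfin.toFinset.sup N
  have hM : IsIntegral K[X] (c ^ M * (algebraMap K[X] F π)⁻¹) := by
    rw [hC.isIntegral_iff]
    intro x hx hA
    by_cases hx' : (algebraMap K[X] F π)⁻¹ ∈ O x
    · exact mul_mem (pow_mem ((hC.isIntegral_iff (A := K[X]) _).1 hc x hx hA) _) hx'
    · exact hN x hx hx' (hA X) M (Finset.le_sup (f := N) (hfin.mem_toFinset.2 hx'))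
  have h2 : γ ^ M = algebraMap K[X] C π * ⟨_, hM⟩ := Subtype.ext (by
    change c ^ M = algebraMap K[X] F π * (c ^ M * (algebraMap K[X] F π)⁻¹)
    field_simp)
  refine IsNilpotent.map (f := Algebra.lmul (K[X] ⧸ p) (C ⧸ p.map (algebraMap K[X] C))) ⟨M, ?_⟩
  rw [← map_pow, Ideal.Quotient.eq_zero_iff_mem, h2]
  exact Ideal.mul_mem_right _ _ (Ideal.mem_map_of_mem _ (Ideal.mem_span_singleton_self π))

/-- The trace of a function `f` is a polynomial, if `π f` vanishes at the zeros of `π`, for every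
irreducible polynomial `π`. -/
theorem IsSmoothCurve.exists_trace_eq (hC : IsSmoothCurve O η) (E : Type*) [Field E]
    [Algebra K[X] E] [IsFractionRing K[X] E] [Algebra E F] [IsScalarTower K[X] E F]
    [FiniteDimensional E F] [Algebra.IsSeparable E F] {f : F}
    (hf : ∀ π : K[X], Prime π → ∀ x, x ≠ η → (algebraMap K[X] F π)⁻¹ ∉ O x →
      algebraMap K[X] F X ∈ O x → ∃ t ∈ maximalIdeal (O x), (t : F) = π • f) :
    ∃ a : K[X], Algebra.trace E F f = algebraMap K[X] E a := by
  have key : ∀ π : K[X], Prime π → ∃ q a : K[X], ¬ π ∣ q ∧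
      algebraMap K[X] E q * Algebra.trace E F f = algebraMap K[X] E a := by
    intro π hπ
    obtain ⟨q, hq, hint⟩ := hC.exists_isIntegral_smul E hπ (u := π • f) (fun x hx hxX => by
      rcases eq_or_ne x η with rfl | hxη
      · rw [hC.generic]; trivial
      · obtain ⟨t, -, ht⟩ := hf π hπ x hxη hx hxX
        rw [← ht]; exact t.2)
    obtain ⟨a, ⟨b, rfl⟩, ha⟩ := hC.dvd_intTrace E hπ hint (fun x hxη hx hxX => by
      obtain ⟨t, htm, ht⟩ := hf π hπ x hxη hx hxX
      refine ⟨⟨_, algebraMap_mem_of_X hxX q⟩ * t, Ideal.mul_mem_left _ _ htm, ?_⟩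
      rw [MulMemClass.coe_mul, ht, Algebra.smul_def q])
    refine ⟨q, b, hq, ?_⟩
    have hπ0 : algebraMap K[X] E π ≠ 0 :=
      (map_ne_zero_iff _ (IsFractionRing.injective K[X] E)).2 hπ.ne_zero
    apply mul_left_cancel₀ hπ0
    rw [← map_mul _ π b, ← ha, trace_polynomial_smul, trace_polynomial_smul]
    ring
  set r := Algebra.trace E F f
  -- no irreducible polynomial divides the denominator of the trace
  have hden : IsUnit (IsFractionRing.den K[X] r : K[X]) := by
    by_contra hcon
    obtain ⟨π, hπi, hπd⟩ := WfDvdMonoid.exists_irreducible_factor hcon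
      (nonZeroDivisors.ne_zero (IsFractionRing.den K[X] r).2)
    obtain ⟨q, a, hq, ha⟩ := key π hπi.prime
    have h1 : algebraMap K[X] E (IsFractionRing.den K[X] r) * r =
        algebraMap K[X] E (IsFractionRing.num K[X] r) := by
      have h0 : algebraMap K[X] E (IsFractionRing.den K[X] r) ≠ 0 :=
        (map_ne_zero_iff _ (IsFractionRing.injective K[X] E)).2 (nonZeroDivisors.ne_zero (IsFractionRing.den K[X] r).2)
      rw [mul_comm]
      exact ((div_eq_iff h0).1 (IsFractionRing.mk'_num_den' K[X] r)).symm
    have h2 : q * IsFractionRing.num K[X] r = a * IsFractionRing.den K[X] r := by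
      apply IsFractionRing.injective K[X] E
      rw [map_mul, map_mul, ← h1, ← ha]; ring
    have h3 : π ∣ IsFractionRing.num K[X] r :=
      (hπi.prime.dvd_or_dvd (h2 ▸ hπd.mul_left a)).resolve_left hq
    exact hπi.not_isUnit (IsFractionRing.num_den_reduced K[X] r h3 hπd)
  exact IsFractionRing.isInteger_of_isUnit_den hden |>.imp fun a h => h.symm

/-- The value at `0` of the trace of a function that is regular at the set `T` of zeros of the
coordinate `X` is the sum of its values at `T`, counted with multiplicities.  The integral closure
of `K[X]` and the semilocal ring of `T` have the same quotient by `X`. -/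
theorem IsSmoothCurve.trace_sub_mem (hC : IsSmoothCurve O η) (E : Type*) [Field E]
    [Algebra K[X] E] [IsFractionRing K[X] E] [Algebra E F] [IsScalarTower K[X] E F]
    [FiniteDimensional E F] [Algebra.IsSeparable E F] (T : Finset Y)
    (hT : ∀ x, x ∈ T ↔ (algebraMap K[X] F X)⁻¹ ∉ O x) {g : Y → F} (hg : IsUniformizers O T g)
    {e : Y → ℕ} {w : F} (hw : ∀ x ∈ T, w ∈ O x ∧ w⁻¹ ∈ O x)
    (hτ : algebraMap K[X] F X = w * ∏ x ∈ T, g x ^ e x) (u : semilocalRing O T) (x : Y) (hx : x ∈ T) :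
    ∃ t ∈ maximalIdeal (O x), (t : F) = algebraMap E F (Algebra.trace E F u) -
      algebraMap K F (∑ x : T, e x * Algebra.trace K (ResidueField (O x))
        (residue (O x) ⟨u, mem_semilocalRing.1 u.2 x x.2⟩)) := by
  have hinj := algebraMap_polynomial_injective (K := K) (F := F) E
  have hX0 : algebraMap K[X] F X ≠ 0 := (map_ne_zero_iff _ hinj).2 X_ne_zero
  have hηT : η ∉ T := fun h => (hT η).1 h (hC.generic ▸ Algebra.mem_top)
  have hne : ∀ y ∈ T, y ≠ η := fun y hy h => hηT (h ▸ hy)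
  have hXO : ∀ y ∈ T, algebraMap K[X] F X ∈ O y := fun y hy => by
    rw [← inv_inv (algebraMap K[X] F X)]
    exact (hC.point y (hne y hy)).inv_mem ((hT y).1 hy)
  have hXm : ∀ y (hy : y ∈ T), (⟨_, hXO y hy⟩ : O y) ∈ maximalIdeal (O y) := fun y hy =>
    (mem_maximalIdeal_iff _ fun h => hX0 (congrArg Subtype.val h)).2 ((hT y).1 hy)
  obtain ⟨q, hq, hint⟩ := hC.exists_isIntegral_smul E prime_X (u := u) fun y hy _ =>
    mem_semilocalRing.1 u.2 y ((hT y).2 hy)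
  let Z := integralClosure K[X] F
  have : IsIntegralClosure Z K[X] F := integralClosure.isIntegralClosure _ _
  have : IsDedekindDomain Z := IsIntegralClosure.isDedekindDomain K[X] E F Z
  have : Module.Finite K[X] Z := IsIntegralClosure.finite K[X] E F Z
  have : IsFractionRing Z F := IsIntegralClosure.isFractionRing_of_finite_extension K[X] E F Z
  have : FaithfulSMul K[X] Z := (faithfulSMul_iff_algebraMap_injective _ _).2 fun a b h =>
    hinj (congrArg (algebraMap Z F) h)
  let γ : Z := ⟨_, hint⟩
  let p : Ideal K[X] := Ideal.span {X}
  have hpm : p.IsMaximal := PrincipalIdealRing.isMaximal_of_irreducible irreducible_X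
  let a := Algebra.intTrace K[X] Z γ
  have ha : algebraMap K[X] E q * Algebra.trace E F u = algebraMap K[X] E a := by
    rw [Algebra.algebraMap_intTrace (A := K[X]) (K := E) (L := F) γ]
    change _ = Algebra.trace E F (q • (u : F))
    rw [trace_polynomial_smul]
  have h1 := Algebra.trace_quotient_eq_of_isDedekindDomain (R := K[X]) (S := Z) p γ
  -- the functions integral over `K[X]` modulo `X` are the semilocal functions modulo `X`
  have hCB : ∀ c : Z, (c : F) ∈ semilocalRing O T := fun c => mem_semilocalRing.2 fun y hy =>
    (hC.isIntegral_iff (A := K[X]) _).1 c.2 y (hne y hy) (algebraMap_mem_of_X (hXO y hy))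
  let B := semilocalRing O T
  let τ : B := ⟨algebraMap K[X] F X, mem_semilocalRing.2 hXO⟩
  let i : Z →+* B := (algebraMap Z F).codRestrict B.toSubring hCB
  let j : Z →+* B ⧸ Ideal.span {τ} := (Ideal.Quotient.mk _).comp i
  have hker : p.map (algebraMap K[X] Z) = RingHom.ker j := by
    rw [Ideal.map_span, Set.image_singleton]
    ext c
    have h2 : c ∈ RingHom.ker j ↔ i c ∈ Ideal.span {τ} := Ideal.Quotient.eq_zero_iff_mem
    rw [h2, Ideal.mem_span_singleton, Ideal.mem_span_singleton]
    constructor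
    · rintro ⟨d, rfl⟩; exact ⟨i d, by rw [map_mul]; rfl⟩
    · rintro ⟨b, hb⟩
      have hb' : (c : F) = algebraMap K[X] F X * b := congrArg Subtype.val hb
      have hbi : IsIntegral K[X] (b : F) := by
        rw [hC.isIntegral_iff]
        intro y hy hA
        by_cases hyT : y ∈ T
        · exact mem_semilocalRing.1 b.2 y hyT
        · have h3 : (b : F) = (algebraMap K[X] F X)⁻¹ * c := by
            rw [hb', inv_mul_cancel_left₀ hX0]
          rw [h3]
          exact mul_mem (not_not.1 (mt (hT y).2 hyT))
            ((hC.isIntegral_iff (A := K[X]) _).1 c.2 y hy hA)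
      exact ⟨⟨b, hbi⟩, Subtype.ext hb'⟩
  have hsurj : Function.Surjective j := by
    intro b
    obtain ⟨b, rfl⟩ := Ideal.Quotient.mk_surjective b
    obtain ⟨r, hr, hrint⟩ := hC.exists_isIntegral_smul E prime_X (u := b) fun y hy _ =>
      mem_semilocalRing.1 b.2 y ((hT y).2 hy)
    have hr0 : r.coeff 0 ≠ 0 := fun h => hr (X_dvd_iff.2 h)
    have hrb : IsIntegral K[X] ((C (r.coeff 0)⁻¹ : K[X]) • r • (b : F)) := hrint.smul _
    refine ⟨⟨_, hrb⟩, ?_⟩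
    refine (Ideal.Quotient.mk_eq_mk_iff_sub_mem _ _).2 (Ideal.mem_span_singleton.2 ?_)
    obtain ⟨s, hs⟩ := (X_dvd_iff (f := Polynomial.C (r.coeff 0)⁻¹ * r - 1)).2 (by simp [hr0])
    refine ⟨⟨algebraMap K[X] F s, mem_semilocalRing.2 fun y hy =>
      algebraMap_mem_of_X (hXO y hy) s⟩ * b, Subtype.ext ?_⟩
    change (C (r.coeff 0)⁻¹ : K[X]) • r • (b : F) - b =
      algebraMap K[X] F X * (algebraMap K[X] F s * b)
    rw [← mul_assoc, ← map_mul, ← hs, map_sub, map_one, sub_mul, one_mul, smul_smul,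
      Algebra.smul_def]
  let e₂ : (Z ⧸ p.map (algebraMap K[X] Z)) ≃+* (B ⧸ Ideal.span {τ}) :=
    (Ideal.quotEquivOfEq hker).trans (RingHom.quotientKerEquivOfSurjective hsurj)
  have hkerK : p = RingHom.ker (evalRingHom (0 : K)) := by
    rw [ker_evalRingHom, map_zero, sub_zero]
  have hsurjK : Function.Surjective (evalRingHom (0 : K)) := fun c => ⟨Polynomial.C c, by simp⟩
  let e₁ : (K[X] ⧸ p) ≃+* K :=
    (Ideal.quotEquivOfEq hkerK).trans (RingHom.quotientKerEquivOfSurjective hsurjK)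
  have h2 : Algebra.trace K (B ⧸ Ideal.span {τ}) (Ideal.Quotient.mk _ (i γ)) = a.eval 0 := by
    rw [Algebra.trace_eq_of_equiv_equiv e₁ e₂ ?_] at h1
    · have h3 := congrArg e₁ h1
      rw [RingEquiv.apply_symm_apply] at h3
      exact h3
    · refine RingHom.ext fun b => ?_
      obtain ⟨b, rfl⟩ := Ideal.Quotient.mk_surjective b
      obtain ⟨s, hs⟩ := (X_dvd_iff (f := b - C (b.coeff 0))).2 (by simp)
      refine (Ideal.Quotient.mk_eq_mk_iff_sub_mem (I := Ideal.span {τ})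
        (algebraMap K B (b.eval 0)) (i (algebraMap K[X] Z b))).2 ?_
      rw [← neg_mem_iff, neg_sub, Ideal.mem_span_singleton]
      refine ⟨⟨algebraMap K[X] F s, mem_semilocalRing.2 fun y hy =>
        algebraMap_mem_of_X (hXO y hy) s⟩, Subtype.ext ?_⟩
      change algebraMap K[X] F b - algebraMap K F (b.eval 0) =
        algebraMap K[X] F X * algebraMap K[X] F s
      rw [← map_mul, ← hs, map_sub, IsScalarTower.algebraMap_apply K K[X] F,
        coeff_zero_eq_eval_zero]
      rfl
  have hw0 : w ≠ 0 := by rintro rfl; rw [zero_mul] at hτ; exact hX0 hτ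
  rw [hg.trace_quotient_eq_sum hC hηT hw hw0 τ (i γ) hτ] at h2
  -- polynomials have their constant term as value at the points of `T`
  have hres : ∀ y (hy : y ∈ T) (b : K[X]), (⟨_, algebraMap_mem_of_X (hXO y hy) b⟩ : O y) -
      algebraMap K (O y) (b.coeff 0) ∈ maximalIdeal (O y) := fun y hy b => by
    obtain ⟨s, hs⟩ := (X_dvd_iff (f := b - C (b.coeff 0))).2 (by simp)
    have : (⟨_, algebraMap_mem_of_X (hXO y hy) b⟩ : O y) - algebraMap K (O y) (b.coeff 0) =
        ⟨_, hXO y hy⟩ * ⟨_, algebraMap_mem_of_X (hXO y hy) s⟩ := Subtype.ext (by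
      change algebraMap K[X] F b - algebraMap K F (b.coeff 0) =
        algebraMap K[X] F X * algebraMap K[X] F s
      rw [← map_mul, ← hs, map_sub, IsScalarTower.algebraMap_apply K K[X] F]
      rfl)
    rw [this]
    exact Ideal.mul_mem_right _ _ (hXm y hy)
  have hq0 : q.coeff 0 ≠ 0 := fun h => hq (X_dvd_iff.2 h)
  set S : K := ∑ x : T, e x * Algebra.trace K (ResidueField (O x))
        (residue (O x) ⟨u, mem_semilocalRing.1 u.2 x x.2⟩) with hS
  have hSa : q.coeff 0 * S = a.coeff 0 := by
    rw [coeff_zero_eq_eval_zero a, ← h2, hS, Finset.mul_sum]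
    refine Finset.sum_congr rfl fun y _ => ?_
    have h3 : (⟨i γ, mem_semilocalRing.1 (i γ).2 y y.2⟩ : O y) =
        ⟨_, algebraMap_mem_of_X (hXO y y.2) q⟩ * ⟨u, mem_semilocalRing.1 u.2 y y.2⟩ :=
      Subtype.ext (Algebra.smul_def q (u : F))
    have h4 : residue (O y) ⟨_, algebraMap_mem_of_X (hXO y y.2) q⟩ =
        algebraMap K (ResidueField (O y)) (q.coeff 0) := by
      rw [IsScalarTower.algebraMap_apply K (O y) (ResidueField (O y)), ResidueField.algebraMap_eq,
        ← sub_eq_zero, ← map_sub, residue_eq_zero_iff]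
      exact hres y y.2 q
    rw [h3, map_mul, h4, ← Algebra.smul_def, map_smul, smul_eq_mul]
    ring
  -- `q` is a unit at the points of `T`, as its value there is the nonzero constant term
  have hqu : IsUnit (⟨_, algebraMap_mem_of_X (hXO x hx) q⟩ : O x) := by
    by_contra hcon
    have h3 : algebraMap K (O x) (q.coeff 0) ∈ maximalIdeal (O x) := by
      have := sub_mem ((mem_maximalIdeal _).2 hcon) (hres x hx q)
      rwa [sub_sub_cancel] at this
    exact h3 ((isUnit_iff_ne_zero.2 hq0).map (algebraMap K (O x)))
  obtain ⟨v, hv⟩ := hqu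
  have hvF : ((v : O x) : F) = algebraMap K[X] F q := congrArg Subtype.val hv
  have hq' : algebraMap K[X] F q ≠ 0 := hvF ▸ unit_ne_zero v
  refine ⟨((v⁻¹ : (O x)ˣ) : O x) * ((⟨_, algebraMap_mem_of_X (hXO x hx) a⟩ -
    algebraMap K (O x) (a.coeff 0)) - algebraMap K (O x) S *
    (⟨_, algebraMap_mem_of_X (hXO x hx) q⟩ - algebraMap K (O x) (q.coeff 0))),
    Ideal.mul_mem_left _ _ (sub_mem (hres x hx a) (Ideal.mul_mem_left _ _ (hres x hx q))), ?_⟩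
  have ha' := congrArg (algebraMap E F) ha
  rw [map_mul, ← IsScalarTower.algebraMap_apply, ← IsScalarTower.algebraMap_apply] at ha'
  change (((v⁻¹ : (O x)ˣ) : O x) : F) * ((algebraMap K[X] F a - algebraMap K F (a.coeff 0)) -
    algebraMap K F S * (algebraMap K[X] F q - algebraMap K F (q.coeff 0))) = _
  rw [coe_inv_unit, hvF, ← ha', ← hSa, map_mul]
  field_simp
  ring

end Integral

section LogDerivative

variable {K F : Type*} [Field K] [Field F] [Algebra K F] [CharZero K]

theorem natCast_isUnit {O : Subalgebra K F} [IsLocalRing O] {n : ℕ} (hn : n ≠ 0) :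
    IsUnit (n : O) := by
  have : (n : O) = algebraMap K O n := by simp
  rw [this]
  exact (isUnit_iff_ne_zero.2 (Nat.cast_ne_zero.2 hn)).map _

theorem isUnit_add_of_mem {O : Type*} [CommRing O] [IsLocalRing O] {a b : O} (ha : IsUnit a)
    (hb : b ∈ maximalIdeal O) : IsUnit (a + b) := by
  by_contra h
  have := sub_mem ((mem_maximalIdeal _).2 h) hb
  rw [add_sub_cancel_right] at this
  exact this ha

/-- The logarithmic derivative of a function with a zero of order `n`. -/
theorem IsSmoothPoint.mul_deriv_eq {O : Subalgebra K F} [IsLocalRing O] (hO : IsSmoothPoint O)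
    {z : O} (hz : maximalIdeal O = Ideal.span {z}) {d : Derivation K F F} (hd : d (z : F) = 1)
    (hdO : ∀ a ∈ O, d a ∈ O) {n : ℕ} (hn : n ≠ 0) {s : F} (u : Oˣ)
    (hs : s = (u : O) * (z : F) ^ n) :
    ∃ c : Oˣ, (z : F) * d s = (c : O) * s ∧ residue O c = n := by
  have hzm : z ∈ maximalIdeal O := hz ▸ Ideal.mem_span_singleton_self z
  let b : O := z * (((u⁻¹ : Oˣ) : O) * ⟨_, hdO _ u.1.2⟩)
  have hb : b ∈ maximalIdeal O := Ideal.mul_mem_right _ _ hzm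
  obtain ⟨c, hc⟩ := isUnit_add_of_mem (natCast_isUnit (O := O) hn) hb
  refine ⟨c, ?_, ?_⟩
  · have hcF : ((c : O) : F) = n + z * (((u : O) : F)⁻¹ * d (u : O)) := by
      rw [hc, ← coe_inv_unit]
      simp [b]
    have hu := unit_ne_zero u
    obtain ⟨m, rfl⟩ := Nat.exists_eq_succ_of_ne_zero hn
    rw [hcF, hs, Derivation.leibniz, Derivation.leibniz_pow, hd]
    simp only [Nat.succ_eq_add_one, Nat.add_sub_cancel, smul_eq_mul, nsmul_eq_mul, mul_one]
    field_simp
    ring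
  · rw [hc, map_add, (residue_eq_zero_iff b).2 hb, add_zero, map_natCast]

theorem IsSmoothPoint.exists_unit_mul_pow {O : Subalgebra K F} [IsLocalRing O]
    (hO : IsSmoothPoint O) {z : O} (hz : maximalIdeal O = Ideal.span {z}) {a : O}
    (ha : a ∈ maximalIdeal O) (ha0 : a ≠ 0) : ∃ (n : ℕ) (u : Oˣ), n ≠ 0 ∧
      (a : F) = (u : O) * (z : F) ^ n := by
  have := hO.dvr
  obtain ⟨n, u, h⟩ := IsDiscreteValuationRing.eq_unit_mul_pow_irreducible ha0 (hO.irreducible hz)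
  refine ⟨n, u, ?_, congrArg Subtype.val h⟩
  rintro rfl
  rw [pow_zero, mul_one] at h
  exact ha (h ▸ u.isUnit)

end LogDerivative

section Coordinate

variable {K F : Type*} [Field K] [Field F] [Algebra K F]

/-- The derivation `d / dτ`. -/
theorem exists_derivation_of_finrank (hF : Module.finrank F Ω[F⁄K] = 1) {τ : F}
    (hτ : KaehlerDifferential.D K F τ ≠ 0) : ∃ d : Derivation K F F, d τ = 1 ∧
      ∀ f, KaehlerDifferential.D K F f = d f • KaehlerDifferential.D K F τ := by
  choose c hc using (finrank_eq_one_iff_of_nonzero' _ hτ).1 hF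
  have hinj : ∀ {a b : F}, a • KaehlerDifferential.D K F τ =
      b • KaehlerDifferential.D K F τ → a = b := fun h => smul_left_injective F hτ h
  let φ : Ω[F⁄K] →ₗ[F] F :=
    { toFun := c
      map_add' := fun x y => hinj (by rw [add_smul, hc, hc, hc])
      map_smul' := fun r x => hinj (by simp [mul_smul, hc]) }
  exact ⟨φ.compDer (KaehlerDifferential.D K F), hinj ((hc _).trans (one_smul _ _).symm),
    fun f => (hc _).symm⟩

theorem exists_derivative_eq [CharZero K] (a : Polynomial K) :
    ∃ q : Polynomial K, Polynomial.derivative q = a := by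
  induction a using Polynomial.induction_on' with
  | add p q hp hq =>
    obtain ⟨p, rfl⟩ := hp; obtain ⟨q, rfl⟩ := hq
    exact ⟨p + q, Polynomial.derivative_add⟩
  | monomial n c =>
    refine ⟨Polynomial.monomial (n + 1) (c / (n + 1 : ℕ)), ?_⟩
    rw [Polynomial.derivative_monomial]
    have : ((n + 1 : ℕ) : K) ≠ 0 := Nat.cast_ne_zero.2 (by omega)
    rw [div_mul_cancel₀ _ this]; simp

theorem transcendental_of_D_ne_zero [CharZero K] {τ : F} (hτ : KaehlerDifferential.D K F τ ≠ 0) :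
    Transcendental K τ := by
  intro h
  have hi : IsIntegral K τ := h.isIntegral
  have h1 := congrArg (KaehlerDifferential.D K F) (minpoly.aeval K τ)
  rw [Derivation.map_aeval, map_zero] at h1
  have hs := (minpoly.irreducible hi).separable.aeval_derivative_ne_zero (minpoly.aeval K τ)
  exact (smul_ne_zero hs hτ) h1

open IntermediateField

variable {X : Type*} [TopologicalSpace X] {O : X → Subalgebra K F} [∀ x, IsLocalRing (O x)] {η : X}

theorem IsSmoothCurve.essFiniteType (hC : IsSmoothCurve O η) : Algebra.EssFiniteType K F := by
  obtain ⟨b, U, ⟨y, hy⟩, h⟩ := hC.chart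
  have := CurvePairing.GeneratedBy.essFiniteType (h y hy)
  have : IsFractionRing (O y) F := by
    rcases eq_or_ne y η with rfl | hne
    · refine .of_field _ _ fun f => ⟨⟨f, hC.generic ▸ Algebra.mem_top⟩, 1, by simp⟩
    · exact (hC.point y hne).isFractionRing
  have := Algebra.EssFiniteType.of_isLocalization F (nonZeroDivisors (O y))
  exact Algebra.EssFiniteType.comp K (O y) F

/-- The function field is finite over the subfield generated by a function with nonzero
differential, since it is unramified and essentially of finite type over it. -/
theorem IsSmoothCurve.finiteDimensional (hC : IsSmoothCurve O η) {τ : F}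
    (hτ : KaehlerDifferential.D K F τ ≠ 0) (E : IntermediateField K F) (hE : τ ∈ E) :
    Algebra.FormallyUnramified E F ∧ FiniteDimensional E F := by
  have := hC.essFiniteType
  have : Algebra.EssFiniteType E F := .of_comp K E F
  have hu : Algebra.FormallyUnramified E F := by
    have hs := KaehlerDifferential.map_surjective K E F
    have h := (finrank_eq_one_iff_of_nonzero' _ hτ).1 hC.finrank_eq_one
    have h0 : ∀ ω, KaehlerDifferential.map K E F F ω = 0 := fun ω => by
      obtain ⟨c, rfl⟩ := h ω
      rw [map_smul, KaehlerDifferential.map_D]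
      have : KaehlerDifferential.D E F (algebraMap F F τ) = 0 :=
        Derivation.map_algebraMap _ (⟨τ, hE⟩ : E)
      rw [this, smul_zero]
    exact ⟨⟨fun a b => by
      obtain ⟨a, rfl⟩ := hs a; obtain ⟨b, rfl⟩ := hs b; rw [h0, h0]⟩⟩
  exact ⟨hu, Algebra.FormallyUnramified.finite_of_free E F⟩

/-- The subfield `E = K(τ)` as quotient field of `K[X]`, with `X ↦ τ`.  It is kept as a variable `E`
so that the lemma applies to both `τ` and `τ⁻¹`. -/
theorem isFractionRing_adjoin {τ : F} (hτ : Transcendental K τ) (E : IntermediateField K F)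
    (hE : τ ∈ E) (hE' : E ≤ K⟮τ⟯) :
    let _ : Algebra (Polynomial K) E := (Polynomial.aeval (⟨τ, hE⟩ : E)).toAlgebra
    IsFractionRing (Polynomial K) E := by
  intro _
  have hmap : ∀ p : Polynomial K, ((algebraMap (Polynomial K) E p : E) : F) =
      Polynomial.aeval τ p := fun p => by
    change ((Polynomial.aeval (⟨τ, hE⟩ : E) p : E) : F) = _
    exact (Polynomial.aeval_algebraMap_apply F (⟨τ, hE⟩ : E) p).symm
  have hinj : Function.Injective (algebraMap (Polynomial K) E) := by
    intro p q h
    apply transcendental_iff_injective.1 hτ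
    rw [← hmap, ← hmap, h]
  have : FaithfulSMul (Polynomial K) E := (faithfulSMul_iff_algebraMap_injective _ _).2 hinj
  refine .of_field _ _ fun f => ?_
  obtain ⟨r, s, h⟩ := IntermediateField.mem_adjoin_simple_iff K (f : F) |>.1 (hE' f.2)
  exact ⟨r, s, Subtype.ext (by rw [h, ← hmap, ← hmap]; rfl)⟩

/-- `IsSmoothCurve.exists_trace_eq` for the subfield generated by a function `τ`. -/
theorem IsSmoothCurve.exists_trace_eq_aeval [CharZero K] (hC : IsSmoothCurve O η) {τ : F}
    (hτ : KaehlerDifferential.D K F τ ≠ 0) (E : IntermediateField K F) (hE : τ ∈ E)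
    (hE' : E ≤ K⟮τ⟯) {f : F}
    (hf : ∀ π : Polynomial K, Prime π → ∀ x, x ≠ η → (Polynomial.aeval τ π)⁻¹ ∉ O x →
      τ ∈ O x → ∃ t ∈ maximalIdeal (O x), (t : F) = Polynomial.aeval τ π * f) :
    ∃ a : Polynomial K, ((Algebra.trace E F f : E) : F) = Polynomial.aeval τ a := by
  letI : Algebra (Polynomial K) E := (Polynomial.aeval (⟨τ, hE⟩ : E)).toAlgebra
  letI : Algebra (Polynomial K) F := (Polynomial.aeval τ).toAlgebra
  have hmap : ∀ p : Polynomial K, ((algebraMap (Polynomial K) E p : E) : F) =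
      Polynomial.aeval τ p := fun p => by
    change ((Polynomial.aeval (⟨τ, hE⟩ : E) p : E) : F) = _
    exact (Polynomial.aeval_algebraMap_apply F (⟨τ, hE⟩ : E) p).symm
  have hX : algebraMap (Polynomial K) F Polynomial.X = τ := Polynomial.aeval_X τ
  have : IsScalarTower K (Polynomial K) F := .of_algebraMap_eq fun c =>
    (Polynomial.aeval_C τ c).symm
  have : IsScalarTower (Polynomial K) E F := .of_algebraMap_eq fun p => (hmap p).symm
  have : IsFractionRing (Polynomial K) E :=
    isFractionRing_adjoin (transcendental_of_D_ne_zero hτ) E hE hE'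
  obtain ⟨-, _⟩ := hC.finiteDimensional hτ E hE
  obtain ⟨a, ha⟩ := hC.exists_trace_eq E (f := f) fun π hπ x hx h1 h2 => by
    obtain ⟨t, ht, ht'⟩ := hf π hπ x hx h1 (hX ▸ h2)
    exact ⟨t, ht, ht'.trans (Algebra.smul_def π f).symm⟩
  exact ⟨a, by rw [ha, hmap]⟩

/-- `IsSmoothCurve.trace_sub_mem` for the subfield generated by a function `τ`. -/
theorem IsSmoothCurve.trace_sub_mem_of_adjoin [CharZero K] (hC : IsSmoothCurve O η) {τ : F}
    (hτ : KaehlerDifferential.D K F τ ≠ 0) (E : IntermediateField K F) (hE : τ ∈ E)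
    (hE' : E ≤ K⟮τ⟯) (T : Finset X) (hT : ∀ x, x ∈ T ↔ τ⁻¹ ∉ O x) {g : X → F}
    (hg : IsUniformizers O T g) {e : X → ℕ} {w : F} (hw : ∀ x ∈ T, w ∈ O x ∧ w⁻¹ ∈ O x)
    (hτw : τ = w * ∏ x ∈ T, g x ^ e x) {u : F} (hu : ∀ x ∈ T, u ∈ O x) (x : X) (hx : x ∈ T) :
    ∃ t ∈ maximalIdeal (O x), (t : F) = (Algebra.trace E F u : E) -
      algebraMap K F (∑ x : T, e x * Algebra.trace K (ResidueField (O x))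
        (residue (O x) ⟨u, hu x x.2⟩)) := by
  letI : Algebra (Polynomial K) E := (Polynomial.aeval (⟨τ, hE⟩ : E)).toAlgebra
  letI : Algebra (Polynomial K) F := (Polynomial.aeval τ).toAlgebra
  have hX : algebraMap (Polynomial K) F Polynomial.X = τ := Polynomial.aeval_X τ
  have : IsScalarTower K (Polynomial K) F := .of_algebraMap_eq fun c =>
    (Polynomial.aeval_C τ c).symm
  have : IsScalarTower (Polynomial K) E F := .of_algebraMap_eq fun p =>
    (Polynomial.aeval_algebraMap_apply F (⟨τ, hE⟩ : E) p)
  have : IsFractionRing (Polynomial K) E :=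
    isFractionRing_adjoin (transcendental_of_D_ne_zero hτ) E hE hE'
  obtain ⟨-, _⟩ := hC.finiteDimensional hτ E hE
  exact hC.trace_sub_mem E T (by rwa [hX]) hg hw (by rwa [hX])
    ⟨u, mem_semilocalRing.2 hu⟩ x hx

theorem exists_derivation_restrict (θ : Derivation K F F) (E : IntermediateField K F)
    (h : ∀ a ∈ E, θ a ∈ E) : ∃ δ : Derivation K E E, ∀ a, (δ a : F) = θ a :=
  ⟨Derivation.mk'
    { toFun := fun a => ⟨θ a, h a a.2⟩
      map_add' := fun a b => Subtype.ext (map_add θ _ _)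
      map_smul' := fun c a => Subtype.ext (θ.map_smul c _) }
    fun a b => Subtype.ext (θ.leibniz _ _), fun _ => rfl⟩

theorem mem_adjoin_of_derivation (θ : Derivation K F F) {s : F} (hs : θ s ∈ K⟮s⟯) :
    ∀ a ∈ K⟮s⟯, θ a ∈ K⟮s⟯ := by
  intro a ha
  induction ha using IntermediateField.adjoin_induction with
  | mem x hx => obtain rfl := hx; exact hs
  | algebraMap c => rw [θ.map_algebraMap]; exact zero_mem _
  | add x y _ _ hx hy => rw [map_add]; exact add_mem hx hy
  | inv x hx' hx =>
    rw [θ.leibniz_inv]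
    exact mul_mem (neg_mem (pow_mem (inv_mem hx') 2)) hx
  | mul x y hx' hy' hx hy =>
    rw [θ.leibniz]
    exact add_mem (mul_mem hx' hy) (mul_mem hy' hx)

end Coordinate

/-! ### The residue theorem -/

section LogResidue

variable {K F : Type*} [Field K] [Field F] [Algebra K F] [CharZero K] {O : Subalgebra K F}
  [IsLocalRing O]

/-- The local computations at a zero of order `n` of a function `s`, in terms of the derivation
`θ = s d/ds`. -/
structure IsLogDerivationAt (O : Subalgebra K F) [IsLocalRing O] (s : F) (n : ℕ)
    (θ : Derivation K F F) : Prop where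
  apply_mem : ∀ a ∈ O, ∃ t ∈ maximalIdeal O, (t : F) = θ a
  mem_of_apply : ∀ f, θ f ∈ O → f ∈ O
  exists_sub_mem : ∀ g : F, ∃ h, g - θ h ∈ O
  hasResidue : ∀ (g h : F) (u : O), g - θ h = u →
    HasResidue O ((g * s⁻¹) • KaehlerDifferential.D K F s)
      (n * Algebra.trace K (ResidueField O) (residue O u))

/-- In terms of a uniformizer `z`, the derivation `θ` is `z d/dz` up to a unit with value `n⁻¹`. -/
theorem IsSmoothPoint.isLogDerivationAt (hO : IsSmoothPoint O) {z : O}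
    (hz : maximalIdeal O = Ideal.span {z}) {s : F} (hs0 : s ≠ 0) {n : ℕ} (hn : n ≠ 0) (u : Oˣ)
    (hs : s = (u : O) * (z : F) ^ n) {θ : Derivation K F F}
    (hθ : ∀ f, KaehlerDifferential.D K F f = (θ f * s⁻¹) • KaehlerDifferential.D K F s) :
    IsLogDerivationAt O s n θ := by
  obtain ⟨d, hd, hdO, hdf⟩ := hO.exists_derivation hz
  obtain ⟨c, hc, hcn⟩ := hO.mul_deriv_eq hz hd hdO hn u hs
  have hz0 := hO.ne_zero hz
  have hc0 := unit_ne_zero c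
  have hzm : z ∈ maximalIdeal O := hz ▸ Ideal.mem_span_singleton_self z
  have hds : d s = (c : O) * s * (z : F)⁻¹ := by rw [← hc]; field_simp
  have hθd : ∀ f, (z : F) * d f = (c : O) * θ f := fun f => by
    have h1 := hθ f
    rw [hdf s, hdf f, smul_smul] at h1
    have h2 : d f = θ f * s⁻¹ * d s := smul_left_injective F (hO.D_ne_zero hz) h1
    rw [h2, hds]; field_simp
  have hform : ∀ g : F, (g * s⁻¹) • KaehlerDifferential.D K F s =
      (g * (c : O) * (z : F)⁻¹) • KaehlerDifferential.D K F (z : F) := fun g => by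
    rw [hdf s, smul_smul, hds]; congr 1; field_simp
  refine ⟨fun a ha => ?_, fun f hf => ?_, fun g => ?_, fun g h v hv => ?_⟩
  · refine ⟨((c⁻¹ : Oˣ) : O) * (z * ⟨_, hdO a ha⟩), Ideal.mul_mem_left _ _
      (Ideal.mul_mem_right _ _ hzm), ?_⟩
    rw [MulMemClass.coe_mul, MulMemClass.coe_mul, hθd a, coe_inv_unit]
    field_simp
  · have := hO.pow_mul_mem_of_deriv hz hd hdO (i := 0) (f := f) (by
      rw [zero_add, pow_one, hθd]; exact mul_mem c.1.2 hf)
    simpa using this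
  · obtain ⟨r, hr⟩ := hO.exists_hasResidue ((g * s⁻¹) • KaehlerDifferential.D K F s)
    obtain ⟨v, h, hv, -⟩ := (hO.hasResidue_iff hz).1 hr
    refine ⟨h, ?_⟩
    rw [hform, hdf h, ← sub_smul, ← sub_smul, hO.smul_D_mem_iff hz] at hv
    have : g - θ h = ((c⁻¹ : Oˣ) : O) * (z * (g * (c : O) * (z : F)⁻¹ - v * (z : F)⁻¹ - d h) + v) := by
      rw [mul_sub, hθd, coe_inv_unit]; field_simp; ring
    rw [this]
    exact mul_mem (c⁻¹ : Oˣ).1.2 (add_mem (mul_mem z.2 hv) v.2)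
  · refine (hO.hasResidue_iff hz).2 ⟨v * c, h, ?_, ?_⟩
    · have : (g * s⁻¹) • KaehlerDifferential.D K F s - (((v * c : O) : F) * (z : F)⁻¹) •
          KaehlerDifferential.D K F (z : F) - KaehlerDifferential.D K F h = 0 := by
        rw [hform, hdf h, ← sub_smul, ← sub_smul, MulMemClass.coe_mul, ← hv]
        have : d h = (c : O) * θ h * (z : F)⁻¹ := by rw [← hθd]; field_simp
        rw [this]
        convert zero_smul F _ using 2
        ring
      rw [this]; exact zero_mem _
    · rw [map_mul, hcn, mul_comm (residue O v), ← nsmul_eq_mul, ← nsmul_eq_mul, map_nsmul]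

end LogResidue

section ResidueTheorem
open IntermediateField

variable {K F : Type*} [Field K] [Field F] [Algebra K F] [CharZero K]

variable {X : Type*} [TopologicalSpace X] {O : X → Subalgebra K F} [∀ x, IsLocalRing (O x)] {η : X}

/-- At the places where the function `t` is regular, a form `f dt` without poles satisfies the
hypothesis of `IsSmoothCurve.exists_trace_eq`. -/
theorem IsSmoothPoint.exists_mem_maximalIdeal_of_smul_D_mem {O : Subalgebra K F} [IsLocalRing O]
    (hO : IsSmoothPoint O) {t f : F}
    (hf : f • KaehlerDifferential.D K F t ∈ regularForms O K) (π : Polynomial K)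
    (hπ0 : Polynomial.aeval t π ≠ 0) (hπ : (Polynomial.aeval t π)⁻¹ ∉ O) (ht : t ∈ O) :
    ∃ a ∈ maximalIdeal O, (a : F) = Polynomial.aeval t π * f := by
  obtain ⟨z, hz⟩ := hO.exists_uniformizer
  obtain ⟨d, hd, hdO, hdf⟩ := hO.exists_derivation hz
  have hcoe : ∀ p : Polynomial K, Polynomial.aeval t p ∈ O := fun p =>
    (Subalgebra.aeval_coe O ⟨t, ht⟩ p) ▸ (Polynomial.aeval (⟨t, ht⟩ : O) p).2
  have hpm : (⟨_, hcoe π⟩ : O) ∈ maximalIdeal O :=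
    (mem_maximalIdeal_iff _ fun h => hπ0 (congrArg Subtype.val h)).2 hπ
  obtain ⟨n, u, hn, hu⟩ := hO.exists_unit_mul_pow hz hpm fun h => hπ0 (congrArg Subtype.val h)
  obtain ⟨c, hc, -⟩ := hO.mul_deriv_eq hz hd hdO hn u hu
  rw [hdf t, smul_smul, hO.smul_D_mem_iff hz] at hf
  have h1 : d (Polynomial.aeval t π) = Polynomial.aeval t (Polynomial.derivative π) * d t := by
    rw [Derivation.map_aeval, smul_eq_mul]
  refine ⟨((c⁻¹ : Oˣ) : O) * (z * (⟨_, hcoe (Polynomial.derivative π)⟩ * ⟨_, hf⟩)),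
    Ideal.mul_mem_left _ _ (Ideal.mul_mem_right _ _ (hz ▸ Ideal.mem_span_singleton_self z)), ?_⟩
  have hc0 := unit_ne_zero c
  change (((c⁻¹ : Oˣ) : O) : F) * ((z : F) * (Polynomial.aeval t (Polynomial.derivative π) * (f * d t))) = _
  change (z : F) * d (Polynomial.aeval t π) = (c : O) * Polynomial.aeval t π at hc
  rw [h1] at hc
  rw [coe_inv_unit, inv_mul_eq_iff_eq_mul₀ hc0, ← mul_assoc ((c : O) : F), ← hc]
  ring

/-- The residue theorem.  Let `s` be a function that vanishes at all poles of `ω`, and write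
`ω = (u + θ f) ds / s` with `θ = s d/ds` and `u` regular at the zeros of `s`.  The trace of `ω` to
`K(s)` is regular outside `s = 0`, so that it is of the form `p(s⁻¹) d(s⁻¹)` and exact; hence the
trace of `u` is in the image of `θ`.  As it is regular at `s = 0`, it vanishes there, and its value
is the sum of the residues of `ω`. -/
theorem IsSmoothCurve.sum_residue_eq_zero (hC : IsSmoothCurve O η) {ω : Ω[F⁄K]} (S : Finset X)
    (hS : η ∉ S) (hreg : ∀ x, x ∉ S → x ≠ η → ω ∈ regularForms (O x) K) (r : X → K)
    (hr : ∀ x ∈ S, HasResidue (O x) ω (r x)) : ∑ x ∈ S, r x = 0 := by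
  classical
  rcases S.eq_empty_or_nonempty with rfl | ⟨x₀, hx₀⟩
  · simp
  have : CharZero F := charZero_of_injective_algebraMap (algebraMap K F).injective
  -- a function `s` vanishing at the poles
  obtain ⟨g, hg⟩ := hC.exists_isUniformizers S hS
  set s : F := ∏ x ∈ S, g x with hs
  have hs0 : s ≠ 0 := Finset.prod_ne_zero_iff.2 fun x hx => hg.ne_zero hC hS hx
  have hsS : ∀ x ∈ S, s⁻¹ ∉ O x := fun x hx h => by
    obtain ⟨⟨z, hz, hzg⟩, -⟩ := hg x hx
    have h1 : (g x)⁻¹ = s⁻¹ * ∏ y ∈ S.erase x, g y := by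
      have h2 := hg.ne_zero hC hS hx
      rw [hs, ← Finset.mul_prod_erase S g hx] at hs0 ⊢
      have := right_ne_zero_of_mul hs0
      field_simp
    have h2 : (g x)⁻¹ ∈ O x := h1 ▸ mul_mem h
      (prod_mem fun y hy => hg.mem (Finset.mem_of_mem_erase hy) hx)
    have hO := hC.point x (fun h => hS (h ▸ hx))
    refine hO.not_mem_of_mul_eq_unit hz (u := 1) ?_ h2
    rw [← hzg]; simp [hO.ne_zero hz]
  -- all the zeros of `s`
  set T : Finset X := (hC.finite_poles s⁻¹).toFinset with hTdef
  have hT : ∀ x, x ∈ T ↔ s⁻¹ ∉ O x := fun x => by simp [hTdef]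
  have hηT : η ∉ T := fun h => (hT η).1 h (hC.generic ▸ Algebra.mem_top)
  have hne : ∀ x ∈ T, x ≠ η := fun x hx h => hηT (h ▸ hx)
  have hST : S ⊆ T := fun x hx => (hT x).2 (hsS x hx)
  have hsO : ∀ x ∈ T, s ∈ O x := fun x hx => by
    rw [← inv_inv s]; exact (hC.point x (hne x hx)).inv_mem ((hT x).1 hx)
  obtain ⟨gT, hgT⟩ := hC.exists_isUniformizers T hηT
  obtain ⟨e, w, hsw, hw⟩ := hgT.exists_eq_mul_prod hC hηT hs0 hsO
  -- the local form of `s` at its zeros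
  have hloc : ∀ x ∈ T, ∃ (z : O x) (u : (O x)ˣ), maximalIdeal (O x) = Ideal.span {z} ∧ e x ≠ 0 ∧
      s = (u : O x) * (z : F) ^ e x := fun x hx => by
    obtain ⟨⟨z, hz, hzg⟩, hy⟩ := hgT x hx
    have hv : w * ∏ y ∈ T.erase x, gT y ^ e y ∈ O x := mul_mem (hw x hx).1
      (prod_mem fun y hy => pow_mem (hgT.mem (Finset.mem_of_mem_erase hy) hx) _)
    have hvi : (w * ∏ y ∈ T.erase x, gT y ^ e y)⁻¹ ∈ O x := by
      rw [mul_inv, ← Finset.prod_inv_distrib]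
      refine mul_mem (hw x hx).2 (prod_mem fun y hy => ?_)
      rw [← inv_pow]
      exact pow_mem ((hgT y (Finset.mem_of_mem_erase hy)).2 x hx (Finset.ne_of_mem_erase hy).symm).2 _
    have hse : s = (w * ∏ y ∈ T.erase x, gT y ^ e y) * (z : F) ^ e x := by
      rw [hsw, ← Finset.mul_prod_erase T _ hx, hzg]; ring
    have hv0 : w * ∏ y ∈ T.erase x, gT y ^ e y ≠ 0 := fun h => hs0 (by rw [hse, h, zero_mul])
    refine ⟨z, ⟨⟨_, hv⟩, ⟨_, hvi⟩, Subtype.ext (mul_inv_cancel₀ hv0),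
      Subtype.ext (inv_mul_cancel₀ hv0)⟩, hz, fun h => ?_, hse⟩
    rw [h, pow_zero, mul_one] at hse
    exact (hT x).1 hx (hse ▸ hvi)
  have hDs : KaehlerDifferential.D K F s ≠ 0 := by
    have hO := hC.point x₀ (hne x₀ (hST hx₀))
    obtain ⟨z, u, hz, hn, h⟩ := hloc x₀ (hST hx₀)
    obtain ⟨d, hd, hdO, hdf⟩ := hO.exists_derivation hz
    obtain ⟨c, hc, -⟩ := hO.mul_deriv_eq hz hd hdO hn u h
    rw [hdf]
    refine smul_ne_zero (fun h0 => ?_) (hO.D_ne_zero hz)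
    rw [h0, mul_zero] at hc
    exact mul_ne_zero (unit_ne_zero c) hs0 hc.symm
  -- the derivation `θ = s d/ds`
  obtain ⟨d, hd, hdf⟩ := exists_derivation_of_finrank hC.finrank_eq_one hDs
  set θ : Derivation K F F := s • d with hθdef
  have hθ : ∀ f, KaehlerDifferential.D K F f = (θ f * s⁻¹) • KaehlerDifferential.D K F s :=
    fun f => by rw [hdf f, hθdef, Derivation.smul_apply, smul_eq_mul]; congr 1; field_simp
  have hθs : θ s = s := by rw [hθdef, Derivation.smul_apply, hd, smul_eq_mul, mul_one]
  have hlog : ∀ x ∈ T, IsLogDerivationAt (O x) s (e x) θ := fun x hx => by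
    obtain ⟨z, u, hz, hn, h⟩ := hloc x hx
    exact (hC.point x (hne x hx)).isLogDerivationAt hz hs0 hn u h hθ
  obtain ⟨G, hG⟩ := (finrank_eq_one_iff_of_nonzero' _ hDs).1 hC.finrank_eq_one ω
  set g₀ : F := G * s with hg₀
  have hω : ω = (g₀ * s⁻¹) • KaehlerDifferential.D K F s := by
    rw [← hG, hg₀]; congr 1; field_simp
  -- subtract an exact form to reduce the poles at the zeros of `s` to logarithmic ones
  have : ∀ x, ∃ h : F, x ∈ T → g₀ - θ h ∈ O x := fun x => by
    by_cases hx : x ∈ T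
    · obtain ⟨h, hh⟩ := (hlog x hx).exists_sub_mem g₀
      exact ⟨h, fun _ => hh⟩
    · exact ⟨0, fun h => (hx h).elim⟩
  choose h hh using this
  obtain ⟨f, hf⟩ := hC.exists_approx T hηT h 1 fun _ _ => one_ne_zero
  have hu : ∀ x ∈ T, g₀ - θ f ∈ O x := fun x hx => by
    have h1 : g₀ - θ f = (g₀ - θ (h x)) - θ (f - h x) := by rw [map_sub]; ring
    have h2 := hf x hx
    rw [Pi.one_apply, div_one] at h2
    obtain ⟨t, -, ht⟩ := (hlog x hx).apply_mem _ h2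
    rw [h1, ← ht]
    exact sub_mem (hh x hx) t.2
  set E := K⟮s⟯ with hE
  have hsE : s ∈ E := IntermediateField.mem_adjoin_simple_self K s
  obtain ⟨δ, hδ⟩ := exists_derivation_restrict θ E
    (mem_adjoin_of_derivation θ (by rw [hθs]; exact hsE))
  obtain ⟨-, _⟩ := hC.finiteDimensional hDs E hsE
  -- the trace of `ω`, by the regularity of `ω` away from the zeros of `s`
  have hDt : KaehlerDifferential.D K F s⁻¹ = (-s⁻¹ ^ 2) • KaehlerDifferential.D K F s :=
    Derivation.leibniz_inv _ _
  have hDt0 : KaehlerDifferential.D K F s⁻¹ ≠ 0 := by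
    rw [hDt]; exact smul_ne_zero (neg_ne_zero.2 (pow_ne_zero _ (inv_ne_zero hs0))) hDs
  have hωt : ω = (-(g₀ * s)) • KaehlerDifferential.D K F s⁻¹ := by
    rw [hω, hDt, smul_smul]; congr 1; field_simp
  have htr := transcendental_of_D_ne_zero hDt0
  obtain ⟨a, ha⟩ := hC.exists_trace_eq_aeval hDt0 E (inv_mem hsE)
    (by
      rw [hE, IntermediateField.adjoin_simple_le_iff]
      simpa using inv_mem (IntermediateField.mem_adjoin_simple_self K s⁻¹))
    (f := -(g₀ * s)) fun π hπ x hx h1 h2 => by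
      have hxT : x ∉ T := fun h => (hT x).1 h h2
      refine (hC.point x hx).exists_mem_maximalIdeal_of_smul_D_mem ?_ π ?_ h1 h2
      · rw [← hωt]; exact hreg x (fun h => hxT (hST h)) hx
      · exact (map_ne_zero_iff _ (transcendental_iff_injective.1 htr)).2 hπ.ne_zero
  obtain ⟨q, hq⟩ := exists_derivative_eq a
  let t' : E := ⟨s⁻¹, inv_mem hsE⟩
  have hcoe : ∀ p : Polynomial K, ((Polynomial.aeval t' p : E) : F) = Polynomial.aeval s⁻¹ p :=
    fun p => (Polynomial.aeval_algebraMap_apply F t' p).symm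
  have hδt : δ t' = -t' := Subtype.ext (by
    rw [hδ]
    change θ s⁻¹ = -s⁻¹
    rw [θ.leibniz_inv, hθs, smul_eq_mul]; field_simp)
  have hTr : Algebra.trace E F g₀ = δ (Polynomial.aeval t' q) := by
    have h1 : g₀ = (-t') • (-(g₀ * s)) := by
      change g₀ = -s⁻¹ * -(g₀ * s)
      field_simp
    rw [h1, map_smul, Derivation.map_aeval, hq, hδt, smul_eq_mul, smul_eq_mul, mul_comm]
    congr 1
    exact Subtype.ext (by rw [ha, hcoe])
  have hTru : Algebra.trace E F (g₀ - θ f) =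
      δ (Polynomial.aeval t' q - Algebra.trace E F f) := by
    rw [map_sub, map_sub, hTr, derivation_trace θ δ (fun b => (hδ b).symm)]
  obtain ⟨b, hb, hb'⟩ := hC.trace_sub_mem_of_adjoin hDs E hsE le_rfl T hT hgT hw hsw hu x₀ (hST hx₀)
  set tot : K := ∑ x : T, e x * Algebra.trace K (ResidueField (O x))
        (residue (O x) ⟨g₀ - θ f, hu x x.2⟩) with htot
  -- both the trace and its difference with the constant `tot` vanish at a zero of `s`
  have hzero : tot = 0 := by
    rw [hTru, hδ] at hb'
    set H : F := ((Polynomial.aeval t' q - Algebra.trace E F f : E) : F)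
    have h1 : θ H ∈ O x₀ := by
      have : θ H = b + algebraMap K F tot := by rw [hb']; ring
      rw [this]; exact add_mem b.2 (Subalgebra.algebraMap_mem _ _)
    obtain ⟨t, ht, ht'⟩ := (hlog x₀ (hST hx₀)).apply_mem _
      ((hlog x₀ (hST hx₀)).mem_of_apply _ h1)
    by_contra hne0
    have h2 : algebraMap K (O x₀) tot = t - b := Subtype.ext (by
      rw [AddSubgroupClass.coe_sub, hb', ht']
      change algebraMap K F tot = _
      ring)
    have h3 : algebraMap K (O x₀) tot ∈ maximalIdeal (O x₀) := h2 ▸ sub_mem ht hb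
    exact h3 ((isUnit_iff_ne_zero.2 hne0).map (algebraMap K (O x₀)))
  rw [← hzero, htot]
  have h1 : ∀ x : T, (if (x : X) ∈ S then r x else 0) = e x * Algebra.trace K (ResidueField (O x))
        (residue (O x) ⟨g₀ - θ f, hu x x.2⟩) := fun x => by
    have hO := hC.point x (hne x x.2)
    have h2 := (hlog x x.2).hasResidue g₀ f ⟨_, hu x x.2⟩ rfl
    rw [← hω] at h2
    refine hO.hasResidue_unique ?_ h2
    split_ifs with hxS
    · exact hr x hxS
    · exact hasResidue_of_mem hO (hreg x hxS (hne x x.2))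
  rw [← Finset.sum_congr rfl fun x _ => h1 x, Finset.sum_coe_sort T fun x => if x ∈ S then r x else 0,
    ← Finset.sum_filter]
  congr 1
  ext x
  simp only [Finset.mem_filter]
  exact ⟨fun h => ⟨hST h, h⟩, fun h => h.2⟩

end ResidueTheorem

/-! ### Contraction of absolute forms -/

section Contraction

variable {k : Type v} {K : Type u} {F : Type w} [Field k] [Field K] [Field F] [Algebra k K]
  [Algebra k F] [Algebra K F] [IsScalarTower k K F]

theorem relForm_D (f : F) :
    relForm k K (KaehlerDifferential.D k F f) = KaehlerDifferential.D K F f :=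
  KaehlerDifferential.map_D _ _ _ _ _

theorem pullForm_D (a : K) : pullForm (F := F) k (KaehlerDifferential.D k K a) =
    KaehlerDifferential.D k F (algebraMap K F a) :=
  KaehlerDifferential.map_D _ _ _ _ _

variable (k K F) in
/-- The forms that come from the base field, `Ω¹_K ⊗ F ⊂ Ω¹_F`. -/
def baseForms : Submodule F Ω[F⁄k] :=
  Submodule.span F (Set.range fun a : K => KaehlerDifferential.D k F (algebraMap K F a))

theorem pullForm_mem_baseForms (τ : Ω[K⁄k]) : pullForm k τ ∈ baseForms k K F := by
  have hτ : τ ∈ Submodule.span K (Set.range (KaehlerDifferential.D k K)) := by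
    rw [KaehlerDifferential.span_range_derivation]; trivial
  induction hτ using Submodule.span_induction with
  | mem x hx =>
    obtain ⟨a, rfl⟩ := hx
    rw [pullForm_D]
    exact Submodule.subset_span ⟨a, rfl⟩
  | zero => rw [map_zero]; exact zero_mem _
  | add x y _ _ hx hy => rw [map_add]; exact add_mem hx hy
  | smul a x _ hx =>
    rw [map_smul, ← algebraMap_smul F a]
    exact Submodule.smul_mem _ _ hx

theorem mem_baseForms_of_relForm_eq_zero {ω : Ω[F⁄k]} (h : relForm k K ω = 0) :
    ω ∈ baseForms k K F := by
  obtain ⟨t, rfl⟩ := (KaehlerDifferential.exact_mapBaseChange_map k K F ω).1 h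
  induction t with
  | zero => rw [map_zero]; exact zero_mem _
  | add x y hx hy =>
    rw [map_add]
    rw [map_add, map_add] at h
    have : ∀ t, relForm k K (KaehlerDifferential.mapBaseChange k K F t) = 0 := fun t =>
      (KaehlerDifferential.exact_mapBaseChange_map k K F _).2 ⟨t, rfl⟩
    exact add_mem (hx (this x)) (hy (this y))
  | tmul f τ =>
    rw [KaehlerDifferential.mapBaseChange_tmul]
    exact Submodule.smul_mem _ _ (pullForm_mem_baseForms τ)

theorem relForm_eq_zero_of_mem {ω : Ω[F⁄k]} (h : ω ∈ baseForms k K F) : relForm k K ω = 0 := by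
  induction h using Submodule.span_induction with
  | mem x hx => obtain ⟨a, rfl⟩ := hx; rw [relForm_D, Derivation.map_algebraMap]
  | zero => exact map_zero _
  | add x y _ _ hx hy => rw [map_add, hx, hy, add_zero]
  | smul a x _ hx => rw [map_smul, hx, smul_zero]

theorem relForm_pullForm (τ : Ω[K⁄k]) : relForm (F := F) k K (pullForm k τ) = 0 :=
  relForm_eq_zero_of_mem (pullForm_mem_baseForms τ)

/-- As `F` is separable over `K`, every derivation of `K` extends to `F`. -/
theorem exists_derivation_extending [CharZero K] [Algebra.EssFiniteType K F]
    (φ : Ω[K⁄k] →ₗ[K] K) : ∃ E : Derivation k F F, ∀ a : K,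
      E (algebraMap K F a) = algebraMap K F (φ (KaehlerDifferential.D k K a)) := by
  have : Algebra.FormallySmooth K F := inferInstance
  -- formal smoothness makes `F ⊗ Ω¹_K → Ω¹_F` injective, and over a field an injection splits
  have hinj : Function.Injective (KaehlerDifferential.mapBaseChange k K F) := by
    rw [← LinearMap.ker_eq_bot, LinearMap.ker_eq_bot']
    intro t ht
    obtain ⟨x, rfl⟩ := (Algebra.H1Cotangent.exact_δ_mapBaseChange k K F t).1 ht
    have := Algebra.FormallySmooth.subsingleton_h1Cotangent (R := K) (A := F)
    rw [Subsingleton.elim x 0, map_zero]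
  obtain ⟨l, hl⟩ := LinearMap.exists_leftInverse_of_injective
    (KaehlerDifferential.mapBaseChange k K F) (LinearMap.ker_eq_bot.2 hinj)
  let ψ : F ⊗[K] Ω[K⁄k] →ₗ[F] F :=
    (TensorProduct.isBaseChange K Ω[K⁄k] F).lift ((Algebra.linearMap K F).comp φ)
  refine ⟨(ψ.comp l).compDer (KaehlerDifferential.D k F), fun a => ?_⟩
  have h1 : KaehlerDifferential.D k F (algebraMap K F a) =
      KaehlerDifferential.mapBaseChange k K F (1 ⊗ₜ KaehlerDifferential.D k K a) := by
    rw [KaehlerDifferential.mapBaseChange_tmul, one_smul, KaehlerDifferential.map_D]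
  change ψ (l (KaehlerDifferential.D k F (algebraMap K F a))) = _
  rw [h1, ← LinearMap.comp_apply l, hl, LinearMap.id_apply]
  exact IsBaseChange.lift_eq _ _ _

variable (K) in
/-- The contraction of absolute `2`-forms with a derivation `E` of the function field, followed by
the projection to relative forms: `α ∧ β ↦ E(α) β - E(β) α`. -/
def contraction (E : Derivation k F F) : ⋀[F]^2 Ω[F⁄k] →ₗ[F] Ω[F⁄K] :=
  exteriorPower.alternatingMapLinearEquiv
    { toFun := fun v => E.liftKaehlerDifferential (v 0) • relForm k K (v 1) -
        E.liftKaehlerDifferential (v 1) • relForm k K (v 0)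
      map_update_add' := fun v i x y => by
        fin_cases i <;> simp <;> module
      map_update_smul' := fun v i c x => by
        fin_cases i <;> simp <;> module
      map_eq_zero_of_eq' := fun v i j h hij => by
        have : v 0 = v 1 := by fin_cases i <;> fin_cases j <;> simp_all
        rw [this, sub_self] }

theorem contraction_wedge (E : Derivation k F F) (α β : Ω[F⁄k]) :
    contraction K E (wedge k α β) = E.liftKaehlerDifferential α • relForm k K β -
        E.liftKaehlerDifferential β • relForm k K α := by
  rw [wedge_apply, contraction]
  exact DFunLike.congr_fun (exteriorPower.alternatingMapLinearEquiv_comp_ιMulti _) ![α, β]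

theorem contraction_of_mem_baseForms₂ (E : Derivation k F F) {η : ⋀[F]^2 Ω[F⁄k]}
    (h : η ∈ baseForms₂ k K F) : contraction K E η = 0 := by
  induction h using Submodule.span_induction with
  | mem x hx =>
    obtain ⟨τ, -, τ', -, rfl⟩ := hx
    simp [contraction_wedge, relForm_pullForm]
  | zero => exact map_zero _
  | add x y _ _ hx hy => rw [map_add, hx, hy, add_zero]
  | smul a x _ hx => rw [map_smul, hx, smul_zero]

theorem liftKaehlerDifferential_pullForm {E : Derivation k F F} {φ : Ω[K⁄k] →ₗ[K] K}
    (hE : ∀ a : K, E (algebraMap K F a) = algebraMap K F (φ (KaehlerDifferential.D k K a)))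
    (τ : Ω[K⁄k]) : E.liftKaehlerDifferential (pullForm k τ) = algebraMap K F (φ τ) := by
  have hτ : τ ∈ Submodule.span K (Set.range (KaehlerDifferential.D k K)) := by
    rw [KaehlerDifferential.span_range_derivation]; trivial
  induction hτ using Submodule.span_induction with
  | mem x hx =>
    obtain ⟨a, rfl⟩ := hx
    rw [pullForm_D, Derivation.liftKaehlerDifferential_comp_D, hE]
  | zero => simp
  | add x y _ _ hx hy => simp only [map_add, hx, hy]
  | smul a x _ hx =>
    rw [map_smul, ← algebraMap_smul F a, map_smul, hx, map_smul, smul_eq_mul, smul_eq_mul, map_mul]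

/-- A case of Cartan's formula. -/
theorem contraction_extDeriv_of_mem_baseForms {E : Derivation k F F} {φ : Ω[K⁄k] →ₗ[K] K}
    (hE : ∀ a : K, E (algebraMap K F a) = algebraMap K F (φ (KaehlerDifferential.D k K a)))
    {ω : Ω[F⁄k]} (h : ω ∈ baseForms k K F) : contraction K E (extDeriv k ω) =
      -KaehlerDifferential.D K F (E.liftKaehlerDifferential ω) := by
  suffices H : ∀ c : F, contraction K E (extDeriv k (c • ω)) =
      -KaehlerDifferential.D K F (E.liftKaehlerDifferential (c • ω)) by simpa using H 1
  induction h using Submodule.span_induction with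
  | mem x hx =>
    intro c
    obtain ⟨a, rfl⟩ := hx
    rw [extDeriv_smul_D, contraction_wedge, relForm_D, relForm_D, Derivation.map_algebraMap,
      smul_zero, zero_sub, map_smul, Derivation.liftKaehlerDifferential_comp_D, hE, smul_eq_mul,
      Derivation.leibniz, Derivation.map_algebraMap, smul_zero, zero_add]
  | zero => intro c; simp
  | add x y _ _ hx hy =>
    intro c
    rw [smul_add, map_add, map_add, map_add, map_add, hx, hy, neg_add]
  | smul a x _ hx => intro c; rw [smul_smul]; exact hx _

/-- The case of Cartan's formula complementary to `contraction_extDeriv_of_mem_baseForms`. -/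
theorem contraction_extDeriv_smul_D (E : Derivation k F F) {z : F} (hz : E z = 0) (f : F) :
    contraction K E (extDeriv k (f • KaehlerDifferential.D k F z)) =
      E f • KaehlerDifferential.D K F z := by
  rw [extDeriv_smul_D, contraction_wedge, relForm_D, relForm_D,
    Derivation.liftKaehlerDifferential_comp_D, Derivation.liftKaehlerDifferential_comp_D, hz,
    zero_smul, sub_zero]

end Contraction

section Adapted

variable {k : Type v} {K : Type u} {F : Type w} [Field k] [Field K] [Field F] [Algebra k K]
  [Algebra k F] [Algebra K F] [IsScalarTower k K F] [CharZero K] {O : Subalgebra K F}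
  [IsLocalRing O]

theorem IsSmoothPoint.essFiniteType (hO : IsSmoothPoint O) : Algebra.EssFiniteType K F := by
  obtain ⟨b, h⟩ := hO.generated
  have := CurvePairing.GeneratedBy.essFiniteType h
  have := hO.isFractionRing
  have := Algebra.EssFiniteType.of_isLocalization F (nonZeroDivisors O)
  exact Algebra.EssFiniteType.comp K O F

/-- A derivation of the function field that extends a given derivation of the base field, kills a
uniformizer `z`, and preserves the local ring. -/
structure IsAdapted (O : Subalgebra K F) (z : F) (φ : Ω[K⁄k] →ₗ[K] K) (E : Derivation k F F) :
    Prop where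
  extends_base : ∀ a : K,
    E (algebraMap K F a) = algebraMap K F (φ (KaehlerDifferential.D k K a))
  uniformizer : E z = 0
  mem : ∀ a ∈ O, E a ∈ O

/-- Every derivation of `K` lifts to an adapted one.  Any extension to `F` can be corrected by a
multiple of `d/dz` so as to kill `z`; that it then preserves the local ring is because the residue
field is separable over `K`. -/
theorem IsSmoothPoint.exists_isAdapted (hO : IsSmoothPoint O) {z : O}
    (hz : maximalIdeal O = Ideal.span {z}) (φ : Ω[K⁄k] →ₗ[K] K) :
    ∃ E : Derivation k F F, IsAdapted O (z : F) φ E := by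
  have := hO.essFiniteType
  obtain ⟨d, hd, hdO, hdf⟩ := hO.exists_derivation hz
  obtain ⟨E₀, hE₀⟩ := exists_derivation_extending (F := F) φ
  obtain ⟨E, hE, hEz⟩ : ∃ E : Derivation k F F, (∀ a : K,
      E (algebraMap K F a) = algebraMap K F (φ (KaehlerDifferential.D k K a))) ∧ E z = 0 := by
    refine ⟨E₀ - E₀ z • d.restrictScalars k, fun a => ?_, ?_⟩
    · change E₀ _ - E₀ z • d (algebraMap K F a) = _
      rw [d.map_algebraMap, smul_zero, sub_zero, hE₀]
    · change E₀ _ - E₀ z • d z = 0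
      rw [hd, smul_eq_mul, mul_one, sub_self]
  refine ⟨E, hE, hEz, ?_⟩
  have hKO : ∀ a : K, E (algebraMap K F a) ∈ O := fun a => hE a ▸ Subalgebra.algebraMap_mem _ _
  -- the poles of the values of `E` on the local ring are bounded
  obtain ⟨N, hN⟩ : ∃ N : ℕ, ∀ a ∈ O, (z : F) ^ N * E a ∈ O := by
    obtain ⟨b, hb⟩ := hO.generated
    choose n hn using fun f : F => hO.exists_pow_mul_mem hz (E f)
    let S : Submodule O Ω[F⁄k] :=
      { carrier := {ω | (z : F) ^ (b.sup n) * E.liftKaehlerDifferential ω ∈ O}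
        zero_mem' := by simp
        add_mem' := fun {x y} hx hy => by
          simp only [Set.mem_setOf_eq] at hx hy ⊢
          rw [map_add, mul_add]; exact add_mem hx hy
        smul_mem' := fun c x hx => by
          simp only [Set.mem_setOf_eq] at hx ⊢
          rw [show c • x = (c : F) • x from rfl, map_smul, smul_eq_mul, mul_left_comm]
          exact mul_mem c.2 hx }
    refine ⟨b.sup n, fun a ha => ?_⟩
    have : KaehlerDifferential.D k F a ∈ S := by
      refine hb.D_mem (fun c => ?_) (fun y hy => ?_) ha
      · change _ * E.liftKaehlerDifferential _ ∈ O
        rw [Derivation.liftKaehlerDifferential_comp_D]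
        exact mul_mem (pow_mem z.2 _) (hKO c)
      · change _ * E.liftKaehlerDifferential _ ∈ O
        rw [Derivation.liftKaehlerDifferential_comp_D]
        exact mem_of_pow_mul_mem z.2 (Finset.le_sup hy) (hn y)
    have h2 : (z : F) ^ (b.sup n) * E.liftKaehlerDifferential (KaehlerDifferential.D k F a) ∈ O :=
      this
    rwa [Derivation.liftKaehlerDifferential_comp_D] at h2
  -- and there are none, by the separable equations of the residue classes
  induction N with
  | zero => simpa using hN
  | succ N ih =>
    refine ih fun a ha => ?_
    obtain ⟨p, hp, hp'⟩ := hO.exists_separable ⟨a, ha⟩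
    rw [hz, Ideal.mem_span_singleton] at hp
    obtain ⟨q, hq⟩ := hp
    obtain ⟨c, hc⟩ := hp'.exists_left_inv
    have hcoe : ∀ r : Polynomial K, ((Polynomial.aeval (⟨a, ha⟩ : O) r : O) : F) =
        Polynomial.aeval a r := fun r => by
      simpa using (Polynomial.aeval_algebraMap_apply F (⟨a, ha⟩ : O) r).symm
    have hEp : ∀ r : Polynomial K, ∃ P ∈ O, E (Polynomial.aeval a r) =
        P + Polynomial.aeval a (Polynomial.derivative r) * E a := fun r => by
      induction r using Polynomial.induction_on' with
      | add r s hr hs =>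
        obtain ⟨P, hP, hP'⟩ := hr
        obtain ⟨Q, hQ, hQ'⟩ := hs
        exact ⟨P + Q, add_mem hP hQ, by rw [map_add, map_add, hP', hQ', map_add, map_add]; ring⟩
      | monomial n c =>
        refine ⟨a ^ n * E (algebraMap K F c), mul_mem (pow_mem ha n) (hKO c), ?_⟩
        rw [Polynomial.derivative_monomial, Polynomial.aeval_monomial, Polynomial.aeval_monomial,
          E.leibniz, E.leibniz_pow, smul_eq_mul, smul_eq_mul, smul_eq_mul, nsmul_eq_mul, map_mul,
          map_natCast]
        ring
    obtain ⟨P, hP, hP'⟩ := hEp p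
    have e1 : Polynomial.aeval a p = (z : F) * q := by rw [← hcoe, hq]; rfl
    have e2 : (c : F) * Polynomial.aeval a (Polynomial.derivative p) = 1 := by
      rw [← hcoe]; exact congrArg Subtype.val hc
    rw [e1, E.leibniz, hEz, smul_zero, add_zero, smul_eq_mul] at hP'
    have e3 : (z : F) ^ N * E a = c * ((z : F) ^ (N + 1) * E q - (z : F) ^ N * P) := by
      rw [← one_mul (E a), ← e2, pow_succ]
      linear_combination (-(c : F) * z ^ N) * hP'
    rw [e3]
    exact mul_mem c.2 (sub_mem (hN _ q.2) (mul_mem (pow_mem z.2 _) hP))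

theorem contraction_mem_regularForms {E : Derivation k F F} (hE : ∀ a ∈ O, E a ∈ O)
    {η : ⋀[F]^2 Ω[F⁄k]} (h : η ∈ regularForms₂ O k) : contraction K E η ∈ regularForms O K := by
  induction h using Submodule.span_induction with
  | mem x hx =>
    obtain ⟨a, ha, b, hb, rfl⟩ := hx
    dsimp only
    rw [contraction_wedge, relForm_D, relForm_D, Derivation.liftKaehlerDifferential_comp_D,
      Derivation.liftKaehlerDifferential_comp_D]
    exact sub_mem (Submodule.smul_mem _ (⟨_, hE a ha⟩ : O) (D_mem_regularForms hb))
      (Submodule.smul_mem _ (⟨_, hE b hb⟩ : O) (D_mem_regularForms ha))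
  | zero => rw [map_zero]; exact zero_mem _
  | add x y _ _ hx hy => rw [map_add]; exact add_mem hx hy
  | smul a x _ hx =>
    rw [show a • x = (a : F) • x from rfl, map_smul]
    exact Submodule.smul_mem _ a hx

end Adapted

/-! ### Residues of absolute two-forms -/

section Residue₂

variable {k : Type v} {K : Type u} {F : Type w} [Field k] [Field K] [Field F] [Algebra k K]
  [Algebra k F] [Algebra K F] [IsScalarTower k K F] [CharZero K] {O : Subalgebra K F}
  [IsLocalRing O]

theorem HasResidue₂.add {η η' : ⋀[F]^2 Ω[F⁄k]} {ρ ρ' : Ω[K⁄k]} (h : HasResidue₂ O η ρ)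
    (h' : HasResidue₂ O η' ρ') : HasResidue₂ O (η + η') (ρ + ρ') := by
  obtain ⟨n, ω, τ, r, hr, hη, rfl⟩ := h
  obtain ⟨n', ω', τ', r', hr', hη', rfl⟩ := h'
  refine ⟨n + n', Fin.append ω ω', Fin.append τ τ', Fin.append r r', fun i => ?_, ?_, ?_⟩
  · refine Fin.addCases (fun i => ?_) (fun i => ?_) i
    · rw [Fin.append_left, Fin.append_left]; exact hr i
    · rw [Fin.append_right, Fin.append_right]; exact hr' i
  · rw [Fin.sum_univ_add]
    simp only [Fin.append_left, Fin.append_right]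
    convert add_mem hη hη' using 1
    abel
  · rw [Fin.sum_univ_add]
    simp only [Fin.append_left, Fin.append_right]

theorem HasResidue₂.neg {η : ⋀[F]^2 Ω[F⁄k]} {ρ : Ω[K⁄k]} (h : HasResidue₂ O η ρ) :
    HasResidue₂ O (-η) (-ρ) := by
  obtain ⟨n, ω, τ, r, hr, hη, rfl⟩ := h
  refine ⟨n, ω, fun i => -τ i, r, hr, ?_, by simp⟩
  convert neg_mem hη using 1
  simp only [map_neg, Finset.sum_neg_distrib]
  abel

theorem HasResidue₂.sub {η η' : ⋀[F]^2 Ω[F⁄k]} {ρ ρ' : Ω[K⁄k]} (h : HasResidue₂ O η ρ)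
    (h' : HasResidue₂ O η' ρ') : HasResidue₂ O (η - η') (ρ - ρ') := by
  simpa only [sub_eq_add_neg] using h.add h'.neg

theorem hasResidue₂_of_mem_baseForms₂ {η : ⋀[F]^2 Ω[F⁄k]} (h : η ∈ baseForms₂ k K F) :
    HasResidue₂ O η 0 :=
  ⟨0, Fin.elim0, Fin.elim0, Fin.elim0, fun i => i.elim0, by simpa using h, by simp⟩

theorem hasResidue₂_wedge {ω : Ω[F⁄k]} {r : K} (h : HasResidue O (relForm k K ω) r) (τ : Ω[K⁄k]) :
    HasResidue₂ O (wedge k ω (pullForm k τ)) (r • τ) :=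
  ⟨1, fun _ => ω, fun _ => τ, fun _ => r, fun _ => h, by simp, by simp⟩

/-- The residue of a `2`-form is determined by the residues of its contractions. -/
theorem HasResidue₂.contraction (hO : IsSmoothPoint O) {η : ⋀[F]^2 Ω[F⁄k]} {ρ : Ω[K⁄k]}
    (h : HasResidue₂ O η ρ) {E : Derivation k F F} {φ : Ω[K⁄k] →ₗ[K] K}
    (hE : ∀ a : K, E (algebraMap K F a) = algebraMap K F (φ (KaehlerDifferential.D k K a))) :
    HasResidue O (contraction K E η) (-φ ρ) := by
  obtain ⟨n, ω, τ, r, hr, hη, rfl⟩ := h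
  have h1 := contraction_of_mem_baseForms₂ E hη
  rw [map_sub, sub_eq_zero] at h1
  have h2 : CurvePairing.contraction K E η = ∑ i, -(φ (τ i)) • relForm k K (ω i) := by
    rw [h1, map_sum]
    refine Finset.sum_congr rfl fun i _ => ?_
    rw [contraction_wedge, relForm_pullForm, smul_zero, zero_sub,
      liftKaehlerDifferential_pullForm hE, algebraMap_smul, neg_smul]
  have h3 : -φ (∑ i, r i • τ i) = ∑ i, -(φ (τ i)) * r i := by
    rw [map_sum, ← Finset.sum_neg_distrib]
    refine Finset.sum_congr rfl fun i _ => ?_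
    rw [map_smul, smul_eq_mul]; ring
  rw [h2, h3]
  exact HasResidue.sum hO _ fun i => (hr i).smul _

/-- Enough contractions are available to determine a residue in `Ω¹_K`: every linear form on `Ω¹_K`
is induced by an adapted derivation. -/
theorem IsSmoothPoint.eq_of_contraction (hO : IsSmoothPoint O) {η : ⋀[F]^2 Ω[F⁄k]} {ρ ρ' : Ω[K⁄k]}
    (h : HasResidue₂ O η ρ) {z : O} (hz : maximalIdeal O = Ideal.span {z})
    (H : ∀ (φ : Ω[K⁄k] →ₗ[K] K) (E : Derivation k F F), IsAdapted O (z : F) φ E →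
      HasResidue O (contraction K E η) (-φ ρ')) : ρ = ρ' := by
  rw [← sub_eq_zero, ← Module.forall_dual_apply_eq_zero_iff K]
  intro φ
  obtain ⟨E, hE⟩ := hO.exists_isAdapted hz φ
  have := hO.hasResidue_unique (h.contraction hO hE.extends_base) (H φ E hE)
  rw [map_sub, neg_injective this, sub_self]

theorem IsSmoothPoint.hasResidue₂_unique (hO : IsSmoothPoint O) {η : ⋀[F]^2 Ω[F⁄k]}
    {ρ ρ' : Ω[K⁄k]} (h : HasResidue₂ O η ρ) (h' : HasResidue₂ O η ρ') : ρ = ρ' := by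
  obtain ⟨z, hz⟩ := hO.exists_uniformizer
  exact hO.eq_of_contraction h hz fun φ E hE => h'.contraction hO hE.extends_base

/-- An absolute form is the sum of a multiple of `dz` and a form from the base field. -/
theorem IsSmoothPoint.exists_sub_smul_D_mem (hO : IsSmoothPoint O) {z : O}
    (hz : maximalIdeal O = Ideal.span {z}) (ω : Ω[F⁄k]) :
    ∃ f : F, relForm k K ω = f • KaehlerDifferential.D K F (z : F) ∧
      ω - f • KaehlerDifferential.D k F (z : F) ∈ baseForms k K F := by
  obtain ⟨f, hf⟩ := hO.exists_smul_D hz (relForm k K ω)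
  refine ⟨f, hf, mem_baseForms_of_relForm_eq_zero ?_⟩
  rw [map_sub, map_smul, relForm_D, hf, sub_self]

theorem baseForms_eq_span : baseForms k K F =
    Submodule.span F (Set.range (pullForm (K := K) (F := F) k)) := by
  refine le_antisymm (Submodule.span_mono ?_) (Submodule.span_le.2 ?_)
  · rintro _ ⟨a, rfl⟩; exact ⟨_, pullForm_D a⟩
  · rintro _ ⟨τ, rfl⟩; exact pullForm_mem_baseForms τ

/-- Every absolute `2`-form has a residue: as `dz ∧ dz = 0`, it is a sum of products of a `1`-form
with a form from the base field. -/
theorem IsSmoothPoint.exists_hasResidue₂ (hO : IsSmoothPoint O) (η : ⋀[F]^2 Ω[F⁄k]) :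
    ∃ ρ, HasResidue₂ O η ρ := by
  obtain ⟨z, hz⟩ := hO.exists_uniformizer
  have hbase : ∀ (α β : Ω[F⁄k]), β ∈ baseForms k K F → ∃ ρ, HasResidue₂ O (wedge k α β) ρ := by
    intro α β hβ
    rw [baseForms_eq_span] at hβ
    suffices H : ∀ c : F, ∃ ρ, HasResidue₂ O (wedge k α (c • β)) ρ by simpa using H 1
    induction hβ using Submodule.span_induction with
    | mem y hy =>
      intro c
      obtain ⟨τ, rfl⟩ := hy
      obtain ⟨r, hr⟩ := hO.exists_hasResidue (relForm k K (c • α))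
      refine ⟨r • τ, ?_⟩
      rw [map_smul, ← LinearMap.smul_apply, ← map_smul]
      exact hasResidue₂_wedge hr τ
    | zero =>
      intro c
      refine ⟨0, hasResidue₂_of_mem_baseForms₂ ?_⟩
      rw [smul_zero, map_zero]; exact zero_mem _
    | add x y _ _ hx hy =>
      intro c
      obtain ⟨ρ, h⟩ := hx c
      obtain ⟨ρ', h'⟩ := hy c
      rw [smul_add, map_add]
      exact ⟨_, h.add h'⟩
    | smul a x _ hx => intro c; rw [smul_smul]; exact hx _
  have hwedge : ∀ α β : Ω[F⁄k], ∃ ρ, HasResidue₂ O (wedge k α β) ρ := by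
    intro α β
    obtain ⟨f, -, hf⟩ := hO.exists_sub_smul_D_mem (k := k) hz α
    obtain ⟨g, -, hg⟩ := hO.exists_sub_smul_D_mem (k := k) hz β
    obtain ⟨ρ, h⟩ := hbase α _ hg
    obtain ⟨ρ', h'⟩ := hbase (g • KaehlerDifferential.D k F (z : F)) _ hf
    refine ⟨ρ - ρ', ?_⟩
    convert h.sub h' using 1
    rw [wedge_swap k (g • _)]
    simp only [map_sub, map_smul, LinearMap.sub_apply, LinearMap.smul_apply, wedge_self]
    rw [wedge_swap k α]
    simp
  have hη : η ∈ Submodule.span F (Set.range (exteriorPower.ιMulti F 2 (M := Ω[F⁄k]))) := by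
    rw [exteriorPower.ιMulti_span]; trivial
  suffices H : ∀ c : F, ∃ ρ, HasResidue₂ O (c • η) ρ by simpa using H 1
  induction hη using Submodule.span_induction with
  | mem y hy =>
    intro c
    obtain ⟨v, rfl⟩ := hy
    have : v = ![v 0, v 1] := by ext i; fin_cases i <;> rfl
    rw [this, ← wedge_apply, ← LinearMap.smul_apply, ← map_smul]
    exact hwedge _ _
  | zero =>
    intro c
    refine ⟨0, hasResidue₂_of_mem_baseForms₂ ?_⟩
    rw [smul_zero]; exact zero_mem _
  | add x y _ _ hx hy =>
    intro c
    obtain ⟨ρ, h⟩ := hx c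
    obtain ⟨ρ', h'⟩ := hy c
    rw [smul_add]
    exact ⟨_, h.add h'⟩
  | smul a x _ hx => intro c; rw [smul_smul]; exact hx _

/-- A `2`-form has the residue `ρ` if its contractions have the corresponding residues. -/
theorem IsSmoothPoint.hasResidue₂_of_contraction (hO : IsSmoothPoint O) {η : ⋀[F]^2 Ω[F⁄k]}
    {ρ : Ω[K⁄k]} {z : O} (hz : maximalIdeal O = Ideal.span {z})
    (H : ∀ (φ : Ω[K⁄k] →ₗ[K] K) (E : Derivation k F F), IsAdapted O (z : F) φ E →
      HasResidue O (CurvePairing.contraction K E η) (-φ ρ)) : HasResidue₂ O η ρ := by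
  obtain ⟨ρ', h⟩ := hO.exists_hasResidue₂ η
  rwa [← hO.eq_of_contraction h hz H]

theorem IsSmoothPoint.hasResidue₂_of_mem (hO : IsSmoothPoint O) {η : ⋀[F]^2 Ω[F⁄k]}
    (h : η ∈ regularForms₂ O k) : HasResidue₂ O η 0 := by
  obtain ⟨z, hz⟩ := hO.exists_uniformizer
  refine hO.hasResidue₂_of_contraction hz fun φ E hE => ?_
  rw [map_zero, neg_zero]
  exact hasResidue_of_mem hO (contraction_mem_regularForms hE.mem h)

/-- The residue of `dlog u ∧ dlog z` is, up to sign, the logarithmic differential of the norm of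
the value of `u` at the point. -/
theorem IsSmoothPoint.hasResidue₂_dlog_unit (hO : IsSmoothPoint O) {z : O}
    (hz : maximalIdeal O = Ideal.span {z}) {a b : Additive Fˣ} (ha : a ∈ unitStalk O)
    (hb : (b.toMul : F) = z) :
    ∃ ρ ∈ (dlog k K).range, HasResidue₂ O (wedge k (dlog k F a) (dlog k F b)) ρ := by
  have := hO.finite
  let u : Oˣ := ⟨⟨_, ha.1⟩, ⟨_, ha.2⟩, Subtype.ext (by simp), Subtype.ext (by simp)⟩
  have hu : ((u : O) : F) = (a.toMul : F) := rfl
  have hres : residue O (u : O) ≠ 0 := fun h => (residue_ne_zero_iff_isUnit _).2 u.isUnit h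
  have hN : Algebra.norm K (residue O (u : O)) ≠ 0 := Algebra.norm_ne_zero_iff.2 hres
  refine ⟨dlog k K (-Additive.ofMul (Units.mk0 _ hN)), ⟨_, rfl⟩, ?_⟩
  refine hO.hasResidue₂_of_contraction hz fun φ E hE => ?_
  -- the derivation that `E` induces on the residue field
  let EO : Derivation k O O := Derivation.mk'
    { toFun := fun a => ⟨E a, hE.mem a a.2⟩
      map_add' := fun a b => Subtype.ext (map_add E _ _)
      map_smul' := fun c a => Subtype.ext (E.map_smul c _) }
    fun a b => Subtype.ext (E.leibniz _ _)
  have hEm : ∀ a ∈ maximalIdeal O, EO a ∈ maximalIdeal O := fun a ha => by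
    rw [hz, Ideal.mem_span_singleton] at ha
    obtain ⟨q, rfl⟩ := ha
    have h1 : EO z = 0 := Subtype.ext hE.uniformizer
    rw [EO.leibniz, h1, smul_zero, add_zero]
    exact Ideal.mul_mem_right _ _ (hz ▸ Ideal.mem_span_singleton_self z)
  choose l hl using residue_surjective (R := O)
  have hEr : ∀ a b : O, residue O a = residue O b → residue O (EO a) = residue O (EO b) :=
    fun a b h => by
      rw [← sub_eq_zero, ← map_sub, residue_eq_zero_iff] at h ⊢
      rw [← map_sub]; exact hEm _ h
  let Eκ : Derivation ℤ (ResidueField O) (ResidueField O) := Derivation.mk'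
    (AddMonoidHom.mk' (fun a => residue O (EO (l a))) (fun a b => by
      rw [← map_add, ← map_add]; exact hEr _ _ (by rw [map_add, hl, hl, hl]))).toIntLinearMap
    fun a b => by
      change residue O (EO (l (a * b))) = a * residue O (EO (l b)) + b * residue O (EO (l a))
      rw [hEr (l (a * b)) (l a * l b) (by rw [map_mul, hl, hl, hl]), EO.leibniz, map_add,
        smul_eq_mul, smul_eq_mul, map_mul, map_mul, hl, hl]
  have hEκ : ∀ a, Eκ (residue O a) = residue O (EO a) := fun a => hEr _ _ (hl _)
  let δ : Derivation ℤ K K := (φ.compDer (KaehlerDifferential.D k K)).restrictScalars ℤ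
  have hδ : ∀ a, δ a = φ (KaehlerDifferential.D k K a) := fun a => rfl
  have hκ : ∀ a : K, Eκ (algebraMap K (ResidueField O) a) = algebraMap K _ (δ a) := fun a => by
    rw [IsScalarTower.algebraMap_apply K O (ResidueField O), ResidueField.algebraMap_eq, hEκ,
      IsScalarTower.algebraMap_apply K O (ResidueField O), ResidueField.algebraMap_eq]
    congr 1
    exact Subtype.ext (hE.extends_base a)
  have hnorm := derivation_norm Eκ δ hκ hres
  have hb0 : (z : F) ≠ 0 := hO.ne_zero hz
  have hφ : -φ (dlog k K (-Additive.ofMul (Units.mk0 _ hN))) =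
      Algebra.trace K (ResidueField O) (residue O ((u⁻¹ : Oˣ) * EO u)) := by
    rw [map_neg, map_neg, neg_neg, dlog_apply, map_smul, ← hδ]
    change (Algebra.norm K (residue O (u : O)))⁻¹ * δ (Algebra.norm K (residue O (u : O))) = _
    have hinv : (residue O (u : O))⁻¹ = residue O ((u⁻¹ : Oˣ) : O) := by
      rw [inv_eq_iff_eq_inv]
      refine eq_inv_of_mul_eq_one_left ?_
      rw [← map_mul, Units.mul_inv, map_one]
    rw [hnorm, inv_mul_cancel_left₀ hN]
    refine congrArg (Algebra.trace K (ResidueField O)) ?_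
    exact (congrArg₂ _ hinv (hEκ _)).trans (map_mul (residue O) _ _).symm
  rw [hφ, contraction_wedge, dlog_apply, dlog_apply, map_smul, map_smul, map_smul, map_smul,
    relForm_D, relForm_D, Derivation.liftKaehlerDifferential_comp_D,
    Derivation.liftKaehlerDifferential_comp_D, hb, hE.uniformizer, smul_zero, zero_smul, sub_zero]
  refine (hO.hasResidue_iff hz).2 ⟨(u⁻¹ : Oˣ) * EO u, 0, ?_, rfl⟩
  have h1 : ((b.toMul⁻¹ : Fˣ) : F) = (z : F)⁻¹ := by rw [Units.val_inv_eq_inv_val, hb]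
  have h2 : ((((u⁻¹ : Oˣ) : O) * EO u : O) : F) = ((a.toMul⁻¹ : Fˣ) : F) • E (a.toMul : F) := rfl
  rw [h1, h2, map_zero, sub_zero, smul_smul, sub_self]
  exact zero_mem _

theorem IsSmoothPoint.exists_eq_unit_add (hO : IsSmoothPoint O) {z : O}
    (hz : maximalIdeal O = Ideal.span {z}) {ζ : Additive Fˣ} (hζ : (ζ.toMul : F) = z)
    (a : Additive Fˣ) : ∃ (n : ℤ), ∃ b ∈ unitStalk O, a = b + n • ζ := by
  obtain ⟨n, u, h⟩ := hO.exists_eq_mul_zpow hz (f := (a.toMul : F)) a.toMul.ne_zero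
  refine ⟨n, a - n • ζ, ?_, by abel⟩
  have h1 : ((a - n • ζ).toMul : F) = (u : O) := by
    rw [toMul_sub, toMul_zsmul, Units.val_div_eq_div_val, Units.val_zpow_eq_zpow_val, hζ, h,
      mul_div_cancel_right₀ _ (zpow_ne_zero _ (hO.ne_zero hz))]
  refine ⟨h1 ▸ u.1.2, ?_⟩
  rw [Units.val_inv_eq_inv_val, h1, ← coe_inv_unit]
  exact (u⁻¹ : Oˣ).1.2

/-- The residue of a form in the image of `K₂` is a logarithmic differential. -/
theorem IsSmoothPoint.hasResidue₂_dlog₂ (hO : IsSmoothPoint O) (s : MilnorK₂ F) :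
    ∃ ρ ∈ (dlog k K).range, HasResidue₂ O (dlog₂ k F s) ρ := by
  obtain ⟨z, hz⟩ := hO.exists_uniformizer
  let ζ : Additive Fˣ := Additive.ofMul (Units.mk0 _ (hO.ne_zero hz))
  have hζ : (ζ.toMul : F) = z := rfl
  let S : AddSubgroup (⋀[F]^2 Ω[F⁄k]) :=
    { carrier := {η | ∃ ρ ∈ (dlog k K).range, HasResidue₂ O η ρ}
      zero_mem' := ⟨0, zero_mem _, hasResidue₂_of_mem_baseForms₂ (zero_mem _)⟩
      add_mem' := fun ⟨ρ, h, h'⟩ ⟨σ, g, g'⟩ => ⟨_, add_mem h g, h'.add g'⟩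
      neg_mem' := fun ⟨ρ, h, h'⟩ => ⟨_, neg_mem h, h'.neg⟩ }
  change dlog₂ k F s ∈ S
  obtain ⟨t, rfl⟩ := QuotientAddGroup.mk'_surjective _ s
  change dlogTensor k F t ∈ S
  induction t with
  | zero => rw [map_zero]; exact zero_mem _
  | add x y hx hy => rw [map_add]; exact add_mem hx hy
  | tmul a b =>
    obtain ⟨n, a, ha, rfl⟩ := hO.exists_eq_unit_add hz hζ a
    obtain ⟨m, b, hb, rfl⟩ := hO.exists_eq_unit_add hz hζ b
    have h1 : wedge k (dlog k F a) (dlog k F b) ∈ S :=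
      ⟨0, zero_mem _, hO.hasResidue₂_of_mem (wedge_dlog_dlog O ha hb)⟩
    have h2 : ∀ a ∈ unitStalk O, wedge k (dlog k F a) (dlog k F ζ) ∈ S := fun a ha =>
      hO.hasResidue₂_dlog_unit hz ha hζ
    have h3 : wedge k (dlog k F ζ) (dlog k F b) ∈ S := by
      rw [wedge_swap]; exact neg_mem (h2 b hb)
    have e : dlogTensor k F ((a + n • ζ) ⊗ₜ (b + m • ζ)) = wedge k (dlog k F a) (dlog k F b) +
        m • wedge k (dlog k F a) (dlog k F ζ) + n • wedge k (dlog k F ζ) (dlog k F b) := by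
      rw [dlogTensor_tmul]
      simp only [map_add, map_zsmul, LinearMap.add_apply, LinearMap.smul_apply, wedge_self,
        smul_zero, add_zero]
      abel
    rw [e]
    exact add_mem (add_mem h1 (zsmul_mem (h2 a ha) _)) (zsmul_mem h3 _)

end Residue₂

/-! ### The trace -/

section Global

variable {k : Type v} {K : Type u} {F : Type w} [Field k] [Field K] [Field F] [Algebra k K]
  [Algebra k F] [Algebra K F] [IsScalarTower k K F] [CharZero K]
  {X : Type u} [TopologicalSpace X] {O : X → Subalgebra K F} [∀ x, IsLocalRing (O x)] {η : X}

theorem IsSmoothCurve.finite_not_mem_regularForms {R : Type*} [Field R] [Algebra R F]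
    (hC : IsSmoothCurve O η) (ω : Ω[F⁄R]) : {x | ω ∉ regularForms (O x) R}.Finite := by
  have hω : ω ∈ Submodule.span F (Set.range (KaehlerDifferential.D R F)) := by
    rw [KaehlerDifferential.span_range_derivation]; trivial
  induction hω using Submodule.span_induction with
  | mem y hy =>
    obtain ⟨f, rfl⟩ := hy
    exact (hC.finite_poles f).subset fun x hx hf => hx (D_mem_regularForms hf)
  | zero => simp
  | add a b _ _ ha hb =>
    refine (ha.union hb).subset fun x hx => ?_
    by_contra h
    simp only [Set.mem_union, Set.mem_setOf_eq, not_or, not_not] at h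
    exact hx (add_mem h.1 h.2)
  | smul c a _ ha =>
    refine (ha.union (hC.finite_poles c)).subset fun x hx => ?_
    by_contra h
    simp only [Set.mem_union, Set.mem_setOf_eq, not_or, not_not] at h
    exact hx (Submodule.smul_mem _ (⟨c, h.2⟩ : O x) h.1)

theorem IsSmoothCurve.exists_D_ne_zero (hC : IsSmoothCurve O η) :
    ∃ t : F, KaehlerDifferential.D K F t ≠ 0 := by
  by_contra! h
  have h1 : (⊤ : Submodule F Ω[F⁄K]) = ⊥ := by
    rw [← KaehlerDifferential.span_range_derivation, Submodule.span_eq_bot]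
    rintro _ ⟨t, rfl⟩; exact h t
  have : Subsingleton Ω[F⁄K] :=
    (Submodule.subsingleton_iff F).1 (subsingleton_of_bot_eq_top h1.symm)
  have h2 := hC.finrank_eq_one
  rw [Module.finrank_zero_of_subsingleton] at h2
  exact zero_ne_one h2

/-- The generic point is not closed: otherwise it would be the only point, and every rational
function would be integral over `K`. -/
theorem IsSmoothCurve.ne_of_isClosed (hC : IsSmoothCurve O η) {x : X}
    (hx : IsClosed ({x} : Set X)) : x ≠ η := by
  rintro rfl
  have h1 : ∀ y, y = x := fun y => by
    by_contra hy
    exact hC.generic_mem ⟨{x}ᶜ, hx.isOpen_compl⟩ ⟨y, hy⟩ rfl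
  obtain ⟨t, ht⟩ := hC.exists_D_ne_zero
  have := (hC.isIntegral_iff (A := K) t).2 fun y hy => (hy (h1 y)).elim
  exact transcendental_of_D_ne_zero ht this.isAlgebraic

/-- The residue of absolute `2`-forms, as a homomorphism. -/
def IsSmoothPoint.residue₂ (k : Type v) [Field k] [Algebra k K] [Algebra k F]
    [IsScalarTower k K F] {O : Subalgebra K F} [IsLocalRing O] (hO : IsSmoothPoint O) :
    ⋀[F]^2 Ω[F⁄k] →+ Ω[K⁄k] :=
  AddMonoidHom.mk' (fun η => (hO.exists_hasResidue₂ η).choose) fun η η' =>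
    hO.hasResidue₂_unique (hO.exists_hasResidue₂ _).choose_spec
      ((hO.exists_hasResidue₂ η).choose_spec.add (hO.exists_hasResidue₂ η').choose_spec)

open Classical in
/-- The residue of absolute `2`-forms at the point `x` of a curve; it is zero by convention at the
generic point. -/
def IsSmoothCurve.res (k : Type v) [Field k] [Algebra k K] [Algebra k F] [IsScalarTower k K F]
    (hC : IsSmoothCurve O η) (x : X) : ⋀[F]^2 Ω[F⁄k] →+ Ω[K⁄k] :=
  if h : x = η then 0 else (hC.point x h).residue₂ k

theorem IsSmoothCurve.hasResidue₂_res (hC : IsSmoothCurve O η) {x : X} (hx : x ≠ η)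
    (Γ : ⋀[F]^2 Ω[F⁄k]) : HasResidue₂ (O x) Γ (hC.res k x Γ) := by
  rw [IsSmoothCurve.res, dif_neg hx]
  exact ((hC.point x hx).exists_hasResidue₂ Γ).choose_spec

theorem IsSmoothCurve.res_eq (hC : IsSmoothCurve O η) {x : X} (hx : x ≠ η) {Γ : ⋀[F]^2 Ω[F⁄k]}
    {ρ : Ω[K⁄k]} (h : HasResidue₂ (O x) Γ ρ) : hC.res k x Γ = ρ :=
  (hC.point x hx).hasResidue₂_unique (hC.hasResidue₂_res hx Γ) h

theorem IsSmoothCurve.res_of_mem (hC : IsSmoothCurve O η) {x : X} {Γ : ⋀[F]^2 Ω[F⁄k]}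
    (h : Γ ∈ regularForms₂ (O x) k) : hC.res k x Γ = 0 := by
  by_cases hx : x = η
  · rw [IsSmoothCurve.res, dif_pos hx]; rfl
  · exact hC.res_eq hx ((hC.point x hx).hasResidue₂_of_mem h)

theorem IsSmoothCurve.res_dlog₂ (hC : IsSmoothCurve O η) (x : X) (s : MilnorK₂ F) :
    hC.res k x (dlog₂ k F s) ∈ (dlog k K).range := by
  by_cases hx : x = η
  · rw [IsSmoothCurve.res, dif_pos hx]; exact zero_mem _
  · obtain ⟨ρ, hρ, h⟩ := (hC.point x hx).hasResidue₂_dlog₂ (k := k) s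
    rwa [hC.res_eq (k := k) hx h]

/-- The residue theorem for absolute `2`-forms.  It follows from the residue theorem for the
contractions with derivations extending derivations of `K`.  Such a derivation need not preserve all
local rings, so that the contraction may acquire poles at further points. -/
theorem IsSmoothCurve.sum_res_eq_zero (hC : IsSmoothCurve O η) {Γ : ⋀[F]^2 Ω[F⁄k]} (S : Finset X)
    (hS : η ∉ S) (hreg : ∀ x ∉ S, x ≠ η → Γ ∈ regularForms₂ (O x) k) :
    ∑ x ∈ S, hC.res k x Γ = 0 := by
  classical
  rw [← Module.forall_dual_apply_eq_zero_iff K]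
  intro φ
  have := hC.essFiniteType
  obtain ⟨E, hE⟩ := exists_derivation_extending (F := F) φ
  have hfin := hC.finite_not_mem_regularForms (contraction K E Γ)
  set T : Finset X := (S ∪ hfin.toFinset).erase η with hT
  have hne : ∀ x ∈ T, x ≠ η := fun x hx => Finset.ne_of_mem_erase hx
  have hST : S ⊆ T := fun x hx => Finset.mem_erase.2 ⟨fun h => hS (h ▸ hx),
    Finset.mem_union_left _ hx⟩
  have h0 : ∑ x ∈ T, -φ (hC.res k x Γ) = 0 := by
    refine hC.sum_residue_eq_zero (ω := contraction K E Γ) T (Finset.notMem_erase _ _) ?_ _ ?_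
    · intro x hx hxη
      by_contra h
      exact hx (Finset.mem_erase.2 ⟨hxη, Finset.mem_union_right _ (hfin.mem_toFinset.2 h)⟩)
    · intro x hx
      exact (hC.hasResidue₂_res (hne x hx) Γ).contraction (hC.point x (hne x hx)) hE
  rw [Finset.sum_neg_distrib, neg_eq_zero, ← map_sum] at h0
  rw [← h0]
  congr 1
  -- at the additional points the contraction has residue zero, because `Γ` has
  refine Finset.sum_subset hST fun x hx hxS => ?_
  exact hC.res_of_mem (hreg x hxS (hne x hx))

theorem dlog₂_mem_regularForms₂ {O : Subalgebra K F} {s : MilnorK₂ F} (hs : s ∈ k₂Stalk O) :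
    dlog₂ k F s ∈ regularForms₂ O k := by
  induction hs using AddSubgroup.closure_induction with
  | mem x hx =>
    obtain ⟨a, ha, b, hb, rfl⟩ := hx
    exact wedge_dlog_dlog O ha hb
  | zero => rw [map_zero]; exact zero_mem _
  | add x y _ _ hx hy => rw [map_add]; exact add_mem hx hy
  | neg x _ hx => rw [map_neg]; exact neg_mem hx

/-- The definition of the trace in terms of the residue homomorphisms. -/
theorem IsSmoothCurve.isTrace_iff (hC : IsSmoothCurve O η) {z : H2 O k} {α : DlogQuotient k K} :
    IsTrace O z α ↔ ∃ c : Z2 O k, H2.mk O k c = z ∧ c.1.1 = 0 ∧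
      ∃ (γ : X → ⋀[F]^2 Ω[F⁄k]) (S : Finset X), (∀ x y, c.1.2 x y = γ y - γ x) ∧ η ∉ S ∧
        (∀ x ∉ S, γ x ∈ regularForms₂ (O x) k) ∧
        QuotientAddGroup.mk (∑ x ∈ S, hC.res k x (γ x)) = α := by
  constructor
  · rintro ⟨c, hc, hc0, a, ⟨γ, hγ, S, ρ, h1, h2, rfl⟩, rfl⟩
    refine ⟨c, hc, hc0, γ, S, hγ, fun h => hC.ne_of_isClosed (h2 η h).1 rfl, h1, ?_⟩
    congr 1
    exact Finset.sum_congr rfl fun x hx => hC.res_eq (hC.ne_of_isClosed (h2 x hx).1) (h2 x hx).2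
  · rintro ⟨c, hc, hc0, γ, S, hγ, hS, h1, rfl⟩
    have hne : ∀ x ∈ S, x ≠ η := fun x hx h => hS (h ▸ hx)
    exact ⟨c, hc, hc0, _, ⟨γ, hγ, S, fun x => hC.res k x (γ x), h1, fun x hx =>
      ⟨hC.isClosed x (hne x hx), hC.hasResidue₂_res (hne x hx) _⟩, rfl⟩, rfl⟩

/-- The trace is well defined: this is where the residue theorem and the computation of the
residues of the image of `K₂` enter. -/
theorem IsSmoothCurve.isTrace_unique (hC : IsSmoothCurve O η) {z : H2 O k}
    {α α' : DlogQuotient k K} (h : IsTrace O z α) (h' : IsTrace O z α') : α = α' := by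
  classical
  obtain ⟨c, rfl, hc0, γ, S, hγ, hS, hreg, rfl⟩ := hC.isTrace_iff.1 h
  obtain ⟨c', hcc', hc0', γ', S', hγ', hS', hreg', rfl⟩ := hC.isTrace_iff.1 h'
  obtain ⟨β, ⟨W, hW, hβ⟩, g, ⟨W', hW', hg⟩, -, hd⟩ := QuotientAddGroup.eq.1 hcc'.symm
  have hd' : ∀ x y, c'.1.2 x y - c.1.2 x y = dlog₂ k F (β x y) + (g y - g x) := fun x y => by
    rw [← hd x y]
    change _ = -(c.1.2 x y) + c'.1.2 x y
    abel
  -- the differences of the two cochains define a global form, up to regular forms and `K₂`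
  set Γ := γ' η - γ η - g η with hΓ
  have hdiff : ∀ x, γ' x - γ x = Γ + g x + dlog₂ k F (β η x) := fun x => by
    have := hd' η x
    rw [hγ, hγ'] at this
    rw [hΓ]
    rw [← sub_eq_zero] at this ⊢
    rw [← this]; abel
  have hfin := hC.finite_compl (W η) ⟨η, hW η⟩
  set T : Finset X := S ∪ S' ∪ hfin.toFinset with hT
  have hηT : η ∉ T := by
    simp only [hT, Finset.mem_union, Set.Finite.mem_toFinset, not_or]
    exact ⟨⟨hS, hS'⟩, fun h => h (hW η)⟩
  have hg' : ∀ x, g x ∈ regularForms₂ (O x) k := fun x => hg x x (hW' x)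
  have hsum : ∑ x ∈ T, hC.res k x Γ = 0 := by
    refine hC.sum_res_eq_zero T hηT fun x hx _ => ?_
    simp only [hT, Finset.mem_union, Set.Finite.mem_toFinset, not_or, Set.mem_compl_iff,
      not_not] at hx
    have : Γ = γ' x - γ x - g x - dlog₂ k F (β η x) := by rw [hdiff]; abel
    rw [this]
    exact sub_mem (sub_mem (sub_mem (hreg' x hx.1.2) (hreg x hx.1.1)) (hg' x))
      (dlog₂_mem_regularForms₂ (hβ η x x ⟨hx.2, hW x⟩))
  refine QuotientAddGroup.eq.2 ?_
  have e1 : ∑ x ∈ S, hC.res k x (γ x) = ∑ x ∈ T, hC.res k x (γ x) :=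
    Finset.sum_subset (fun x hx => by simp [hT, hx]) fun x _ hx => hC.res_of_mem (hreg x hx)
  have e2 : ∑ x ∈ S', hC.res k x (γ' x) = ∑ x ∈ T, hC.res k x (γ' x) :=
    Finset.sum_subset (fun x hx => by simp [hT, hx]) fun x _ hx => hC.res_of_mem (hreg' x hx)
  rw [e1, e2, neg_add_eq_sub, ← Finset.sum_sub_distrib]
  have e3 : ∑ x ∈ T, (hC.res k x (γ' x) - hC.res k x (γ x)) =
      ∑ x ∈ T, hC.res k x (dlog₂ k F (β η x)) := by
    rw [← zero_add (∑ x ∈ T, hC.res k x (dlog₂ k F (β η x))), ← hsum, ← Finset.sum_add_distrib]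
    refine Finset.sum_congr rfl fun x _ => ?_
    rw [← map_sub, hdiff, map_add, map_add, hC.res_of_mem (hg' x), add_zero]
  rw [e3]
  exact sum_mem fun x _ => hC.res_dlog₂ x _

/-- The coboundary of a `1`-cochain of the Milnor `K₂`-sheaf. -/
def k₂Coboundary (β : X → X → MilnorK₂ F)
    (hβ : β ∈ C1 fun x => k₂Stalk (O x)) : Z2 (K := K) O k :=
  ⟨(fun x y z => β y z - β x z + β x y, fun x y => dlog₂ k F (β x y)), by
    obtain ⟨W, hW, hβ⟩ := hβ
    refine ⟨⟨W, hW, fun x y z p hp => ?_⟩, ⟨W, hW, fun x y p hp => ?_⟩, fun x y z t => ?_,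
      fun x y z => ?_⟩
    · exact add_mem (sub_mem (hβ y z p ⟨hp.1.2, hp.2⟩) (hβ x z p ⟨hp.1.1, hp.2⟩)) (hβ x y p hp.1)
    · exact dlog₂_mem_regularForms₂ (k := k) (hβ x y p hp)
    · dsimp only; abel
    · simp only [map_add, map_sub]⟩

theorem k₂Coboundary_mem (β : X → X → MilnorK₂ F) (hβ : β ∈ C1 fun x => k₂Stalk (O x)) :
    k₂Coboundary (k := k) β hβ ∈ B2 (K := K) O k :=
  ⟨β, hβ, 0, zero_mem _, fun _ _ _ => rfl, fun x y => by simp [k₂Coboundary]⟩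

variable {m : X → ℕ}

/-- The trace of a product as a sum of residues.  On a covering by open sets any two of which meet
in a neighbourhood of the generic point `η` over which everything is trivialized, the symbols
`{λ_{xy}, c_{yz}}` are the coboundary of `{λ_{xη}, c_{yx}}`. -/
theorem IsSmoothCurve.exists_isTrace_cup (hC : IsSmoothCurve O η) (l : Z1Pic O m)
    (c : Z1Conn O m k) : ∃ S₀ : Finset X, η ∉ S₀ ∧ ∀ S : Finset X, S₀ ⊆ S → η ∉ S →
      IsTrace O (cup O m k (H1Pic.mk O m l) (H1Conn.mk O m k c))
        (QuotientAddGroup.mk (-∑ x ∈ S, hC.res k x (wedge k (dlog k F (l.1 x η)) (c.1.2 x)))) := by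
  classical
  obtain ⟨W₁, hW₁, hl⟩ := l.2.1
  have hl' := l.2.2
  obtain ⟨W₂, hW₂, hc⟩ := c.2.1
  obtain ⟨W₃, hW₃, hω⟩ := c.2.2.1
  have hc' := c.2.2.2.1
  have hcω := c.2.2.2.2
  set W : X → Opens X := fun x => W₁ x ⊓ W₂ x ⊓ W₃ x with hWdef
  have hW : ∀ x, x ∈ W x := fun x => ⟨⟨hW₁ x, hW₂ x⟩, hW₃ x⟩
  have hfin := hC.finite_compl (W η) ⟨η, hW η⟩
  have hopen : ∀ x, IsOpen ((W η : Set X) ∪ {x}) := fun x => by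
    rw [← isClosed_compl_iff, Set.compl_union]
    have h1 : ((W η : Set X)ᶜ ∩ {x}ᶜ).Finite := hfin.subset Set.inter_subset_left
    rw [← Set.biUnion_of_singleton ((W η : Set X)ᶜ ∩ {x}ᶜ)]
    exact h1.isClosed_biUnion fun y hy => hC.isClosed y fun h => hy.1 (h ▸ hW η)
  -- two different ones among the neighbourhoods `W η ∪ {x}` meet inside `W η`
  set β : X → X → MilnorK₂ F := fun x y => symb (l.1 x η) (c.1.1 y x) with hβdef
  have hl0 : ∀ x, l.1 x x = 0 := fun x => by simpa using hl' x x x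
  have hc0 : ∀ x, c.1.1 x x = 0 := fun x => by simpa using hc' x x x
  have hβ : β ∈ C1 fun x => k₂Stalk (O x) := by
    refine ⟨fun x => W x ⊓ ⟨_, hopen x⟩, fun x => ⟨hW x, Or.inr rfl⟩, fun x y p hp => ?_⟩
    rcases eq_or_ne x y with rfl | hxy
    · rw [hβdef]
      dsimp only
      rw [hc0, map_zero]; exact zero_mem _
    · have hpη : p ∈ W η := by
        rcases hp.1.2 with h | h
        · exact h
        · rcases hp.2.2 with h' | h'
          · exact h'
          · exact (hxy (h.symm.trans h')).elim
      exact AddSubgroup.subset_closure ⟨_, (hl x η p ⟨hp.1.1.1.1, hpη.1.1⟩).1, _,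
        hc y x p ⟨hp.2.1.1.2, hp.1.1.1.2⟩, rfl⟩
  refine ⟨hfin.toFinset, fun h => (hfin.mem_toFinset.1 h) (hW η), fun S hS₀ hS => ?_⟩
  refine hC.isTrace_iff.2 ⟨cupCocycle O m k l c - k₂Coboundary (k := k) β hβ, ?_, ?_,
    fun x => -wedge k (dlog k F (l.1 x η)) (c.1.2 x), S, fun x y => ?_, hS, fun x hx => ?_, ?_⟩
  · rw [cup_mk, map_sub, sub_eq_self]
    exact (QuotientAddGroup.eq_zero_iff _).2 (k₂Coboundary_mem β hβ)
  · funext x y z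
    change symb (l.1 x y) (c.1.1 y z) - (symb (l.1 y η) (c.1.1 z y) - symb (l.1 x η) (c.1.1 z x) +
      symb (l.1 x η) (c.1.1 y x)) = 0
    have e1 : l.1 x y = l.1 x η - l.1 y η := by rw [hl' x y η]; abel
    have e2 : c.1.1 z x = c.1.1 z y + c.1.1 y x := hc' z y x
    have e3 : c.1.1 y z = -c.1.1 z y := by
      rw [eq_neg_iff_add_eq_zero, ← hc' y z y, hc0]
    rw [e1, e2, e3]
    simp only [map_add, map_sub, map_neg, AddMonoidHom.sub_apply, AddMonoidHom.add_apply]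
    abel
  · change wedge k (dlog k F (l.1 x y)) (c.1.2 y) - dlog₂ k F (symb (l.1 x η) (c.1.1 y x)) = _
    have e1 : l.1 x y = l.1 x η - l.1 y η := by rw [hl' x y η]; abel
    rw [dlog₂_symb, hcω y x, e1]
    simp only [map_sub, LinearMap.sub_apply]
    abel
  · have hxη : x ∈ W η := by
      by_contra h
      exact hx (hS₀ (hfin.mem_toFinset.2 h))
    exact neg_mem (wedge_dlog_logPolar (O x) (m x) (hl x η x ⟨hW₁ x, hxη.1.1⟩)
      (hω x x (hW₃ x)))
  · congr 1
    simp only [map_neg, Finset.sum_neg_distrib]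

end Global

/-! ### Rank one connections -/

section RankOne

variable {K F : Type*} [Field K] [Field F] [Algebra K F]
  {V : Type*} [AddCommGroup V] [Module F V]

theorem exists_coordinate (hV : Module.finrank F V = 1) {e : V} (he : e ≠ 0) :
    ∃ ℓ : V →ₗ[F] F, ℓ e = 1 ∧ ∀ v, ℓ v • e = v := by
  choose c hc using (finrank_eq_one_iff_of_nonzero' e he).1 hV
  have hinj : ∀ {a b : F}, a • e = b • e → a = b := fun h => smul_left_injective F he h
  exact ⟨{ toFun := c
           map_add' := fun x y => hinj (by rw [add_smul, hc, hc, hc])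
           map_smul' := fun r x => hinj (by simp [mul_smul, hc]) },
    hinj ((hc _).trans (one_smul _ _).symm), hc⟩

variable {N : Type*} [AddCommGroup N] [Module F N]

theorem exists_eq_tmul (hV : Module.finrank F V = 1) {e : V} (he : e ≠ 0) (t : N ⊗[F] V) :
    ∃ a : N, t = a ⊗ₜ e := by
  obtain ⟨ℓ, -, hℓ⟩ := exists_coordinate hV he
  induction t with
  | zero => exact ⟨0, by simp⟩
  | add x y hx hy =>
    obtain ⟨a, rfl⟩ := hx
    obtain ⟨b, rfl⟩ := hy
    exact ⟨a + b, (TensorProduct.add_tmul _ _ _).symm⟩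
  | tmul a v => exact ⟨ℓ v • a, by rw [TensorProduct.smul_tmul, hℓ]⟩

theorem exists_tensor_coordinate (hV : Module.finrank F V = 1) {e : V} (he : e ≠ 0) :
    ∃ (ℓ : V →ₗ[F] F) (ψ : N ⊗[F] V →ₗ[F] N), ℓ e = 1 ∧ ∀ a v, ψ (a ⊗ₜ v) = ℓ v • a := by
  obtain ⟨ℓ, h1, -⟩ := exists_coordinate hV he
  exact ⟨ℓ, (TensorProduct.rid F N).toLinearMap ∘ₗ ℓ.lTensor N, h1, fun a v => by simp⟩

theorem tmul_left_cancel (hV : Module.finrank F V = 1) {e : V} (he : e ≠ 0) {a b : N}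
    (h : a ⊗ₜ[F] e = b ⊗ₜ e) : a = b := by
  obtain ⟨ℓ, ψ, h1, hψ⟩ := exists_tensor_coordinate (N := N) hV he
  have := congrArg ψ h
  rwa [hψ, hψ, h1, one_smul, one_smul] at this

theorem tmul_mem_tensorStalk_iff (hV : Module.finrank F V = 1) {e : V} (he : e ≠ 0)
    {O : Subalgebra K F} {S : Submodule O N} {a : N} :
    a ⊗ₜ[F] e ∈ tensorStalk O S (Submodule.span O {e}) ↔ a ∈ S := by
  refine ⟨fun h => ?_, fun h => Submodule.subset_span
    ⟨a, h, e, Submodule.mem_span_singleton_self e, rfl⟩⟩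
  obtain ⟨ℓ, ψ, h1, hψ⟩ := exists_tensor_coordinate (N := N) hV he
  suffices H : ∀ t ∈ tensorStalk O S (Submodule.span O {e}), ψ t ∈ S by
    have := H _ h
    rwa [hψ, h1, one_smul] at this
  intro t ht
  induction ht using Submodule.span_induction with
  | mem y hy =>
    obtain ⟨b, hb, v, hv, rfl⟩ := hy
    obtain ⟨r, rfl⟩ := Submodule.mem_span_singleton.1 hv
    dsimp only
    rw [hψ, show r • e = (r : F) • e from rfl, map_smul, h1, smul_eq_mul, mul_one]
    exact S.smul_mem r hb
  | zero => rw [map_zero]; exact zero_mem _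
  | add x y _ _ hx hy => rw [map_add]; exact add_mem hx hy
  | smul r x _ hx =>
    rw [show r • x = (r : F) • x from rfl, map_smul]
    exact S.smul_mem r hx

theorem mem_of_tmul_mem_span (hV : Module.finrank F V = 1) {e : V} (he : e ≠ 0)
    {S : Submodule F N} {a : N} (h : a ⊗ₜ[F] e ∈
      Submodule.span F (Set.image2 (fun η v => η ⊗ₜ[F] v) (S : Set N) (Set.univ : Set V))) :
    a ∈ S := by
  obtain ⟨ℓ, ψ, h1, hψ⟩ := exists_tensor_coordinate (N := N) hV he
  suffices H : ∀ t ∈ Submodule.span F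
      (Set.image2 (fun η v => η ⊗ₜ[F] v) (S : Set N) (Set.univ : Set V)), ψ t ∈ S by
    have := H _ h
    rwa [hψ, h1, one_smul] at this
  intro t ht
  induction ht using Submodule.span_induction with
  | mem y hy =>
    obtain ⟨b, hb, v, -, rfl⟩ := hy
    dsimp only
    rw [hψ]
    exact S.smul_mem _ hb
  | zero => rw [map_zero]; exact zero_mem _
  | add x y _ _ hx hy => rw [map_add]; exact add_mem hx hy
  | smul r x _ hx => rw [map_smul]; exact S.smul_mem r hx

end RankOne

section Connection

variable {k : Type v} {K : Type u} {F : Type w} [Field k] [Field K] [Field F] [Algebra k K]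
  [Algebra k F] [Algebra K F] [IsScalarTower k K F]
  {V : Type*} [AddCommGroup V] [Module F V] {D : Connection k F V}

theorem Connection.toFun_smul {e : V} {ω : Ω[F⁄k]} (h : D.toFun e = ω ⊗ₜ e) (f : F) :
    D.toFun (f • e) = (f • ω + KaehlerDifferential.D k F f) ⊗ₜ e := by
  rw [D.leibniz, h, TensorProduct.add_tmul, TensorProduct.smul_tmul']

theorem Connection.rel_smul {e : V} {ω : Ω[F⁄k]} (h : D.toFun e = ω ⊗ₜ e) (f : F) :
    D.rel K (f • e) = (f • relForm k K ω + KaehlerDifferential.D K F f) ⊗ₜ e := by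
  change (relForm k K).rTensor V (D.toFun (f • e)) = _
  rw [D.toFun_smul h, LinearMap.rTensor_tmul, map_add, map_smul, relForm_D]

theorem Connection.rel_eq {e : V} {ω : Ω[F⁄k]} (h : D.toFun e = ω ⊗ₜ e) :
    D.rel K e = relForm k K ω ⊗ₜ e := by
  change (relForm k K).rTensor V (D.toFun e) = _
  rw [h, LinearMap.rTensor_tmul]

/-- The connection form of a rank one connection with vertical curvature is closed, up to forms from
the base. -/
theorem Connection.HasVerticalCurvature.extDeriv_mem (hD : D.HasVerticalCurvature K)
    (hV : Module.finrank F V = 1) {e : V} (he : e ≠ 0) {ω : Ω[F⁄k]}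
    (h : D.toFun e = ω ⊗ₜ e) : extDeriv k ω ∈ baseForms₂ k K F := by
  have h1 := hD e
  have h2 : D.curvature e = extDeriv k ω ⊗ₜ e := by
    change D.next (D.toFun e) = _
    rw [h]
    change extDeriv k ω ⊗ₜ[F] e - (wedge k ω).rTensor V (D.toFun e) = _
    rw [h, LinearMap.rTensor_tmul, wedge_self, TensorProduct.zero_tmul]
    exact sub_zero (extDeriv k ω ⊗ₜ[F] e)
  rw [h2] at h1
  exact mem_of_tmul_mem_span hV he h1

variable [CharZero K] {O : Subalgebra K F} [IsLocalRing O]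

/-- The components of a connection form in the direction of the base are determined up to constants
by the relative connection form. -/
theorem IsSmoothPoint.smul_D_eq_D (hO : IsSmoothPoint O) {z : O}
    (hz : maximalIdeal O = Ideal.span {z}) {ω : Ω[F⁄k]} (hω : extDeriv k ω ∈ baseForms₂ k K F)
    {f : F} (hf : relForm k K ω = f • KaehlerDifferential.D K F (z : F)) {φ : Ω[K⁄k] →ₗ[K] K}
    {E : Derivation k F F} (hE : IsAdapted O (z : F) φ E) :
    E f • KaehlerDifferential.D K F (z : F) =
      KaehlerDifferential.D K F (E.liftKaehlerDifferential ω) := by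
  have h1 : ω - f • KaehlerDifferential.D k F (z : F) ∈ baseForms k K F := by
    apply mem_baseForms_of_relForm_eq_zero
    rw [map_sub, map_smul, relForm_D, hf, sub_self]
  -- Cartan's formula for `ω - f dz`; the contraction of `dω` vanishes
  have h2 := contraction_extDeriv_of_mem_baseForms hE.extends_base h1
  rw [map_sub, map_sub, contraction_of_mem_baseForms₂ E hω,
    contraction_extDeriv_smul_D E hE.uniformizer, map_sub, map_smul,
    Derivation.liftKaehlerDifferential_comp_D, hE.uniformizer, smul_zero, sub_zero, zero_sub,
    neg_inj] at h2
  exact h2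

/-- The components of a connection form in the direction of the base have poles of order one less
than the relative connection form, since their derivatives along the curve are the `E f`. -/
theorem IsSmoothPoint.pow_mul_lift_mem (hO : IsSmoothPoint O) {z : O}
    (hz : maximalIdeal O = Ideal.span {z}) {ω : Ω[F⁄k]} (hω : extDeriv k ω ∈ baseForms₂ k K F)
    {f : F} (hf : relForm k K ω = f • KaehlerDifferential.D K F (z : F)) {i : ℕ}
    (hfi : (z : F) ^ (i + 1) * f ∈ O) {φ : Ω[K⁄k] →ₗ[K] K}
    {E : Derivation k F F} (hE : IsAdapted O (z : F) φ E) :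
    (z : F) ^ i * E.liftKaehlerDifferential ω ∈ O := by
  obtain ⟨d, hd, hdO, hdf⟩ := hO.exists_derivation hz
  refine hO.pow_mul_mem_of_deriv hz hd hdO ?_
  have h1 := hO.smul_D_eq_D hz hω hf hE
  rw [hdf (E.liftKaehlerDifferential ω)] at h1
  have h2 : E f = d (E.liftKaehlerDifferential ω) := smul_left_injective F (hO.D_ne_zero hz) h1
  have h3 := hE.mem _ hfi
  rw [E.leibniz, E.leibniz_pow, hE.uniformizer, smul_zero, smul_zero, smul_zero, add_zero,
    smul_eq_mul] at h3
  rwa [← h2]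

theorem pullForm_mem_regularForms (τ : Ω[K⁄k]) : pullForm k τ ∈ regularForms O k := by
  have hτ : τ ∈ Submodule.span K (Set.range (KaehlerDifferential.D k K)) := by
    rw [KaehlerDifferential.span_range_derivation]; trivial
  induction hτ using Submodule.span_induction with
  | mem x hx =>
    obtain ⟨a, rfl⟩ := hx
    rw [pullForm_D]
    exact D_mem_regularForms (Subalgebra.algebraMap_mem _ _)
  | zero => rw [map_zero]; exact zero_mem _
  | add x y _ _ hx hy => rw [map_add]; exact add_mem hx hy
  | smul a x _ hx =>
    rw [map_smul, ← algebraMap_smul O a]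
    exact Submodule.smul_mem _ _ hx

/-- Poles of a connection form: if the relative form has a pole of order at most `i + 1`, the
absolute form has logarithmic poles up to a factor of `z ^ i`. -/
theorem IsSmoothPoint.mem_logPolarForms (hO : IsSmoothPoint O) {z : O}
    (hz : maximalIdeal O = Ideal.span {z}) {ω : Ω[F⁄k]} (hω : extDeriv k ω ∈ baseForms₂ k K F)
    {f : F} (hf : relForm k K ω = f • KaehlerDifferential.D K F (z : F)) {i : ℕ}
    (hfi : (z : F) ^ (i + 1) * f ∈ O) : ω ∈ logPolarForms O k (i + 1) := by
  have hz0 := hO.ne_zero hz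
  intro g hg
  rw [hz, Ideal.span_singleton_pow, Ideal.mem_span_singleton] at hg
  obtain ⟨c, rfl⟩ := hg
  rw [mul_comm, mul_smul]
  refine Submodule.smul_mem _ c ?_
  change ((z ^ i : O) : F) • ω ∈ logForms O k
  rw [SubmonoidClass.coe_pow]
  set ω' := ω - f • KaehlerDifferential.D k F (z : F) with hω'
  have hmem : ω' ∈ baseForms k K F := by
    apply mem_baseForms_of_relForm_eq_zero
    rw [hω', map_sub, map_smul, relForm_D, hf, sub_self]
  have h1 : (z : F) ^ i • ω = ((⟨_, hfi⟩ : O) • ((z : F)⁻¹ • KaehlerDifferential.D k F (z : F))) +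
      (z : F) ^ i • ω' := by
    change _ = ((z : F) ^ (i + 1) * f) • ((z : F)⁻¹ • KaehlerDifferential.D k F (z : F)) + _
    rw [hω', smul_sub, smul_smul, smul_smul,
      show (z : F) ^ (i + 1) * f * (z : F)⁻¹ = (z : F) ^ i * f by field_simp; ring, add_sub_cancel]
  rw [h1]
  refine add_mem (Submodule.smul_mem _ _ (Submodule.subset_span (Or.inr ⟨z, hz, rfl⟩))) ?_
  have hle : regularForms O k ≤ logForms O k := Submodule.span_mono Set.subset_union_left
  refine hle ?_
  -- expand the part from the base in a basis of `Ω¹_K`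
  let B := Module.Basis.ofVectorSpace K Ω[K⁄k]
  have hB : baseForms k K F ≤ Submodule.span F (Set.range fun j => pullForm (F := F) k (B j)) := by
    rw [baseForms_eq_span, Submodule.span_le]
    rintro _ ⟨τ, rfl⟩
    rw [← B.linearCombination_repr τ, Finsupp.linearCombination_apply, Finsupp.sum, map_sum]
    refine sum_mem fun j _ => ?_
    rw [map_smul, ← algebraMap_smul F]
    exact Submodule.smul_mem _ _ (Submodule.subset_span ⟨j, rfl⟩)
  obtain ⟨c, hc⟩ := (Finsupp.mem_span_range_iff_exists_finsupp).1 (hB hmem)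
  rw [← hc, Finsupp.sum, Finset.smul_sum]
  refine sum_mem fun j _ => ?_
  have hcj : (z : F) ^ i * c j ∈ O := by
    obtain ⟨E, hE⟩ := hO.exists_isAdapted hz (B.coord j)
    have h2 := hO.pow_mul_lift_mem hz hω hf hfi hE
    have h3 : E.liftKaehlerDifferential ω = c j := by
      have h4 : ω = ω' + f • KaehlerDifferential.D k F (z : F) := by rw [hω']; abel
      rw [h4, map_add, map_smul, Derivation.liftKaehlerDifferential_comp_D, hE.uniformizer,
        smul_zero, add_zero, ← hc, Finsupp.sum, map_sum]
      classical
      simp only [map_smul, liftKaehlerDifferential_pullForm hE.extends_base, B.coord_apply,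
        B.repr_self, Finsupp.single_apply, smul_eq_mul]
      simp +contextual
    rwa [h3] at h2
  rw [smul_smul]
  exact Submodule.smul_mem _ (⟨_, hcj⟩ : O) (pullForm_mem_regularForms _)

theorem IsSmoothPoint.smul_D_mem_polarForms_iff (hO : IsSmoothPoint O) {z : O}
    (hz : maximalIdeal O = Ideal.span {z}) {f : F} {n : ℕ} :
    f • KaehlerDifferential.D K F (z : F) ∈ polarForms O n ↔ (z : F) ^ n * f ∈ O := by
  constructor
  · intro h
    have := h (z ^ n) (by
      rw [hz, Ideal.span_singleton_pow]; exact Ideal.mem_span_singleton_self _)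
    change ((z ^ n : O) : F) • f • KaehlerDifferential.D K F (z : F) ∈ _ at this
    rwa [smul_smul, hO.smul_D_mem_iff hz, SubmonoidClass.coe_pow] at this
  · intro h g hg
    rw [hz, Ideal.span_singleton_pow, Ideal.mem_span_singleton] at hg
    obtain ⟨c, rfl⟩ := hg
    change ((z ^ n * c : O) : F) • f • KaehlerDifferential.D K F (z : F) ∈ _
    rw [smul_smul, hO.smul_D_mem_iff hz, MulMemClass.coe_mul, SubmonoidClass.coe_pow,
      mul_right_comm]
    exact mul_mem h c.2

theorem polarForms_zero : polarForms O 0 = regularForms O K := by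
  ext ω
  refine ⟨fun h => by simpa using h 1 (by simp), fun h g _ => Submodule.smul_mem _ g h⟩

theorem IsSmoothPoint.polarForms_eq_span (hO : IsSmoothPoint O) {z : O}
    (hz : maximalIdeal O = Ideal.span {z}) {f : F} {n : ℕ} (u : Oˣ)
    (hu : (z : F) ^ n * f = (u : O)) :
    polarForms O n = Submodule.span O {f • KaehlerDifferential.D K F (z : F)} := by
  have hz0 := hO.ne_zero hz
  have hu0 := unit_ne_zero u
  ext ω
  obtain ⟨g, rfl⟩ := hO.exists_smul_D hz ω
  rw [hO.smul_D_mem_polarForms_iff hz, Submodule.mem_span_singleton]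
  constructor
  · intro h
    refine ⟨((u⁻¹ : Oˣ) : O) * ⟨_, h⟩, ?_⟩
    change ((((u⁻¹ : Oˣ) : O) : F) * ((z : F) ^ n * g)) • f • KaehlerDifferential.D K F (z : F) = _
    rw [smul_smul]
    congr 1
    rw [coe_inv_unit, ← hu]
    have : (z : F) ^ n * f ≠ 0 := hu ▸ hu0
    have hf0 := right_ne_zero_of_mul this
    field_simp
  · rintro ⟨a, ha⟩
    have h1 : (a : F) * f = g := by
      apply smul_left_injective F (hO.D_ne_zero hz)
      exact (mul_smul _ _ _).trans ha
    rw [← h1, mul_left_comm, hu]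
    exact mul_mem a.2 (u : O).2

/-- Conversely, a generator of the forms with poles of order at most `n` has a pole of exact
order `n`. -/
theorem IsSmoothPoint.exists_unit_of_polarForms_eq_span (hO : IsSmoothPoint O) {z : O}
    (hz : maximalIdeal O = Ideal.span {z}) {f : F} {n : ℕ}
    (h : polarForms O n = Submodule.span O {f • KaehlerDifferential.D K F (z : F)}) :
    ∃ u : Oˣ, (z : F) ^ n * f = (u : O) := by
  have hz0 := hO.ne_zero hz
  have h1 : (z : F) ^ n * f ∈ O := by
    rw [← hO.smul_D_mem_polarForms_iff hz, h]; exact Submodule.mem_span_singleton_self _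
  have h2 : ((z : F) ^ n)⁻¹ • KaehlerDifferential.D K F (z : F) ∈ polarForms O n := by
    rw [hO.smul_D_mem_polarForms_iff hz, mul_inv_cancel₀ (pow_ne_zero _ hz0)]; exact one_mem _
  rw [h] at h2
  obtain ⟨c, hc⟩ := Submodule.mem_span_singleton.1 h2
  have h3 : (c : F) * f = ((z : F) ^ n)⁻¹ := by
    apply smul_left_injective F (hO.D_ne_zero hz)
    exact (mul_smul _ _ _).trans hc
  have h4 : (⟨_, h1⟩ : O) * c = 1 := Subtype.ext (by
    change (z : F) ^ n * f * c = 1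
    rw [mul_assoc, mul_comm f, h3, mul_inv_cancel₀ (pow_ne_zero _ hz0)])
  exact ⟨⟨_, c, h4, by rw [mul_comm, h4]⟩, rfl⟩

end Connection

/-! ### Good extensions at a point of the divisor -/

section Comparison

variable {k : Type v} {K : Type u} {F : Type w} [Field k] [Field K] [Field F] [Algebra k K]
  [Algebra k F] [Algebra K F] [IsScalarTower k K F] [CharZero K] {O : Subalgebra K F}
  [IsLocalRing O]

/-- The local computation behind the comparison of two extensions: `ω` and `ω + N dz / z` are the
connection forms of the two extensions at a point, and `g` is the quotient of the corresponding
relative forms.  The contractions of `dlog g` with the second connection form turn out to be exact up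
to regular forms. -/
theorem IsSmoothPoint.hasResidue₂_dlog_quotient (hO : IsSmoothPoint O) {z : O}
    (hz : maximalIdeal O = Ideal.span {z}) {ω : Ω[F⁄k]} (hω : extDeriv k ω ∈ baseForms₂ k K F)
    {f f' : F} (hf : relForm k K ω = f • KaehlerDifferential.D K F (z : F)) {i : ℕ} {u u' : Oˣ}
    (hu : (z : F) ^ (i + 1) * f = (u : O)) (hu' : (z : F) ^ (i + 1) * f' = (u' : O)) {N : ℤ}
    (hff' : f' = f + N * (z : F)⁻¹) {g : Additive Fˣ} (hg : (g.toMul : F) * f = f') :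
    HasResidue₂ O (wedge k (dlog k F g)
      (ω + (N * (z : F)⁻¹) • KaehlerDifferential.D k F (z : F))) 0 := by
  have hz0 := hO.ne_zero hz
  have hu0 := unit_ne_zero u
  have hf0 : f ≠ 0 := right_ne_zero_of_mul (hu ▸ hu0 : (z : F) ^ (i + 1) * f ≠ 0)
  set G : F := (g.toMul : F) with hG
  have hG0 : G ≠ 0 := Units.ne_zero _
  have hGi : G⁻¹ ∈ O := by
    have : G⁻¹ = (u : O) * (((u'⁻¹ : Oˣ) : O) : F) := by
      have := unit_ne_zero u'
      rw [coe_inv_unit, ← hu, ← hu', ← hg]; field_simp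
    rw [this]; exact mul_mem (u : O).2 (u'⁻¹ : Oˣ).1.2
  -- `y` vanishes to order `i`, and `g = 1 + N y`
  set y : F := ((z : F) * f)⁻¹ with hy
  have hyu : y = (z : F) ^ i * ((u⁻¹ : Oˣ) : O) := by
    rw [coe_inv_unit, ← hu, hy, pow_succ]; field_simp
  have hyO : y ∈ O := hyu ▸ mul_mem (pow_mem z.2 _) (u⁻¹ : Oˣ).1.2
  have hGy : G = 1 + N * y := by
    have : G = f' / f := by rw [← hg]; field_simp
    rw [this, hff', hy]; field_simp
  refine hO.hasResidue₂_of_contraction hz fun φ E hE => ?_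
  -- `b` has a pole of order at most `i`, so that `b y` is regular
  set b := E.liftKaehlerDifferential ω with hb
  have hby : b * y ∈ O := by
    have h1 := hO.pow_mul_lift_mem hz hω hf (hu ▸ u.1.2) hE
    rw [hyu, mul_left_comm, ← mul_assoc]
    exact mul_mem h1 (u⁻¹ : Oˣ).1.2
  have hDb : E f • KaehlerDifferential.D K F (z : F) = KaehlerDifferential.D K F b :=
    hO.smul_D_eq_D hz hω hf hE
  have hEy : E y = -((z : F) * y ^ 2 * E f) := by
    rw [hy, E.leibniz_inv, E.leibniz, hE.uniformizer, smul_zero, add_zero, smul_eq_mul, smul_eq_mul]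
    ring
  have hEG : E G = N * E y := by
    rw [hGy, map_add, E.map_one_eq_zero, E.leibniz, E.map_intCast, smul_zero, add_zero, zero_add,
      smul_eq_mul]
  have hDG : KaehlerDifferential.D K F G = (N : F) • KaehlerDifferential.D K F y := by
    rw [hGy, map_add, Derivation.map_one_eq_zero, Derivation.leibniz, Derivation.map_intCast,
      smul_zero, add_zero, zero_add]
  have hlift : E.liftKaehlerDifferential
      (ω + (N * (z : F)⁻¹) • KaehlerDifferential.D k F (z : F)) = b := by
    rw [map_add, map_smul, Derivation.liftKaehlerDifferential_comp_D, hE.uniformizer, smul_zero,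
      add_zero]
  have hrel : relForm k K (ω + (N * (z : F)⁻¹) • KaehlerDifferential.D k F (z : F)) =
      (G * f) • KaehlerDifferential.D K F (z : F) := by
    rw [map_add, map_smul, relForm_D, hf, ← add_smul, hg, hff']
  have key : contraction K E (wedge k (dlog k F g)
      (ω + (N * (z : F)⁻¹) • KaehlerDifferential.D k F (z : F))) =
      KaehlerDifferential.D K F (-(N * (y * b))) +
        ((N : F) ^ 2 * (b * y) * G⁻¹) • KaehlerDifferential.D K F y := by
    rw [contraction_wedge, hlift, hrel, dlog_apply, map_smul, map_smul, relForm_D,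
      Derivation.liftKaehlerDifferential_comp_D, Units.val_inv_eq_inv_val, ← hG, hEG, hDG,
      map_neg, Derivation.leibniz, Derivation.leibniz, Derivation.map_intCast, ← hDb, smul_smul,
      smul_smul, smul_smul, smul_zero, add_zero, smul_add, smul_smul, smul_smul]
    have h1 : G⁻¹ • (N * E y) * (G * f) = -(N * (y * E f)) := by
      rw [hEy, smul_eq_mul, hy]; field_simp
    have h2 : b * G⁻¹ * N = N * b - (N : F) ^ 2 * (b * y) * G⁻¹ := by
      have : (N : F) * y = G - 1 := by rw [hGy]; ring
      have h3 : (N : F) ^ 2 * (b * y) * G⁻¹ = N * b * (G - 1) * G⁻¹ := by rw [← this]; ring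
      rw [h3]; field_simp; ring
    rw [h1, h2]
    module
  rw [key, map_zero, neg_zero, ← add_zero (0 : K)]
  refine (hasResidue_D hO _).add hO (hasResidue_of_mem hO ?_)
  have hNO : ((N : F) ^ 2 * (b * y) * G⁻¹) ∈ O :=
    mul_mem (mul_mem (pow_mem (intCast_mem O N) 2) hby) hGi
  exact Submodule.smul_mem _ (⟨_, hNO⟩ : O) (D_mem_regularForms hyO)

end Comparison

section Extension

variable {k : Type v} {K : Type u} {F : Type w} [Field k] [Field K] [Field F] [Algebra k K]
  [Algebra k F] [Algebra K F] [IsScalarTower k K F] [CharZero K]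
  {X : Type u} [TopologicalSpace X] {O : X → Subalgebra K F} [∀ x, IsLocalRing (O x)] {η : X}
  {V : Type*} [AddCommGroup V] [Module F V] {D : Connection k F V} {m : X → ℕ}
  {L : InvertibleSheaf O V {x | m x = 0}} {M : InvertibleSheaf O V (Set.univ : Set X)}

theorem IsSmoothCurve.exists_opens (hC : IsSmoothCurve O η) {T : Set X} (hT : T.Finite)
    (hη : η ∉ T) {x : X} (hx : x ∉ T) : ∃ W : Opens X, x ∈ W ∧ ∀ y ∈ W, y ∉ T := by
  have h1 : IsClosed T := by
    rw [← Set.biUnion_of_singleton T]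
    exact hT.isClosed_biUnion fun y hy => hC.isClosed y fun h => hη (h ▸ hy)
  exact ⟨⟨Tᶜ, h1.isOpen_compl⟩, hx, fun y hy => hy⟩

/-- A rational function is regular in a punctured neighbourhood of every point. -/
theorem IsSmoothCurve.exists_opens_mem (hC : IsSmoothCurve O η) (f : F) (x : X) :
    ∃ W : Opens X, x ∈ W ∧ ∀ y ∈ W, y ≠ x → f ∈ O y := by
  obtain ⟨W, hx, hW⟩ := hC.exists_opens (T := {y | f ∉ O y} \ {x})
    ((hC.finite_poles f).subset Set.diff_subset)
    (fun h => h.1 (hC.generic ▸ Algebra.mem_top)) (x := x) (fun h => h.2 rfl)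
  exact ⟨W, hx, fun y hy hyx => by_contra fun h => hW y hy ⟨h, hyx⟩⟩

theorem mem_pushStalk_of_mem (hC : IsSmoothCurve O η) (hM : IsGoodExtension (K := K) m D L M)
    {x : X} {v : V} (hv : v ∈ M.stalk x) : v ∈ pushStalk L x := by
  obtain ⟨W, hx, e, -, hW⟩ := M.exists_generator x trivial
  rw [hW x hx trivial] at hv
  obtain ⟨a, rfl⟩ := Submodule.mem_span_singleton.1 hv
  obtain ⟨U, hxU, hU⟩ := hC.spread x a a.2
  refine ⟨W ⊓ U, ⟨hx, hxU⟩, fun y hy hym => ?_⟩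
  rw [← hM.stalk_eq y hym, hW y hy.1 trivial]
  exact Submodule.mem_span_singleton.2 ⟨⟨a, hU y hy.2⟩, rfl⟩

theorem sub_mem_pushStalk {x : X} {v v' : V} (hv : v ∈ pushStalk L x) (hv' : v' ∈ pushStalk L x) :
    v - v' ∈ pushStalk L x := by
  obtain ⟨W, hx, hW⟩ := hv
  obtain ⟨W', hx', hW'⟩ := hv'
  exact ⟨W ⊓ W', ⟨hx, hx'⟩, fun y hy hym => sub_mem (hW y hy.1 hym) (hW' y hy.2 hym)⟩

/-- The relative connection form of a good extension has a pole of order exactly `m x`: otherwise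
a generator divided by a uniformizer would violate the quasi-isomorphism. -/
theorem IsGoodExtension.exists_unit (hM : IsGoodExtension (K := K) m D L M)
    (hC : IsSmoothCurve O η) (hV : Module.finrank F V = 1)
    {x : X} (hx : m x ≠ 0) (hxη : x ≠ η) {z : O x} (hz : maximalIdeal (O x) = Ideal.span {z})
    {e : V} (he : e ≠ 0) (hMe : M.stalk x = Submodule.span (O x) {e}) {ω : Ω[F⁄k]}
    (hω : D.toFun e = ω ⊗ₜ e) {f : F}
    (hf : relForm k K ω = f • KaehlerDifferential.D K F (z : F)) :
    ∃ u : (O x)ˣ, (z : F) ^ m x * f = (u : O x) := by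
  have hO := hC.point x hxη
  have hz0 := hO.ne_zero hz
  obtain ⟨i, hi⟩ := Nat.exists_eq_succ_of_ne_zero hx
  have hee : e ∈ M.stalk x := hMe ▸ Submodule.mem_span_singleton_self e
  have h1 : (z : F) ^ m x * f ∈ O x := by
    have := hM.rel_mem x e hee
    rw [D.rel_eq hω, hMe, tmul_mem_tensorStalk_iff hV he, hf,
      hO.smul_D_mem_polarForms_iff hz] at this
    exact this
  by_contra hcon
  -- the pole would be of smaller order
  have h2 : (z : F) ^ i * f ∈ O x := by
    have h3 : (⟨_, h1⟩ : O x) ∈ maximalIdeal (O x) := by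
      rw [mem_maximalIdeal, mem_nonunits_iff]
      rintro ⟨u, hu⟩
      exact hcon ⟨u, (congrArg Subtype.val hu).symm⟩
    rw [hz, Ideal.mem_span_singleton] at h3
    obtain ⟨q, hq⟩ := h3
    have h4 : (z : F) ^ m x * f = z * q := congrArg Subtype.val hq
    have h5 : (z : F) ^ i * f = q := by
      apply mul_left_cancel₀ hz0
      rw [← h4, hi, pow_succ]; ring
    rw [h5]; exact q.2
  obtain rfl | hi0 := Nat.eq_zero_or_pos i
  · rw [pow_zero, one_mul] at h2
    obtain ⟨v, hv, hv'⟩ := hM.pole x hx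
    rw [hMe] at hv
    obtain ⟨a, rfl⟩ := Submodule.mem_span_singleton.1 hv
    apply hv'
    rw [show a • e = (a : F) • e from rfl, D.rel_smul hω, hMe, tmul_mem_tensorStalk_iff hV he]
    refine add_mem (Submodule.smul_mem _ a ?_) (D_mem_regularForms a.2)
    rwa [hf, hO.smul_D_mem_iff hz]
  · obtain ⟨j, rfl⟩ := Nat.exists_eq_succ_of_ne_zero hi0.ne'
    have hv : (z : F)⁻¹ • e ∈ pushStalk L x := by
      obtain ⟨W, hxW, e', -, hW⟩ := M.exists_generator x trivial
      obtain ⟨W', hxW', hW'⟩ := hC.exists_opens_mem (z : F)⁻¹ x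
      obtain ⟨U, hxU, hU⟩ := mem_pushStalk_of_mem hC hM hee
      refine ⟨U ⊓ W', ⟨hxU, hxW'⟩, fun y hy hym => ?_⟩
      have hyx : y ≠ x := by rintro rfl; exact hx hym
      exact Submodule.smul_mem _ (⟨_, hW' y hy.2 hyx⟩ : O y) (hU y hy.1 hym)
    obtain ⟨v', hv', hvv'⟩ := hM.quasiIso_H1_injective x _ hv (by
      rw [D.rel_smul hω, hMe, tmul_mem_tensorStalk_iff hV he, hf, Derivation.leibniz_inv,
        smul_smul, ← add_smul, hO.smul_D_mem_polarForms_iff hz, hi]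
      have : (z : F) ^ (j + 1 + 1) * ((z : F)⁻¹ * f + -(z : F)⁻¹ ^ 2) =
          (z : F) ^ (j + 1) * f - (z : F) ^ j := by
        rw [pow_succ, pow_succ]; field_simp; ring
      rw [this]
      exact sub_mem h2 (pow_mem z.2 _))
    have hw := hM.quasiIso_H0 x _ (sub_mem_pushStalk hv (mem_pushStalk_of_mem hC hM hv'))
      (by rw [map_sub, hvv', sub_self])
    have hmem := add_mem hw hv'
    rw [sub_add_cancel, hMe] at hmem
    obtain ⟨a, ha⟩ := Submodule.mem_span_singleton.1 hmem
    have h6 : (a : F) = (z : F)⁻¹ := smul_left_injective F he ha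
    refine hO.not_mem_of_mul_eq_unit hz (f := (z : F)⁻¹) (u := 1) ?_ (h6 ▸ a.2)
    rw [mul_inv_cancel₀ hz0]; rfl

end Extension

/-! ### The classes and their pairing -/

section RankOneGenerators

variable {K F : Type*} [Field K] [Field F] [Algebra K F]

theorem exists_eq_unit_smul {N : Type*} [AddCommGroup N] [Module F N]
    (hN : Module.finrank F N = 1) {s s' : N} (hs : s ≠ 0) (hs' : s' ≠ 0) :
    ∃ a : Additive Fˣ, s = (a.toMul : F) • s' := by
  obtain ⟨c, hc⟩ := (finrank_eq_one_iff_of_nonzero' s' hs').1 hN s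
  have hc0 : c ≠ 0 := by rintro rfl; exact hs (by rw [← hc, zero_smul])
  exact ⟨Additive.ofMul (Units.mk0 c hc0), hc.symm⟩

theorem unit_smul_cancel {N : Type*} [AddCommGroup N] [Module F N] {s : N} (hs : s ≠ 0)
    {a b : Additive Fˣ} (h : (a.toMul : F) • s = (b.toMul : F) • s) : a = b :=
  Additive.toMul.injective (Units.ext (smul_left_injective F hs h))

theorem mem_unitStalk_of_span_eq {N : Type*} [AddCommGroup N] [Module F N] {O : Subalgebra K F}
    {s s' : N} (hs : s ≠ 0) (h : Submodule.span O {s} = Submodule.span O {s'}) {a : Additive Fˣ}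
    (ha : s = (a.toMul : F) • s') : a ∈ unitStalk O := by
  have hs' : s' ≠ 0 := by rintro rfl; exact hs (by rw [ha, smul_zero])
  obtain ⟨b, hb⟩ := Submodule.mem_span_singleton.1 (h ▸ Submodule.mem_span_singleton_self s)
  obtain ⟨c, hc⟩ := Submodule.mem_span_singleton.1 (h ▸ Submodule.mem_span_singleton_self s')
  have hb' : (b : F) = a.toMul := smul_left_injective F hs' (hb.trans ha)
  have hc' : (c : F) * a.toMul = 1 := by
    refine smul_left_injective F hs' ?_
    change ((c : F) * a.toMul) • s' = (1 : F) • s'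
    rw [mul_smul, ← ha, one_smul]; exact hc
  refine ⟨hb' ▸ b.2, ?_⟩
  rw [Units.val_inv_eq_inv_val, ← eq_inv_of_mul_eq_one_left hc']
  exact c.2

theorem span_unit_smul {N : Type*} [AddCommGroup N] [Module F N] {O : Subalgebra K F} {c : F}
    (hc : c ∈ O) (hc' : c⁻¹ ∈ O) (hc0 : c ≠ 0) (s : N) :
    Submodule.span O {c • s} = Submodule.span O {s} := by
  refine le_antisymm ?_ ?_ <;> rw [Submodule.span_singleton_le_iff_mem,
    Submodule.mem_span_singleton]
  · exact ⟨⟨c, hc⟩, rfl⟩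
  · refine ⟨⟨c⁻¹, hc'⟩, ?_⟩
    change c⁻¹ • c • s = s
    rw [smul_smul, inv_mul_cancel₀ hc0, one_smul]

end RankOneGenerators

section Classes

variable {k : Type v} {K : Type u} {F : Type w} [Field k] [Field K] [Field F] [Algebra k K]
  [Algebra k F] [Algebra K F] [IsScalarTower k K F] [CharZero K]
  {X : Type u} [TopologicalSpace X] {O : X → Subalgebra K F} [∀ x, IsLocalRing (O x)] {η : X}
  {V : Type*} [AddCommGroup V] [Module F V] {D : Connection k F V} {m : X → ℕ}
  {L : InvertibleSheaf O V {x | m x = 0}} {M : InvertibleSheaf O V (Set.univ : Set X)}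

theorem IsSmoothCurve.regularForms_generic (hC : IsSmoothCurve O η) :
    regularForms (O η) K = ⊤ := by
  refine eq_top_iff.2 fun ω _ => ?_
  have hω : ω ∈ Submodule.span F (Set.range (KaehlerDifferential.D K F)) := by
    rw [KaehlerDifferential.span_range_derivation]; trivial
  induction hω using Submodule.span_induction with
  | zero => exact zero_mem _
  | add a b _ _ ha hb => exact add_mem (ha trivial) (hb trivial)
  | smul r a _ ha =>
    exact Submodule.smul_mem _ (⟨r, hC.generic ▸ Algebra.mem_top⟩ : O η) (ha trivial)
  | mem a ha =>
    obtain ⟨t, rfl⟩ := ha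
    exact D_mem_regularForms (hC.generic ▸ Algebra.mem_top)

/-- A nonzero rational form generates the sheaf of regular forms at almost all points. -/
theorem IsSmoothCurve.finite_regularForms_ne_span (hC : IsSmoothCurve O η) {ω : Ω[F⁄K]}
    (hω : ω ≠ 0) : {p | regularForms (O p) K ≠ Submodule.span (O p) {ω}}.Finite := by
  obtain ⟨b, U, hU, hb⟩ := hC.chart
  choose g hg using (finrank_eq_one_iff_of_nonzero' ω hω).1 hC.finrank_eq_one
  refine (((hC.finite_compl U hU).union (hC.finite_not_mem_regularForms ω)).union
    (b.finite_toSet.biUnion fun i _ => hC.finite_poles (g (KaehlerDifferential.D K F i)))).subset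
    fun p hp => ?_
  by_contra hcon
  simp only [Set.mem_union, Set.mem_compl_iff, Set.mem_setOf_eq, Set.mem_iUnion, not_or, not_not,
    not_exists] at hcon
  obtain ⟨⟨h1, h2⟩, h3⟩ := hcon
  apply hp
  refine le_antisymm ?_ ((Submodule.span_singleton_le_iff_mem _ _).2 h2)
  rw [(hb p h1).regularForms_eq, Submodule.span_le]
  rintro _ ⟨i, hi, rfl⟩
  exact Submodule.mem_span_singleton.2 ⟨⟨_, h3 i hi⟩, hg _⟩

theorem IsSmoothCurve.regularForms_generic_eq_span (hC : IsSmoothCurve O η) {ω : Ω[F⁄K]}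
    (hω : ω ≠ 0) : regularForms (O η) K = Submodule.span (O η) {ω} := by
  rw [hC.regularForms_generic]
  refine (eq_top_iff.2 fun τ _ => ?_).symm
  obtain ⟨c, hc⟩ := (finrank_eq_one_iff_of_nonzero' ω hω).1 hC.finrank_eq_one τ
  exact Submodule.mem_span_singleton.2 ⟨⟨c, hC.generic ▸ Algebra.mem_top⟩, hc⟩

theorem IsSmoothCurve.exists_opens_regularForms (hC : IsSmoothCurve O η) {ω : Ω[F⁄K]}
    (hω : ω ≠ 0) (x : X) : ∃ W : Opens X, x ∈ W ∧ ∀ p ∈ W, p ≠ x →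
      regularForms (O p) K = Submodule.span (O p) {ω} := by
  obtain ⟨W, hx, hW⟩ := hC.exists_opens
    (T := {p | regularForms (O p) K ≠ Submodule.span (O p) {ω}} \ {x})
    ((hC.finite_regularForms_ne_span hω).subset Set.diff_subset)
    (fun h => h.1 (hC.regularForms_generic_eq_span hω)) (x := x) (fun h => h.2 rfl)
  exact ⟨W, hx, fun y hy hyx => by_contra fun h => hW y hy ⟨h, hyx⟩⟩

theorem IsSmoothCurve.ne_zero_of_polarForms_eq_span (hC : IsSmoothCurve O η) (hη : m η = 0)
    {s : Ω[F⁄K]} (h : polarForms (O η) (m η) = Submodule.span (O η) {s}) : s ≠ 0 := by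
  rintro rfl
  obtain ⟨t, ht⟩ := hC.exists_D_ne_zero
  apply ht
  have h1 : KaehlerDifferential.D K F t ∈ polarForms (O η) (m η) := by
    rw [hη, polarForms_zero, hC.regularForms_generic]; trivial
  rwa [h, Submodule.span_zero_singleton, Submodule.mem_bot] at h1

/-- Two generators of `Ω¹(𝒟)` that both induce the trivialization `triv ∇` along `𝒟` differ by a
section of `𝒪^*_{C,𝒟}`. -/
theorem IsSmoothCurve.mem_congrUnitStalk (hC : IsSmoothCurve O η) (hV : Module.finrank F V = 1)
    (hη : m η = 0) {p : X} {s s' : Ω[F⁄K]} (hs0 : s ≠ 0)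
    (hs : polarForms (O p) (m p) = Submodule.span (O p) {s})
    (hs' : polarForms (O p) (m p) = Submodule.span (O p) {s'})
    (ht : m p ≠ 0 → ∀ v ∈ M.stalk p,
      D.rel K v - s ⊗ₜ[F] v ∈ tensorStalk (O p) (regularForms (O p) K) (M.stalk p))
    (ht' : m p ≠ 0 → ∀ v ∈ M.stalk p,
      D.rel K v - s' ⊗ₜ[F] v ∈ tensorStalk (O p) (regularForms (O p) K) (M.stalk p))
    {a : Additive Fˣ} (ha : s = (a.toMul : F) • s') : a ∈ congrUnitStalk (O p) (m p) := by
  have hau := mem_unitStalk_of_span_eq hs0 (hs.symm.trans hs') ha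
  refine ⟨hau, ⟨(a.toMul : F) - 1, sub_mem hau.1 (one_mem _)⟩, ?_, rfl⟩
  by_cases hp : m p = 0
  · rw [hp, pow_zero, Ideal.one_eq_top]; trivial
  have hO := hC.point p fun h => hp (h ▸ hη)
  obtain ⟨z, hz⟩ := hO.exists_uniformizer
  obtain ⟨f, rfl⟩ := hO.exists_smul_D hz s'
  obtain ⟨u, hu⟩ := hO.exists_unit_of_polarForms_eq_span hz hs'
  obtain ⟨_, hxW, e, he, hW⟩ := M.exists_generator p trivial
  have hMe := hW p hxW trivial
  have hee : e ∈ M.stalk p := hMe ▸ Submodule.mem_span_singleton_self e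
  have h1 := sub_mem (ht' hp e hee) (ht hp e hee)
  rw [sub_sub_sub_cancel_left, ← TensorProduct.sub_tmul, hMe, tmul_mem_tensorStalk_iff hV he, ha,
    smul_smul, ← sub_smul, hO.smul_D_mem_iff hz] at h1
  -- `(a - 1) f` is regular and `f` has a pole of order exactly `m p`
  rw [hz, Ideal.span_singleton_pow, Ideal.mem_span_singleton]
  refine ⟨⟨_, h1⟩ * ((u⁻¹ : (O p)ˣ) : O p), Subtype.ext ?_⟩
  change (a.toMul : F) - 1 = (z : F) ^ m p * (((a.toMul : F) * f - f) * ((u⁻¹ : (O p)ˣ) : O p))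
  have hu0 := unit_ne_zero u
  rw [coe_inv_unit, ← hu]
  rw [← hu] at hu0
  have h2 := left_ne_zero_of_mul hu0
  have h3 := right_ne_zero_of_mul hu0
  field_simp

theorem IsTrivClass.unique (hC : IsSmoothCurve O η) (hV : Module.finrank F V = 1) (hη : m η = 0)
    {A A' : H1Pic O m} (hA : IsTrivClass m D M A) (hA' : IsTrivClass m D M A') : A = A' := by
  obtain ⟨W, s, l, hW, hs, ht, hl, rfl⟩ := hA
  obtain ⟨W', s', l', hW', hs', ht', hl', rfl⟩ := hA'
  have h0 : ∀ x, s x ≠ 0 := fun x => hC.ne_zero_of_polarForms_eq_span hη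
    (hs x η (hC.generic_mem _ ⟨x, hW x⟩))
  have h0' : ∀ x, s' x ≠ 0 := fun x => hC.ne_zero_of_polarForms_eq_span hη
    (hs' x η (hC.generic_mem _ ⟨x, hW' x⟩))
  choose a ha using fun x => exists_eq_unit_smul hC.finrank_eq_one (h0 x) (h0' x)
  rw [← sub_eq_zero, ← map_sub]
  refine (QuotientAddGroup.eq_zero_iff _).2 ⟨a, ⟨fun x => W x ⊓ W' x, fun x => ⟨hW x, hW' x⟩,
    fun x p hp => hC.mem_congrUnitStalk hV hη (h0 x) (hs x p hp.1) (hs' x p hp.2) (ht x p hp.1)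
      (ht' x p hp.2) (ha x)⟩, fun x y => ?_⟩
  change l.1 x y - l'.1 x y = a x - a y
  rw [sub_eq_sub_iff_add_eq_add]
  apply unit_smul_cancel (h0' y)
  simp only [toMul_add, Units.val_mul, mul_smul]
  rw [← ha y, ← hl' x y, ← hl x y, ha x]

theorem IsConnClass.unique (hC : IsSmoothCurve O η) (hV : Module.finrank F V = 1)
    {B B' : H1Conn O m k} (hB : IsConnClass m D M B) (hB' : IsConnClass m D M B') : B = B' := by
  obtain ⟨W, e, c, hW, he, hc, hD, rfl⟩ := hB
  obtain ⟨W', e', c', hW', he', hc', hD', rfl⟩ := hB'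
  have key : ∀ (x : X) (e : V), M.stalk x = Submodule.span (O x) {e} → e ≠ 0 := by
    rintro x _ h rfl
    obtain ⟨U, hx, e₁, he₁, hU⟩ := M.exists_generator x trivial
    have := hU x hx trivial ▸ Submodule.mem_span_singleton_self e₁
    rw [h, Submodule.span_zero_singleton, Submodule.mem_bot] at this
    exact he₁ this
  have h0 : ∀ x, e x ≠ 0 := fun x => key x _ (he x x (hW x))
  have h0' : ∀ x, e' x ≠ 0 := fun x => key x _ (he' x x (hW' x))
  choose b hb using fun x => exists_eq_unit_smul hV (h0 x) (h0' x)
  rw [← sub_eq_zero, ← map_sub]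
  refine (QuotientAddGroup.eq_zero_iff _).2 ⟨b, ⟨fun x => W x ⊓ W' x, fun x => ⟨hW x, hW' x⟩,
    fun x p hp => mem_unitStalk_of_span_eq (h0 x) ((he x p hp.1).symm.trans (he' x p hp.2))
      (hb x)⟩, fun x y => ?_, fun x => ?_⟩
  · change c.1.1 x y - c'.1.1 x y = b x - b y
    rw [sub_eq_sub_iff_add_eq_add]
    apply unit_smul_cancel (h0' y)
    simp only [toMul_add, Units.val_mul, mul_smul]
    rw [← hb y, ← hc' x y, ← hc x y, hb x]
  · change c.1.2 x - c'.1.2 x = _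
    have h1 := hD x
    nth_rw 1 [hb x] at h1
    rw [D.toFun_smul (hD' x), hb x, ← TensorProduct.smul_tmul] at h1
    have h2 := tmul_left_cancel hV (h0' x) h1
    rw [dlog_apply, sub_eq_iff_eq_add, Units.val_inv_eq_inv_val]
    apply smul_right_injective _ (Units.ne_zero (b x).toMul)
    dsimp only
    rw [← h2, smul_add, smul_smul, mul_inv_cancel₀ (Units.ne_zero _), one_smul, add_comm]

/-- Compatible generators on a neighbourhood `W` of `x`: `e` generates the invertible sheaf `M`
and has connection form `ω`, and `s` generates `Ω¹_{C/K}(𝒟)` and restricts to `triv ∇` along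
`𝒟`. -/
structure IsLocalFrame (m : X → ℕ) (D : Connection k F V)
    (M : InvertibleSheaf O V (Set.univ : Set X)) (x : X) (W : Opens X) (e : V) (s : Ω[F⁄K])
    (ω : Ω[F⁄k]) : Prop where
  mem : x ∈ W
  ne_zero : e ≠ 0
  stalk_eq : ∀ p ∈ W, M.stalk p = Submodule.span (O p) {e}
  polarForms_eq : ∀ p ∈ W, polarForms (O p) (m p) = Submodule.span (O p) {s}
  triv : ∀ p ∈ W, m p ≠ 0 → ∀ v ∈ M.stalk p,
    D.rel K v - s ⊗ₜ[F] v ∈ tensorStalk (O p) (regularForms (O p) K) (M.stalk p)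
  toFun_eq : D.toFun e = ω ⊗ₜ[F] e
  mem_logPolarForms : ∀ p ∈ W, ω ∈ logPolarForms (O p) k (m p)

/-- Both classes are computed by local frames, so that the pairing is a sum of residues. -/
theorem IsSmoothCurve.isPairing_iff (hC : IsSmoothCurve O η) (hV : Module.finrank F V = 1)
    (hη : m η = 0) {W : X → Opens X} {e : X → V} {s : X → Ω[F⁄K]} {ω : X → Ω[F⁄k]}
    (h : ∀ x, IsLocalFrame m D M x (W x) (e x) (s x) (ω x)) :
    ∃ a : X → Additive Fˣ, (∀ x, s x = ((a x).toMul : F) • s η) ∧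
      ∃ S₀ : Finset X, η ∉ S₀ ∧ ∀ S : Finset X, S₀ ⊆ S → η ∉ S → ∀ β : DlogQuotient k K,
        IsPairing m D M β ↔
          β = QuotientAddGroup.mk (-∑ x ∈ S, hC.res k x (wedge k (dlog k F (a x)) (ω x))) := by
  have h0 : ∀ x, s x ≠ 0 := fun x => hC.ne_zero_of_polarForms_eq_span hη
    ((h x).polarForms_eq η (hC.generic_mem _ ⟨x, (h x).mem⟩))
  choose l hl using fun x y => exists_eq_unit_smul hC.finrank_eq_one (h0 x) (h0 y)
  choose c hc using fun x y => exists_eq_unit_smul hV (h x).ne_zero (h y).ne_zero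
  have hlZ : l ∈ Z1Pic O m := by
    refine ⟨⟨W, fun x => (h x).mem, fun x y p hp => ?_⟩, fun x y z => ?_⟩
    · exact hC.mem_congrUnitStalk hV hη (h0 x) ((h x).polarForms_eq p hp.1)
        ((h y).polarForms_eq p hp.2) ((h x).triv p hp.1) ((h y).triv p hp.2) (hl x y)
    · apply unit_smul_cancel (h0 z)
      rw [toMul_add, Units.val_mul, mul_smul, ← hl y z, ← hl x y, ← hl x z]
  have hcZ : (c, ω) ∈ Z1Conn O m k := by
    refine ⟨⟨W, fun x => (h x).mem, fun x y p hp => ?_⟩, ⟨W, fun x => (h x).mem, fun x p hp =>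
      (h x).mem_logPolarForms p hp⟩, fun x y z => ?_, fun x y => ?_⟩
    · exact mem_unitStalk_of_span_eq (h x).ne_zero
        (((h x).stalk_eq p hp.1).symm.trans ((h y).stalk_eq p hp.2)) (hc x y)
    · apply unit_smul_cancel (h z).ne_zero
      rw [toMul_add, Units.val_mul, mul_smul, ← hc y z, ← hc x y, ← hc x z]
    · change dlog k F (c x y) = ω x - ω y
      have h1 := (h x).toFun_eq
      nth_rw 1 [hc x y] at h1
      rw [D.toFun_smul (h y).toFun_eq, hc x y, ← TensorProduct.smul_tmul] at h1
      have h2 := tmul_left_cancel hV (h y).ne_zero h1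
      rw [dlog_apply, eq_sub_iff_add_eq, Units.val_inv_eq_inv_val]
      apply smul_right_injective _ (Units.ne_zero (c x y).toMul)
      dsimp only
      rw [← h2, smul_add, smul_smul, mul_inv_cancel₀ (Units.ne_zero _), one_smul, add_comm]
  have hA : IsTrivClass m D M (H1Pic.mk O m ⟨l, hlZ⟩) :=
    ⟨W, s, ⟨l, hlZ⟩, fun x => (h x).mem, fun x => (h x).polarForms_eq, fun x => (h x).triv, hl,
      rfl⟩
  have hB : IsConnClass m D M (H1Conn.mk O m k ⟨(c, ω), hcZ⟩) :=
    ⟨W, e, ⟨(c, ω), hcZ⟩, fun x => (h x).mem, fun x => (h x).stalk_eq, hc,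
      fun x => (h x).toFun_eq, rfl⟩
  obtain ⟨S₀, hS₀, hS⟩ := hC.exists_isTrace_cup ⟨l, hlZ⟩ ⟨(c, ω), hcZ⟩
  refine ⟨fun x => l x η, fun x => hl x η, S₀, hS₀, fun S hSS hηS β => ⟨?_, ?_⟩⟩
  · rintro ⟨A, B, hA', hB', hT⟩
    rw [hA'.unique hC hV hη hA, hB'.unique hC hV hB] at hT
    exact hC.isTrace_unique hT (hS S hSS hηS)
  · rintro rfl
    exact ⟨_, _, hA, hB, hS S hSS hηS⟩

/-- At a point of `𝒟`, a generator of a good extension with connection form `ω` gives a frame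
in which `triv ∇` is represented by the relative connection form. -/
theorem IsGoodExtension.exists_isLocalFrame (hM : IsGoodExtension (K := K) m D L M)
    (hC : IsSmoothCurve O η) (hV : Module.finrank F V = 1) (hη : m η = 0)
    (hm : {x | m x ≠ 0}.Finite) (hL : D.IsRegularOn L) (hD : D.HasVerticalCurvature K)
    {x : X} (hx : m x ≠ 0) {W : Opens X} (hxW : x ∈ W) {e : V} (he : e ≠ 0)
    (hMe : ∀ p ∈ W, M.stalk p = Submodule.span (O p) {e}) {ω : Ω[F⁄k]}
    (hω : D.toFun e = ω ⊗ₜ e) :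
    ∃ W' : Opens X, IsLocalFrame m D M x W' e (relForm k K ω) ω := by
  have hxη : x ≠ η := fun h => hx (h ▸ hη)
  have hO := hC.point x hxη
  obtain ⟨z, hz⟩ := hO.exists_uniformizer
  obtain ⟨f, hf⟩ := hO.exists_smul_D hz (relForm k K ω)
  obtain ⟨u, hu⟩ := hM.exists_unit hC hV hx hxη hz he (hMe x hxW) hω hf
  have hf0 : f ≠ 0 := right_ne_zero_of_mul (hu ▸ unit_ne_zero u : (z : F) ^ m x * f ≠ 0)
  have hr0 : relForm k K ω ≠ 0 := by
    rw [hf]; exact smul_ne_zero hf0 (hO.D_ne_zero hz)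
  obtain ⟨W₁, hx₁, hW₁⟩ := hC.exists_opens_regularForms hr0 x
  obtain ⟨W₂, hx₂, hW₂⟩ := hC.exists_opens (T := {x | m x ≠ 0} \ {x})
    (hm.subset Set.diff_subset) (fun h => h.1 hη) (x := x) (fun h => h.2 rfl)
  have hmp : ∀ p ∈ W₂, p ≠ x → m p = 0 := fun p hp hpx =>
    by_contra fun h => hW₂ p hp ⟨h, hpx⟩
  refine ⟨W ⊓ W₁ ⊓ W₂, ⟨⟨hxW, hx₁⟩, hx₂⟩, he, fun p hp => hMe p hp.1.1, fun p hp => ?_,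
    fun p hp hp0 v hv => ?_, hω, fun p hp => ?_⟩
  · rcases eq_or_ne p x with rfl | hpx
    · rw [hf]; exact hO.polarForms_eq_span hz u hu
    · rw [hmp p hp.2 hpx, polarForms_zero]; exact hW₁ p hp.1.2 hpx
  · rw [hMe p hp.1.1] at hv ⊢
    obtain ⟨a, rfl⟩ := Submodule.mem_span_singleton.1 hv
    rw [show a • e = (a : F) • e from rfl, D.rel_smul hω, ← TensorProduct.smul_tmul,
      ← TensorProduct.sub_tmul, add_sub_cancel_left, tmul_mem_tensorStalk_iff hV he]
    exact D_mem_regularForms a.2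
  · rcases eq_or_ne p x with rfl | hpx
    · obtain ⟨i, hi⟩ := Nat.exists_eq_succ_of_ne_zero hx
      rw [hi] at hu ⊢
      exact hO.mem_logPolarForms hz (hD.extDeriv_mem hV he hω) hf (hu ▸ u.1.2)
    · have h0 := hmp p hp.2 hpx
      have h1 := hL p h0 e (by
        rw [← hM.stalk_eq p h0, hMe p hp.1.1]; exact Submodule.mem_span_singleton_self e)
      rw [← hM.stalk_eq p h0, hMe p hp.1.1, hω, tmul_mem_tensorStalk_iff hV he] at h1
      rw [h0]; exact h1

/-- Frames of two good extensions at a point.  The contributions of the point to the two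
pairings agree up to an element of `dlog K^*`. -/
theorem IsGoodExtension.exists_isLocalFrame_pair {M' : InvertibleSheaf O V (Set.univ : Set X)}
    (hM : IsGoodExtension (K := K) m D L M) (hM' : IsGoodExtension (K := K) m D L M')
    (hC : IsSmoothCurve O η) (hV : Module.finrank F V = 1) (hη : m η = 0)
    (hm : {x | m x ≠ 0}.Finite) (hL : D.IsRegularOn L) (hD : D.HasVerticalCurvature K) (x : X) :
    ∃ (W W' : Opens X) (e e' : V) (s s' : Ω[F⁄K]) (ω ω' : Ω[F⁄k]),
      IsLocalFrame m D M x W e s ω ∧ IsLocalFrame m D M' x W' e' s' ω' ∧ (x = η → s = s') ∧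
      ∀ (σ : Ω[F⁄K]) (a a' : Additive Fˣ), σ ≠ 0 → s = (a.toMul : F) • σ →
        s' = (a'.toMul : F) • σ →
        hC.res k x (wedge k (dlog k F a) ω) - hC.res k x (wedge k (dlog k F a') ω') ∈
          (dlog k K).range := by
  obtain ⟨W, hxW, e, he, hMe⟩ := M.exists_generator x trivial
  obtain ⟨ω, hω⟩ := exists_eq_tmul hV he (D.toFun e)
  replace hMe : ∀ p ∈ W, M.stalk p = Submodule.span (O p) {e} := fun p hp => hMe p hp trivial
  by_cases hx : m x = 0
  · have hs : ∃ s : Ω[F⁄K], s ≠ 0 ∧ regularForms (O x) K = Submodule.span (O x) {s} := by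
      rcases eq_or_ne x η with rfl | hxη
      · obtain ⟨t, ht⟩ := hC.exists_D_ne_zero
        exact ⟨_, ht, hC.regularForms_generic_eq_span ht⟩
      · have hO := hC.point x hxη
        obtain ⟨z, hz⟩ := hO.exists_uniformizer
        exact ⟨_, hO.D_ne_zero hz, hO.regularForms_eq hz⟩
    obtain ⟨s, hs0, hs⟩ := hs
    obtain ⟨W₁, hx₁, hW₁⟩ := hC.exists_opens_regularForms hs0 x
    obtain ⟨W₂, hx₂, hW₂⟩ := hC.exists_opens hm (fun h => h hη) (x := x) (fun h => h hx)
    have hmp : ∀ p ∈ W₂, m p = 0 := fun p hp => by_contra fun h => hW₂ p hp h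
    have hML : ∀ p ∈ W₂, M.stalk p = L.stalk p := fun p hp => hM.stalk_eq p (hmp p hp)
    have hsp : ∀ p ∈ W ⊓ W₁ ⊓ W₂, polarForms (O p) (m p) = Submodule.span (O p) {s} := by
      intro p hp
      rw [hmp p hp.2, polarForms_zero]
      rcases eq_or_ne p x with rfl | hpx
      · exact hs
      · exact hW₁ p hp.1.2 hpx
    have hlog : ∀ p ∈ W ⊓ W₁ ⊓ W₂, ω ∈ logPolarForms (O p) k (m p) := by
      intro p hp
      have h1 := hL p (hmp p hp.2) e (by
        rw [← hML p hp.2, hMe p hp.1.1]; exact Submodule.mem_span_singleton_self e)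
      rw [← hML p hp.2, hMe p hp.1.1, hω, tmul_mem_tensorStalk_iff hV he] at h1
      rw [hmp p hp.2]; exact h1
    have hmem : x ∈ W ⊓ W₁ ⊓ W₂ := ⟨⟨hxW, hx₁⟩, hx₂⟩
    refine ⟨_, _, e, e, s, s, ω, ω,
      ⟨hmem, he, fun p hp => hMe p hp.1.1, hsp, fun p hp h => (h (hmp p hp.2)).elim, hω, hlog⟩,
      ⟨hmem, he, fun p hp => ?_, hsp, fun p hp h => (h (hmp p hp.2)).elim, hω, hlog⟩,
      fun _ => rfl, fun σ a a' hσ ha ha' => ?_⟩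
    · rw [hM'.stalk_eq p (hmp p hp.2), ← hML p hp.2]; exact hMe p hp.1.1
    · rw [unit_smul_cancel hσ (ha.symm.trans ha'), sub_self]; exact zero_mem _
  have hxη : x ≠ η := fun h => hx (h ▸ hη)
  have hO := hC.point x hxη
  obtain ⟨z, hz⟩ := hO.exists_uniformizer
  have hz0 := hO.ne_zero hz
  obtain ⟨W', hxW', e₁, he₁, hMe₁⟩ := M'.exists_generator x trivial
  obtain ⟨h, hh⟩ := exists_eq_unit_smul hV he₁ he
  obtain ⟨N, u, hu⟩ := hO.exists_eq_mul_zpow hz (Units.ne_zero h.toMul)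
  -- a unit factor changes the generator of the second sheaf into `z ^ N • e`
  set e' : V := (z : F) ^ N • e with he'
  have hu0 := unit_ne_zero u
  have he₁' : e₁ = (u : F) • e' := by rw [hh, hu, mul_smul]
  have he0' : e' ≠ 0 := smul_ne_zero (zpow_ne_zero _ hz0) he
  obtain ⟨U, hxU, hU⟩ := hC.spread x u u.1.2
  obtain ⟨U', hxU', hU'⟩ := hC.spread x ((u⁻¹ : (O x)ˣ) : O x) (u⁻¹ : (O x)ˣ).1.2
  have hMe' : ∀ p ∈ W' ⊓ U ⊓ U', M'.stalk p = Submodule.span (O p) {e'} := fun p hp => by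
    have h1 := hU' p hp.2
    rw [coe_inv_unit] at h1
    rw [hMe₁ p hp.1.1 trivial, he₁', span_unit_smul (hU p hp.1.2) h1 hu0]
  set ω' : Ω[F⁄k] := ω + (N * (z : F)⁻¹) • KaehlerDifferential.D k F (z : F) with hω'
  set ζ : Additive Fˣ := Additive.ofMul (Units.mk0 (z : F) hz0) with hζ
  have hζN : dlog k F (N • ζ) = (N * (z : F)⁻¹) • KaehlerDifferential.D k F (z : F) := by
    rw [map_zsmul, dlog_apply, mul_smul, Int.cast_smul_eq_zsmul]; rfl
  have hDe' : D.toFun e' = ω' ⊗ₜ e' := by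
    have h1 : (((N • ζ).toMul : Fˣ) : F) = (z : F) ^ N := by
      rw [hζ, toMul_zsmul, toMul_ofMul, Units.val_zpow_eq_zpow_val, Units.val_mk0]
    have h2 : KaehlerDifferential.D k F ((z : F) ^ N) =
        (z : F) ^ N • ((N * (z : F)⁻¹) • KaehlerDifferential.D k F (z : F)) := by
      rw [← hζN, dlog_apply, Units.val_inv_eq_inv_val, h1, smul_smul,
        mul_inv_cancel₀ (zpow_ne_zero _ hz0), one_smul]
    rw [he', D.toFun_smul hω, h2, ← smul_add, ← hω', TensorProduct.smul_tmul]
  obtain ⟨W₁, h₁⟩ := hM.exists_isLocalFrame hC hV hη hm hL hD hx hxW he hMe hω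
  obtain ⟨W₂, h₂⟩ := hM'.exists_isLocalFrame hC hV hη hm hL hD hx
    (⟨⟨hxW', hxU⟩, hxU'⟩ : x ∈ W' ⊓ U ⊓ U') he0' hMe' hDe'
  refine ⟨W₁, W₂, e, e', _, _, ω, ω', h₁, h₂, fun h => (hxη h).elim, fun σ a a' hσ ha ha' => ?_⟩
  obtain ⟨f, hf⟩ := hO.exists_smul_D hz (relForm k K ω)
  have hf' : relForm k K ω' = (f + N * (z : F)⁻¹) • KaehlerDifferential.D K F (z : F) := by
    rw [hω', map_add, map_smul, relForm_D, hf, add_smul]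
  obtain ⟨i, hi⟩ := Nat.exists_eq_succ_of_ne_zero hx
  obtain ⟨v, hv⟩ := hM.exists_unit hC hV hx hxη hz he (hMe x hxW) hω hf
  obtain ⟨v', hv'⟩ := hM'.exists_unit hC hV hx hxη hz he0'
    (hMe' x ⟨⟨hxW', hxU⟩, hxU'⟩) hDe' hf'
  rw [hi] at hv hv'
  have hg : (((a' - a).toMul : Fˣ) : F) * f = f + N * (z : F)⁻¹ := by
    apply smul_left_injective F (hO.D_ne_zero hz)
    dsimp only
    rw [← hf', ha', mul_smul, ← hf, ha, toMul_sub, smul_smul, ← Units.val_mul, div_mul_cancel]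
  have hres := hC.res_eq hxη (hO.hasResidue₂_dlog_quotient hz (hD.extDeriv_mem hV he hω) hf hv hv'
    rfl hg)
  have hsplit : wedge k (dlog k F a) ω - wedge k (dlog k F a') ω' =
      -(wedge k (dlog k F (a' - a)) ω' + dlog₂ k F (symb a (N • ζ))) := by
    rw [dlog₂_symb, hζN, show (N * (z : F)⁻¹) • KaehlerDifferential.D k F (z : F) = ω' - ω by
      rw [hω', add_sub_cancel_left]]
    simp only [map_sub, LinearMap.sub_apply]
    abel
  rw [← map_sub, hsplit, map_neg, map_add, hres, zero_add]
  exact neg_mem (hC.res_dlog₂ x _)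

/-- The theorem for the abstract curve: the pairing is defined for every good extension, and
does not depend on it. -/
theorem IsSmoothCurve.exists_isPairing_iff {M' : InvertibleSheaf O V (Set.univ : Set X)}
    (hC : IsSmoothCurve O η) (hV : Module.finrank F V = 1) (hη : m η = 0)
    (hm : {x | m x ≠ 0}.Finite) (hL : D.IsRegularOn L) (hD : D.HasVerticalCurvature K)
    (hM : IsGoodExtension (K := K) m D L M) (hM' : IsGoodExtension (K := K) m D L M') :
    ∃ α : DlogQuotient k K,
      (∀ β, IsPairing m D M β ↔ β = α) ∧ (∀ β, IsPairing m D M' β ↔ β = α) := by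
  classical
  choose W W' e e' s s' ω ω' h h' hs hres using fun x =>
    hM.exists_isLocalFrame_pair hM' hC hV hη hm hL hD x
  obtain ⟨a, ha, S, hS, hS'⟩ := hC.isPairing_iff hV hη h
  obtain ⟨a', ha', T, hT, hT'⟩ := hC.isPairing_iff hV hη h'
  have hST : η ∉ S ∪ T := by simp [hS, hT]
  have hσ : s η ≠ 0 := hC.ne_zero_of_polarForms_eq_span hη
    ((h η).polarForms_eq η (h η).mem)
  refine ⟨_, hS' (S ∪ T) Finset.subset_union_left hST, fun β => ?_⟩
  rw [hT' (S ∪ T) Finset.subset_union_right hST β]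
  suffices heq : (QuotientAddGroup.mk (-∑ x ∈ S ∪ T, hC.res k x (wedge k (dlog k F (a' x)) (ω' x))) :
      DlogQuotient k K) =
      QuotientAddGroup.mk (-∑ x ∈ S ∪ T, hC.res k x (wedge k (dlog k F (a x)) (ω x))) by rw [heq]
  rw [QuotientAddGroup.eq, neg_neg, ← sub_eq_add_neg, ← Finset.sum_sub_distrib]
  rw [← neg_mem_iff, ← Finset.sum_neg_distrib]
  refine sum_mem fun x _ => ?_
  rw [neg_sub]
  refine hres x (s η) (a x) (a' x) hσ (ha x) ?_
  rw [ha' x, hs η rfl]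

end Classes

/-! ### The generic point -/

/-- The residue field at the generic point is larger than `K`. -/
theorem IsSmoothCurve.exists_sub_algebraMap_ne {K : Type u} {F : Type w} {X : Type u} [Field K]
    [CharZero K] [Field F] [Algebra K F] [TopologicalSpace X] {O : X → Subalgebra K F}
    [∀ x, IsLocalRing (O x)] {η : X}
    (hC : IsSmoothCurve O η) :
    ∃ a : O η, ∀ r : K, a - algebraMap K _ r ∉ maximalIdeal (O η) := by
  obtain ⟨t, ht⟩ := hC.exists_D_ne_zero
  have hmem : ∀ g : F, g ∈ O η := fun g => hC.generic ▸ Algebra.mem_top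
  refine ⟨⟨t, hmem t⟩, fun r hr => ?_⟩
  rw [mem_maximalIdeal, mem_nonunits_iff] at hr
  apply ht
  have h0 : t - algebraMap K F r = 0 := by
    by_contra h0
    exact hr (IsUnit.of_mul_eq_one (⟨_, hmem (t - algebraMap K F r)⁻¹⟩ : O η)
      (Subtype.ext (mul_inv_cancel₀ h0)))
  rw [sub_eq_zero.1 h0, Derivation.map_algebraMap]

end CurvePairing
end

theorem theorem4p4 {k : Type v} {K : Type u} [Field k] [IsAlgClosed k] [CharZero k] [Field K]
    [Algebra k K] {C : Scheme.{u}} [IsIntegral C] (f : C ⟶ Spec (.of K)) [IsProper f]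
    [SmoothOfRelativeDimension 1 f] (𝒟 : C →₀ ℕ)
    (h𝒟 : ∀ c ∈ 𝒟.support, CurvePairing.IsRationalPoint f c)
    {V : Type w} [AddCommGroup V] [Module (CurvePairing.FunctionField f) V]
    (hV : Module.finrank (CurvePairing.FunctionField f) V = 1)
    (L : CurvePairing.InvertibleSheaf (CurvePairing.localRing f) V {x | 𝒟 x = 0})
    (D : CurvePairing.Connection k (CurvePairing.FunctionField f) V)
    (hL : D.IsRegularOn L) (hD : D.HasVerticalCurvature K)
    (M M' : CurvePairing.InvertibleSheaf (CurvePairing.localRing f) V Set.univ)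
    (hM : CurvePairing.IsGoodExtension 𝒟 D L M) (hM' : CurvePairing.IsGoodExtension 𝒟 D L M') :
    ∃ α : CurvePairing.DlogQuotient k K,
      (∀ β, CurvePairing.IsPairing 𝒟 D M β ↔ β = α) ∧
      (∀ β, CurvePairing.IsPairing 𝒟 D M' β ↔ β = α) := by
  have : CharZero K := charZero_of_injective_algebraMap (algebraMap k K).injective
  have hC := CurvePairing.isSmoothCurve f
  -- the points of the divisor are rational, hence closed
  have hη : 𝒟 (genericPoint C) = 0 := by
    by_contra h
    obtain ⟨a, ha⟩ := hC.exists_sub_algebraMap_ne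
    obtain ⟨r, hr⟩ := CurvePairing.IsRationalPoint.exists_sub_mem f
      (h𝒟 _ (Finsupp.mem_support_iff.2 h)) a
    exact ha r hr
  have hm : {x | 𝒟 x ≠ 0}.Finite := 𝒟.finite_support
  exact hC.exists_isPairing_iff hV hη hm hL hD hM hM'
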